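/- Let $d\ge 1$ and $m>n>1$ with $\gcd(n,m)=1$. Let $(C,0)$ be a generic irreducible plane curve singularity over $\mathbb{C}$, parametrized by $x(t)=t^{dn}$, $y(t)=t^{dm}+\lambda t^{dm+1}+(\text{higher order terms})$, $\lambda\neq0$. Put $E=\mathbb{C}((t))$, $\tilde R=\mathbb{C}[[t]]$, let $R=\mathbb{C}[[x(t),y(t)]]\subset\tilde R$, $\delta=\dim_{\mathbb{C}}\tilde R/R$, and $\Gamma=\mathrm{ord}_t(R)$, the set of valuations of nonzero elements of $R$. For $\Delta\subset\mathbb{N}$ put $e(\Delta)=\delta-|\mathbb{N}\setminus\Delta|$. Let $\mathcal{A}dm(dn,dm)$ be the set of $\Delta\subset\mathbb{N}$ with $0\in\Delta$ and $\Gamma+\Delta\subset\Delta$ such that for every $0\le i\le d-1$ there is $a\in\Delta$ with $a-dn\notin\Delta$, $a\equiv i \pmod d$ and $a+dm+1\in\Delta$. Let $\mathrm{Hilb}^{[\tau]}(C,0)$ be the variety of ideals $I\subset R$ with $\dim_{\mathbb{C}} R/I=\tau$, put $I^{-1}=\{z\in E: zI\subset R\}$, and let $$H_\Delta^{[\tau]}=\{I\in\mathrm{Hilb}^{[\tau]}(C,0):\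 \mathrm{ord}_t(t^{\tau-e(\Delta)}I^{-1})=\Delta\}.$$ A box is a lattice unit square, identified with its top-left vertex $(x,y)$; put $\mathrm{rk}(x,y)=mx-ny$. Let $\mathcal{R}^+$ be the set of boxes $(x,y)$ with $0\le x\le dn-1$ and $1\le y\le \frac{m}{n}x$. A $(dn,dm)$-Dyck path $D$ is a sequence $0\le y_0\le y_1\le\dots\le y_{dn-1}$ of integers with $y_x\le\lfloor mx/n\rfloor$, identified with the set of boxes $(x,y)$, $1\le y\le y_x$; put $|D|=\sum_x y_x$. For $z=(x,y)\in D$ let $\mathfrak{a}(z)$ and $\mathfrak{l}(z)$ be the numbers of boxes of $D$ to the left of $z$ in its row, respectively above $z$ in its column. For $0\le i\le d-1$, $0\le j\le n-1$ write $y_{i,j}=y_{in+j}$ and $\mathrm{rk}_{D,i,j}=m(in+j)-ny_{i,j}$. Given $D$, let $w^{[0]}=(m x-n y_x)_{0\le x\le dn-1}$, and for $u=d-1,d-2,\dots,1$ let $$\mathbf{p}_u=\max\{0\le x\le un:\ w^{[d-u-1]}_x\le w^{[d-u-1]}_{x+n-1}+m\}$$ and let $w^{[d-u]}$ be $w^{[d-u-1]}$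 with the entries of index $\mathbf{p}_u,\dots,\mathbf{p}_u+n-1$ deleted. For $0\le j\le n-1$, $1\le u\le d-1$ let $\mathbf{i}_{j,u}=\min\{0\le i\le u: in+j\ge\mathbf{p}_u\}$, let $\mathbf{s}_{j,u}$ be the cycle $\mathbf{i}_{j,u}\mapsto \mathbf{i}_{j,u}+1\mapsto\dots\mapsto u\mapsto \mathbf{i}_{j,u}$, a permutation of $\{0,\dots,d-1\}$, and put $\mathbf{s}_j=\mathbf{s}_{j,d-1}\circ\dots\circ\mathbf{s}_{j,1}$. Put $c_{i,j}=y_{\mathbf{s}_j(i),j}-(\mathbf{s}_j(i)-i)m$ and $$\Psi_d(D)=\bigcup_{0\le i\le d-1,\ 0\le j\le n-1}\bigl(jdm+(dmn+1)i-dn\,c_{i,j}+dn\,\mathbb{N}\bigr).$$ The enhanced rank of a box $(in+j,y)$ is $\widehat{\mathrm{rk}}_D(in+j,y)=d\cdot\mathrm{rk}(in+j,y)+\mathbf{s}_j^{-1}(i)$. **Proposition.** Let $D$ be a $(dn,dm)$-Dyck path and $\Delta=\Psi_d(D)$. Then $\Delta\in\mathcal{A}dm(dn,dm)$. Every $\tau_0\in\mathbb{N}$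 can be written uniquely as $\tau_0=dr+k$, $r=m\ell-nh$, with integers $0\le k\le d-1$, $0\le\ell\le n-1$, $h\le\lfloor m\ell/n\rfloor$, and: 1. $\tau_0\in\Delta \iff h\le y_{\mathbf{s}_\ell(k),\ell}-\mathbf{s}_\ell(k)\,m \iff r\ge\mathrm{rk}_{D,\mathbf{s}_\ell(k),\ell}$. 2. Define $\varepsilon_D(\tau_0)=|\{z\in\mathcal{R}^+\setminus D:\mathrm{rk}(z)=r,\ \widehat{\mathrm{rk}}_D(z)<\tau_0\}|$ and $\hat\varepsilon_D(\tau_0)=|\{z\in\mathcal{R}^+\setminus D:\widehat{\mathrm{rk}}_D(z)<\tau_0\}|$. Then $$\varepsilon_D(\tau_0)=|\{0\le i\le k-1:\mathrm{rk}_{D,\mathbf{s}_\ell(i),\ell}>r\}|,\qquad \hat\varepsilon_D(\tau_0)=|\{z\in\mathcal{R}^+\setminus D:\mathrm{rk}(z)<r\}|+\varepsilon_D(\tau_0),$$ and $\varepsilon_D(\tau_0)=0$ if $\tau_0\in\Gamma$. If $\tau_0\in\Delta$, then the cell $H_\Delta^{[\tau_0+|D|]}$ has dimension $$\dim H_\Delta^{[\tau_0+|D|]}=\Bigl|\Bigl\{z\in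 D:\ \tfrac{\mathfrak{l}(z)}{\mathfrak{a}(z)+1}>\tfrac mn\ \text{ or }\ \tfrac{\mathfrak{l}(z)+1}{\mathfrak{a}(z)}\le\tfrac mn\Bigr\}\Bigr|+\hat\varepsilon_D(\tau_0),$$ where the second fraction is read as $+\infty$ if $\mathfrak{a}(z)=0$. -/

import Mathlib

/-!
# Cells of punctual Hilbert schemes of generic plane curve branches, and Dyck paths
-/

noncomputable section

/-! ## The Zariski topology on Grassmannians of finite-codimensional subspaces -/

/-- The Zariski topology on the affine space `σ → ℂ` (closed points): the non-vanishing loci of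
polynomials form a basis of open sets. -/
@[reducible]
def zariskiTopology (σ : Type*) : TopologicalSpace (σ → ℂ) :=
  TopologicalSpace.generateFrom
    {U | ∃ p : MvPolynomial σ ℂ, U = {v | MvPolynomial.eval v p ≠ 0}}

/-- Surjective linear maps `V → ℂ^k`, i.e. codimension `k` subspaces of `V` together with a basis
of the quotient. -/
def FramedQuotient (V : Type*) [AddCommGroup V] [Module ℂ V] (k : ℕ) : Type _ :=
  {q : V →ₗ[ℂ] (Fin k → ℂ) // Function.Surjective q}

/-- The Zariski topology on framed quotients, with the matrix entries `q ↦ q v i` as coordinate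
functions. -/
instance FramedQuotient.instTopologicalSpace (V : Type*) [AddCommGroup V] [Module ℂ V] (k : ℕ) :
    TopologicalSpace (FramedQuotient V k) :=
  TopologicalSpace.induced (fun q (vi : V × Fin k) => q.1 vi.1 vi.2) (zariskiTopology (V × Fin k))

/-- A subspace with `k`-dimensional quotient, as a point of the Grassmannian. -/
def grassmannianMk {V : Type*} [AddCommGroup V] [Module ℂ V] (k : ℕ) (W : Submodule ℂ V)
    (hf : Module.Finite ℂ (V ⧸ W)) (hk : Module.finrank ℂ (V ⧸ W) = k) :
    Module.Grassmannian ℂ V k where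
  toSubmodule := W
  finite_quotient := hf
  projective_quotient := inferInstance
  rankAtStalk_eq p := by
    rw [Module.rankAtStalk_eq_finrank_of_free]
    simpa using hk

/-- The subspace underlying a framed quotient: the kernel. -/
def FramedQuotient.toGrassmannian {V : Type*} [AddCommGroup V] [Module ℂ V] {k : ℕ}
    (q : FramedQuotient V k) : Module.Grassmannian ℂ V k :=
  grassmannianMk k (LinearMap.ker q.1)
    (Module.Finite.equiv (q.1.quotKerEquivOfSurjective q.2).symm)
    (by rw [(q.1.quotKerEquivOfSurjective q.2).finrank_eq]; simp)

/-- The Zariski topology on the Grassmannian of codimension `k` subspaces of `V`: the Grassmannian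
is the quotient of the variety of surjective linear maps `V → ℂ^k` by `GL_k`. -/
instance grassmannianTopology (V : Type*) [AddCommGroup V] [Module ℂ V] (k : ℕ) :
    TopologicalSpace (Module.Grassmannian ℂ V k) :=
  TopologicalSpace.coinduced FramedQuotient.toGrassmannian inferInstance

/-! ## Generic irreducible plane curve singularities -/

open scoped PowerSeries LaurentSeries

/-- A generic irreducible (singular) plane curve branch of type `(d, n, m)`: it is parametrized by
`x(t) = t^{dn}`, `y(t) = t^{dm} + λ t^{dm+1} + higher order terms`, where `λ ≠ 0`, `d ≥ 1`,
`m > n > 1` and `gcd(n, m) = 1`. -/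
structure GenericBranch (d n m : ℕ) where
  d_pos : 0 < d
  one_lt_n : 1 < n
  n_lt_m : n < m
  coprime : Nat.Coprime n m
  /-- the power series `y(t)` -/
  y : ℂ⟦X⟧
  coeff_of_lt : ∀ j < d * m, PowerSeries.coeff j y = 0
  coeff_dm : PowerSeries.coeff (d * m) y = 1
  coeff_succ_ne_zero : PowerSeries.coeff (d * m + 1) y ≠ 0

/-- `ord_t(J)`: the set of valuations of the nonzero elements of `J ⊆ ℂ((t))`. -/
def valuationSet (J : Set ℂ⸨X⸩) : Set ℤ :=
  {a | ∃ z ∈ J, z ≠ 0 ∧ HahnSeries.order z = a}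

/-- `|ℕ ∖ Δ|`. -/
def gapCount (Δ : Set ℤ) : ℕ := {a : ℤ | 0 ≤ a ∧ a ∉ Δ}.ncard

namespace GenericBranch

variable {d n m : ℕ}

/-- The pair `(x(t), y(t))`. -/
def param (C : GenericBranch d n m) : Fin 2 → ℂ⟦X⟧ := ![PowerSeries.X ^ (d * n), C.y]

theorem hasSubst_param (C : GenericBranch d n m) : MvPowerSeries.HasSubst C.param := by
  have hn := C.one_lt_n
  have hm := C.n_lt_m
  refine MvPowerSeries.hasSubst_of_constantCoeff_zero fun s => ?_
  fin_cases s
  · change PowerSeries.constantCoeff ((PowerSeries.X : ℂ⟦X⟧) ^ (d * n)) = 0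
    have h0 : n ≠ 0 := by omega
    simp [C.d_pos.ne', h0]
  · change PowerSeries.constantCoeff C.y = 0
    rw [← PowerSeries.coeff_zero_eq_constantCoeff_apply]
    exact C.coeff_of_lt 0 (Nat.mul_pos C.d_pos (by omega))

/-- The completed local ring `R = ℂ[[x(t), y(t)]] ⊆ ℂ[[t]]`: the image of
`ℂ[[X, Y]] → ℂ[[t]]`, `F ↦ F(x(t), y(t))`. -/
def localRing (C : GenericBranch d n m) : Subalgebra ℂ ℂ⟦X⟧ :=
  (MvPowerSeries.substAlgHom (R := ℂ) C.hasSubst_param).range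

/-- `R` as a subset of `E = ℂ((t))`. -/
def ringInE (C : GenericBranch d n m) : Set ℂ⸨X⸩ :=
  {z | ∃ f : C.localRing, z = HahnSeries.ofPowerSeries ℤ ℂ (f : ℂ⟦X⟧)}

/-- The semigroup of valuations `Γ = ord_t(R)`. -/
def Γ (C : GenericBranch d n m) : Set ℤ := valuationSet C.ringInE

/-- The `δ`-invariant `dim ℂ[[t]] / R`. -/
def delta (C : GenericBranch d n m) : ℕ :=
  Module.finrank ℂ (ℂ⟦X⟧ ⧸ Subalgebra.toSubmodule C.localRing)

/-- `e(Δ) = δ - |ℕ ∖ Δ|`. -/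
def e (C : GenericBranch d n m) (Δ : Set ℤ) : ℤ := (C.delta : ℤ) - gapCount Δ

/-- The punctual Hilbert scheme `Hilb^{[τ]}(C, 0)` (its closed points): ideals of `R` of
colength `τ`. -/
def Hilb (C : GenericBranch d n m) (τ : ℕ) : Type :=
  {I : Ideal C.localRing // Module.Finite ℂ (C.localRing ⧸ I.restrictScalars ℂ) ∧
    Module.finrank ℂ (C.localRing ⧸ I.restrictScalars ℂ) = τ}

/-- The Zariski topology on `Hilb^{[τ]}(C, 0)`, as a subspace of the Grassmannian of codimension
`τ` subspaces of `R`. -/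
instance (C : GenericBranch d n m) (τ : ℕ) : TopologicalSpace (C.Hilb τ) :=
  TopologicalSpace.induced
    (fun I => grassmannianMk τ (I.1.restrictScalars ℂ) I.2.1 I.2.2) inferInstance

/-- The dual module `I⁻¹ = {z ∈ E : z I ⊆ R}`. -/
def dual (C : GenericBranch d n m) (I : Ideal C.localRing) : Set ℂ⸨X⸩ :=
  {z | ∀ f ∈ I, z * HahnSeries.ofPowerSeries ℤ ℂ (f : ℂ⟦X⟧) ∈ C.ringInE}

/-- The cell `H_Δ^{[τ]} ⊆ Hilb^{[τ]}(C, 0)`: ideals `I` with `ord_t(t^{τ - e(Δ)} I⁻¹) = Δ`. -/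
def cell (C : GenericBranch d n m) (Δ : Set ℤ) (τ : ℕ) : Set (C.Hilb τ) :=
  {I | valuationSet {w | ∃ z ∈ C.dual I.1, w = HahnSeries.single ((τ : ℤ) - C.e Δ) (1 : ℂ) * z}
    = Δ}

/-- `𝒜dm(dn, dm)`: the set of `0`-normalized `Γ`-semimodules `Δ` that are admissible, i.e. for each
`0 ≤ i ≤ d - 1` there is a `dn`-generator `a ≡ i (mod d)` of `Δ` with `a + dm + 1 ∈ Δ`. -/
def Adm (C : GenericBranch d n m) : Set (Set ℤ) :=
  {Δ | (∀ b ∈ Δ, 0 ≤ b) ∧ (0 : ℤ) ∈ Δ ∧ (∀ a ∈ C.Γ, ∀ b ∈ Δ, a + b ∈ Δ) ∧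
    ∀ i : ℕ, i < d → ∃ a ∈ Δ, a - d * n ∉ Δ ∧ a ≡ i [ZMOD d] ∧ a + d * m + 1 ∈ Δ}

end GenericBranch

/-! ## Dyck paths -/

/-- A `(dn, dm)`-Dyck path, given by the column heights `y_0 ≤ y_1 ≤ ⋯ ≤ y_{dn-1}` of the Young
diagram below it, where `y_x ≤ ⌊m x / n⌋`. -/
structure RationalDyckPath (d n m : ℕ) where
  height : Fin (d * n) → ℕ
  height_le : ∀ x, height x ≤ m * x / n
  mono : Monotone height

/-- `rk(x, y) = m x - n y`. -/
def boxRank (n m : ℕ) (x y : ℤ) : ℤ := m * x - n * y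

/-- `ℛ⁺`: boxes in the triangle with vertices `(0,0), (dn,0), (dn,dm)`. A box is identified with its
top-left vertex `(x, y)`. -/
def triangleBoxes (d n m : ℕ) : Finset (ℕ × ℕ) :=
  (Finset.range (d * n) ×ˢ Finset.Icc 1 (d * m)).filter fun z => n * z.2 ≤ m * z.1

namespace RationalDyckPath

variable {d n m : ℕ}

/-- `y_x` for `0 ≤ x < dn` (extended by `0`). -/
def y (D : RationalDyckPath d n m) (x : ℕ) : ℕ :=
  if h : x < d * n then D.height ⟨x, h⟩ else 0

/-- The boxes of the Young diagram `D`: column `x` consists of the boxes `(x, 1), …, (x, y_x)`. -/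
def boxes (D : RationalDyckPath d n m) : Finset (ℕ × ℕ) :=
  (triangleBoxes d n m).filter fun z => z.2 ≤ D.y z.1

/-- The size `|D| = ∑ y_x`. -/
def size (D : RationalDyckPath d n m) : ℕ := ∑ x, D.height x

/-- The leg length: number of boxes of `D` above `z` in its column. -/
def leg (D : RationalDyckPath d n m) (z : ℕ × ℕ) : ℕ :=
  (D.boxes.filter fun w => w.1 = z.1 ∧ z.2 < w.2).card

/-- The arm length: number of boxes of `D` to the left of `z` in its row. -/
def arm (D : RationalDyckPath d n m) (z : ℕ × ℕ) : ℕ :=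
  (D.boxes.filter fun w => w.2 = z.2 ∧ w.1 < z.1).card

/-- `rk_{D,x} = rk(x, y_x)`. -/
def rank (D : RationalDyckPath d n m) (x : ℕ) : ℤ := boxRank n m x (D.y x)

/-- For a rank vector `w` of length `(u+1)n`: `max {0 ≤ x ≤ un : w_x ≤ w_{x+n-1} + m}`. -/
def moveIndexOf (n m : ℕ) (w : ℕ → ℤ) (u : ℕ) : ℕ :=
  Nat.findGreatest (fun x => w x ≤ w (x + n - 1) + m) (u * n)

/-- The rank vectors `rk^{[t]}`, `0 ≤ t ≤ d - 1` (of length `(d-t)n`; later entries are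
irrelevant): `rk^{[0]} = rk_D`, and `rk^{[t+1]}` is obtained from `rk^{[t]}` by deleting the entries
with indices `p, …, p+n-1`, where `p = p_u` is the move index with `u = d - (t+1)`. -/
def rankVec (D : RationalDyckPath d n m) : ℕ → ℕ → ℤ
  | 0 => D.rank
  | t + 1 => fun x =>
      if x < moveIndexOf n m (D.rankVec t) (d - (t + 1)) then D.rankVec t x
      else D.rankVec t (x + n)

/-- The move index `p_u`, `1 ≤ u ≤ d - 1`. -/
def moveIndex (D : RationalDyckPath d n m) (u : ℕ) : ℕ :=
  moveIndexOf n m (D.rankVec (d - u - 1)) u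

theorem exists_permIndex (D : RationalDyckPath d n m) (j u : ℕ) :
    ∃ i, i ≤ u ∧ D.moveIndex u ≤ i * n + j :=
  ⟨u, le_rfl, (Nat.findGreatest_le _).trans (Nat.le_add_right _ _)⟩

/-- The permutation index `i_{j,u} = min {0 ≤ i ≤ u : i n + j ≥ p_u}`. -/
def permIndex (D : RationalDyckPath d n m) (j u : ℕ) : ℕ := Nat.find (D.exists_permIndex j u)

/-- The cycle `s_{j,u} = (i_{j,u} ⋯ u)`, mapping `i_{j,u} ↦ i_{j,u} + 1 ↦ ⋯ ↦ u ↦ i_{j,u}`, as a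
permutation of `ℕ` (fixing all numbers `≥ d` if `u ≤ d - 1`). -/
def cyclePerm (D : RationalDyckPath d n m) (j u : ℕ) : Equiv.Perm ℕ :=
  (List.range' (D.permIndex j u) (u + 1 - D.permIndex j u)).formPerm

/-- `s_{j,v} ∘ ⋯ ∘ s_{j,1}`. -/
def permProd (D : RationalDyckPath d n m) (j : ℕ) : ℕ → Equiv.Perm ℕ
  | 0 => 1
  | v + 1 => D.cyclePerm j (v + 1) * D.permProd j v

/-- `s_j = s_{j,d-1} ∘ ⋯ ∘ s_{j,1}`. -/
def perm (D : RationalDyckPath d n m) (j : ℕ) : Equiv.Perm ℕ := D.permProd j (d - 1)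

/-- The matrix `(c_{i,j}) = Ψ_d(D)`: `c_{i,j} = y_{s_j(i), j} - (s_j(i) - i) m`, where
`y_{i,j} = y_{in+j}`. -/
def c (D : RationalDyckPath d n m) (i j : ℕ) : ℤ :=
  (D.y (D.perm j i * n + j) : ℤ) - ((D.perm j i : ℤ) - i) * m

/-- `Δ = Ψ_d(D)` as a set of integers: the `dn`-invariant set with `dn`-generators
`j d m + (d m n + 1) i - d n c_{i,j}`, `0 ≤ i ≤ d - 1`, `0 ≤ j ≤ n - 1`. -/
def Psi (D : RationalDyckPath d n m) : Set ℤ :=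
  {b | ∃ i < d, ∃ j < n, ∃ s : ℕ,
    b = ((j : ℤ) * d * m + (d * m * n + 1) * i - d * n * D.c i j) + d * n * s}

/-- The enhanced rank of the box `(x, y)` with `x = i n + j`: `d (m x - n y) + s_j⁻¹(i)`. -/
def enhancedRank (D : RationalDyckPath d n m) (z : ℕ × ℕ) : ℤ :=
  d * boxRank n m z.1 z.2 + ((D.perm (z.1 % n)).symm (z.1 / n) : ℕ)

/-- The boxes `z ∈ D` with `l(z) / (a(z) + 1) > m / n` or `(l(z) + 1) / a(z) ≤ m / n`. Denominators
are cleared, so that for `a(z) = 0` the second fraction is `+∞`. -/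
def specialBoxes (D : RationalDyckPath d n m) : Finset (ℕ × ℕ) :=
  D.boxes.filter fun z =>
    m * (D.arm z + 1) < n * D.leg z ∨ n * (D.leg z + 1) ≤ m * D.arm z

/-- `ε_D(τ₀) = |{z ∈ ℛ⁺ ∖ D : rk(z) = r, enhanced rank of z < τ₀}|`, where `r = ⌊τ₀ / d⌋`. -/
def epsilon (D : RationalDyckPath d n m) (τ₀ : ℕ) : ℕ :=
  ((triangleBoxes d n m \ D.boxes).filter fun z =>
    boxRank n m z.1 z.2 = (τ₀ / d : ℕ) ∧ D.enhancedRank z < τ₀).card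

/-- `ε̂_D(τ₀) = |{z ∈ ℛ⁺ ∖ D : enhanced rank of z < τ₀}|`. -/
def epsilonHat (D : RationalDyckPath d n m) (τ₀ : ℕ) : ℕ :=
  ((triangleBoxes d n m \ D.boxes).filter fun z => D.enhancedRank z < τ₀).card

end RationalDyckPath

end

/-! Structure of `R`. Since `λ ≠ 0`, the element `y^n - x^m` has order exactly `dmn + 1`. Hence the
`dn` products `y^j (y^n - x^m)^i` with `j < n`, `i < d` have orders that are pairwise incongruent
modulo `dn`, and they form a basis of `R` over `ℂ⟦x⟧` (`GenericBranch.mem_localRing_iff`). So `Γ` is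
explicit and symmetric, and `R` is Gorenstein: a linear functional `Φ` pairs `R` with `ℂ⟦t⟧ / t^s
R`, nondegenerately on the second factor (`GenericBranch.exists_duality`).

From ideals to modules. Here `e(Δ) = |D|`, so an ideal `I` in the cell corresponds to the module `M
= t^{τ₀} I⁻¹` with `ord M = Δ`, and `I ⊆ R` turns into `t^{τ₀} ∈ M`. Duality makes this a bijection
with matching colengths. It is a homeomorphism for the Zariski topologies: one direction is the
framing by the pairing, the other is Cramer's rule
(`GenericBranch.CellData.topologicalKrullDim_cell`).

Equations. Such an `M` has a unique reduced basis `f_k = t^{α_k} + ∑ v_{l,k} t^{α_k+l}` over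
`ℂ⟦t^{dn}⟧`, with one unknown for each gap `α_k + l` of `Δ`. The conditions `y f_k ∈ M` and `t^{τ₀}
∈ M` give one equation for each gap `α_k + dm + l` and for each gap `τ₀ + l`. They are solved order
by order in `l`. In the unknowns of order `l` the first kind of equation has linear part `v_{l,k} -
v_{l,k+dm}`, and the only linear relations are the sums over those classes modulo `d` that are full,
i.e. carry an equation at each residue (`range_eqnMap`). The resulting obstruction of order `l + 1`
is removed one order earlier. Translating the unknowns of order `l` by a function `c` of the class
modulo `d` preserves the equations of order `l`, changes the class sum of order `l + 1` by `nλ(c_i -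
c_{i+1})`, and changes the equation of order `l` for `t^{τ₀}` by `-c`. Not all classes are full, so
these translations reach every value (`shiftMap_surjective`); admissibility excludes obstructions of
order `1`. Therefore the cell is an affine space whose dimension is the number of unknowns minus the
number of equations (`isAffineOfDim_solutionSet`).

Counting. The deletion procedure divides the columns of `D` into `d` classes, and the generators of
`Ψ_d(D)` are `d · rk + class`. The combinatorial properties collected in `IsClassFunction` give
stability under `Γ` and admissibility. The number of unknowns minus the number of equations for `y
f_k` becomes a sum over pairs of columns of numbers of multiples of `n` in a window of length `m`,
where ties are broken by class. Breaking ties by position instead does not change the sum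
(`IsClassFunction.sum_multiplesIn`), and the new sum counts the special boxes together with `ℛ⁺ ∖ D`
(`RationalDyckPath.card_specialBoxes`). Enhanced ranks identify `ℛ⁺ ∖ D` with the gaps of `Δ`, so
the equations for `t^{τ₀}`, one for each gap beyond `τ₀`, leave exactly `ε̂_D(τ₀)`. -/

section

open MvPolynomial

/-! ## Polynomial functions and the Zariski topology on affine spaces -/

/-- The affine space `σ → ℂ` with its Zariski topology. -/
def ZariskiSpace (σ : Type*) : Type _ := σ → ℂ

instance (σ : Type*) : TopologicalSpace (ZariskiSpace σ) := zariskiTopology σ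

/-- A subset of `σ → ℂ`, as a subset of the affine space with its Zariski topology. -/
def zariskiSet {σ : Type*} (S : Set (σ → ℂ)) : Set (ZariskiSpace σ) := S

/-- Functions on `σ → ℂ` given by a polynomial. -/
def IsPolyFun {σ : Type*} (f : (σ → ℂ) → ℂ) : Prop :=
  ∃ p : MvPolynomial σ ℂ, ∀ v, f v = eval v p

namespace IsPolyFun

variable {σ τ ι κ : Type*} {f g : (σ → ℂ) → ℂ}

theorem const (c : ℂ) : IsPolyFun fun _ : σ → ℂ => c := ⟨C c, by simp⟩

theorem coord (i : σ) : IsPolyFun fun v : σ → ℂ => v i := ⟨X i, by simp⟩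

theorem add (hf : IsPolyFun f) (hg : IsPolyFun g) : IsPolyFun fun v => f v + g v := by
  obtain ⟨p, hp⟩ := hf
  obtain ⟨q, hq⟩ := hg
  exact ⟨p + q, by simp [hp, hq]⟩

theorem mul (hf : IsPolyFun f) (hg : IsPolyFun g) : IsPolyFun fun v => f v * g v := by
  obtain ⟨p, hp⟩ := hf
  obtain ⟨q, hq⟩ := hg
  exact ⟨p * q, by simp [hp, hq]⟩

theorem neg (hf : IsPolyFun f) : IsPolyFun fun v => -f v := by
  obtain ⟨p, hp⟩ := hf
  exact ⟨-p, by simp [hp]⟩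

theorem sub (hf : IsPolyFun f) (hg : IsPolyFun g) : IsPolyFun fun v => f v - g v := by
  simpa [sub_eq_add_neg] using hf.add hg.neg

theorem pow (hf : IsPolyFun f) (k : ℕ) : IsPolyFun fun v => f v ^ k := by
  obtain ⟨p, hp⟩ := hf
  exact ⟨p ^ k, by simp [hp]⟩

theorem sum (s : Finset ι) {f : ι → (σ → ℂ) → ℂ} (hf : ∀ i ∈ s, IsPolyFun (f i)) :
    IsPolyFun fun v => ∑ i ∈ s, f i v := by
  classical
  induction s using Finset.induction_on with
  | empty => simpa using const 0
  | insert a s ha ih =>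
    simp only [Finset.sum_insert ha]
    exact (hf a (by simp)).add (ih fun i hi => hf i (by simp [hi]))

theorem prod (s : Finset ι) {f : ι → (σ → ℂ) → ℂ} (hf : ∀ i ∈ s, IsPolyFun (f i)) :
    IsPolyFun fun v => ∏ i ∈ s, f i v := by
  classical
  induction s using Finset.induction_on with
  | empty => simpa using const 1
  | insert a s ha ih =>
    simp only [Finset.prod_insert ha]
    exact (hf a (by simp)).mul (ih fun i hi => hf i (by simp [hi]))

theorem comp {h : (τ → ℂ) → ℂ} (hh : IsPolyFun h) {f : (σ → ℂ) → τ → ℂ}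
    (hf : ∀ i, IsPolyFun fun v => f v i) : IsPolyFun fun v => h (f v) := by
  obtain ⟨p, hp⟩ := hh
  choose q hq using hf
  refine ⟨bind₁ q p, fun v => ?_⟩
  change h (f v) = _
  rw [hp, eval_eq_eval_eval_bind₁ v q p, show f v = fun i => eval v (q i) from funext fun i => hq i v]
where
  eval_eq_eval_eval_bind₁ (v : σ → ℂ) (q : τ → MvPolynomial σ ℂ) (p : MvPolynomial τ ℂ) :
      eval v (bind₁ q p) = eval (fun i => eval v (q i)) p := by
    simp only [← coe_aeval_eq_eval, RingHom.coe_coe, aeval_bind₁]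

theorem linear [Fintype ι] (L : (ι → ℂ) →ₗ[ℂ] (κ → ℂ)) {f : (σ → ℂ) → ι → ℂ}
    (hf : ∀ i, IsPolyFun fun v => f v i) (j : κ) : IsPolyFun fun v => L (f v) j := by
  classical
  have : (fun v => L (f v) j) = fun v => ∑ i, f v i * L (Pi.single i 1) j := by
    funext v
    rw [LinearMap.pi_apply_eq_sum_univ L (f v)]
    simp only [Finset.sum_apply, Pi.smul_apply, smul_eq_mul]
    refine Finset.sum_congr rfl fun i _ => ?_
    have h : (fun j => if i = j then (1 : ℂ) else 0) = Pi.single i 1 := by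
      funext k
      simp [Pi.single_apply, eq_comm]
    rw [h]
  rw [this]
  exact sum _ fun i _ => (hf i).mul (const _)

end IsPolyFun

namespace ZariskiSpace

variable {σ : Type*}

theorem isOpen_of_isPolyFun {f : (σ → ℂ) → ℂ} (hf : IsPolyFun f) :
    IsOpen (zariskiSet {v | f v ≠ 0}) := by
  obtain ⟨p, hp⟩ := hf
  exact TopologicalSpace.isOpen_generateFrom_of_mem ⟨p, by simp only [zariskiSet, hp]⟩

theorem continuous_iff {T : Type*} [TopologicalSpace T] {f : T → ZariskiSpace σ} :
    Continuous f ↔ ∀ p : MvPolynomial σ ℂ, IsOpen {t | eval (f t) p ≠ 0} := by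
  refine continuous_generateFrom_iff.trans ⟨fun h p => h _ ⟨p, rfl⟩, ?_⟩
  rintro h _ ⟨p, rfl⟩
  exact h p

theorem continuous_of_isPolyFun {τ : Type*} {f : (σ → ℂ) → τ → ℂ}
    (hf : ∀ i, IsPolyFun fun v => f v i) :
    Continuous (X := ZariskiSpace σ) (Y := ZariskiSpace τ) f :=
  continuous_iff.2 fun p => isOpen_of_isPolyFun (IsPolyFun.comp ⟨p, fun _ => rfl⟩ hf)

theorem mem_pointToPoint (v : σ → ℂ) (p : MvPolynomial σ ℂ) :
    p ∈ (pointToPoint (k := ℂ) v).asIdeal ↔ eval v p = 0 := by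
  simp [pointToPoint, mem_vanishingIdeal_iff]

theorem mem_zeroLocus_iff_eval (v : σ → ℂ) (I : Ideal (MvPolynomial σ ℂ)) :
    v ∈ zeroLocus ℂ I ↔ ∀ p ∈ I, eval v p = 0 := by
  rw [mem_zeroLocus_iff]
  simp

/-- Non-vanishing loci of polynomials are the traces of the basic open sets of the spectrum on
closed points. This transports both the basis property and the upper bound on Krull dimension from
the spectrum. -/
theorem isInducing_pointToPoint :
    Topology.IsInducing
      (fun v : ZariskiSpace σ => (pointToPoint (k := ℂ) (K := ℂ) (σ := σ) v)) := by
  constructor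
  rw [PrimeSpectrum.isTopologicalBasis_basic_opens.eq_generateFrom, induced_generateFrom_eq]
  change TopologicalSpace.generateFrom _ = _
  congr 1
  ext U
  constructor
  · rintro ⟨p, rfl⟩
    refine ⟨_, ⟨p, rfl⟩, ?_⟩
    ext v
    exact not_congr (mem_pointToPoint v p)
  · rintro ⟨_, ⟨p, rfl⟩, rfl⟩
    refine ⟨p, ?_⟩
    ext v
    exact not_congr (mem_pointToPoint v p)

theorem exists_eval_ne_zero_of_isOpen {U : Set (ZariskiSpace σ)} (hU : IsOpen U) {v : σ → ℂ}
    (hv : v ∈ U) : ∃ p : MvPolynomial σ ℂ, eval v p ≠ 0 ∧ ∀ w : σ → ℂ, eval w p ≠ 0 → w ∈ U := by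
  obtain ⟨V, hV, rfl⟩ := isInducing_pointToPoint.isOpen_iff.1 hU
  obtain ⟨_, ⟨p, rfl⟩, h1, h2⟩ :=
    PrimeSpectrum.isTopologicalBasis_basic_opens.exists_subset_of_mem_open hv hV
  refine ⟨p, ?_, fun w hw => h2 ?_⟩
  · exact (not_congr (mem_pointToPoint v p)).1 h1
  · exact (not_congr (mem_pointToPoint w p)).2 hw

theorem isClosed_zeroLocus (I : Ideal (MvPolynomial σ ℂ)) :
    IsClosed (zariskiSet (zeroLocus ℂ I)) := by
  have : zariskiSet (zeroLocus ℂ I) = ⋂ p ∈ I, (zariskiSet {v | eval v p ≠ 0})ᶜ := by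
    ext v
    simp only [Set.mem_iInter, Set.mem_compl_iff]
    refine (mem_zeroLocus_iff_eval v I).trans (forall₂_congr fun p _ => ?_)
    exact not_not.symm
  rw [this]
  exact isClosed_biInter fun p _ =>
    (isOpen_of_isPolyFun ⟨p, fun _ => rfl⟩).isClosed_compl

theorem isIrreducible_zeroLocus [Finite σ] (P : Ideal (MvPolynomial σ ℂ)) [hP : P.IsPrime] :
    IsIrreducible (zariskiSet (zeroLocus ℂ P)) := by
  -- Nullstellensatz: a polynomial that vanishes on the zero locus of a prime lies in it.
  have key : ∀ p : MvPolynomial σ ℂ, p ∉ P → ∃ v ∈ zeroLocus ℂ P, eval v p ≠ 0 := by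
    intro p hp
    rw [← IsPrime.vanishingIdeal_zeroLocus (K := ℂ) P, mem_vanishingIdeal_iff] at hp
    push Not at hp
    simpa [coe_aeval_eq_eval] using hp
  constructor
  · obtain ⟨v, hv, -⟩ := key 1 (fun h => hP.ne_top ((Ideal.eq_top_iff_one _).2 h))
    exact ⟨v, hv⟩
  · rintro U V hU hV ⟨x, hx, hxU⟩ ⟨y, hy, hyV⟩
    obtain ⟨p, hp, hpU⟩ := exists_eval_ne_zero_of_isOpen hU hxU
    obtain ⟨q, hq, hqV⟩ := exists_eval_ne_zero_of_isOpen hV hyV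
    have hp' : p ∉ P := fun h => hp ((mem_zeroLocus_iff_eval _ _).1 hx p h)
    have hq' : q ∉ P := fun h => hq ((mem_zeroLocus_iff_eval _ _).1 hy q h)
    obtain ⟨z, hz, hz'⟩ := key (p * q) (fun h => (hP.mem_or_mem h).elim hp' hq')
    rw [map_mul] at hz'
    exact ⟨z, hz, hpU z (left_ne_zero_of_mul hz'), hqV z (right_ne_zero_of_mul hz')⟩

/-- The upper bound comes from the inducing map into the spectrum. For the lower bound, primes are
sent to their irreducible zero loci; this reverses inclusions and is injective by the
Nullstellensatz. -/
theorem topologicalKrullDim_eq (N : ℕ) :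
    topologicalKrullDim (ZariskiSpace (Fin N)) = N := by
  have hring : ringKrullDim (MvPolynomial (Fin N) ℂ) = N := by
    rw [MvPolynomial.ringKrullDim_of_isNoetherianRing, ringKrullDim_eq_zero_of_field]
    simp
  refine le_antisymm ?_ ?_
  · refine (isInducing_pointToPoint (σ := Fin N)).topologicalKrullDim_le.trans ?_
    rw [PrimeSpectrum.topologicalKrullDim_eq_ringKrullDim, hring]
  · rw [← hring, ringKrullDim, ← Order.krullDim_orderDual]
    refine Order.krullDim_le_of_strictMono
      (fun P : (PrimeSpectrum (MvPolynomial (Fin N) ℂ))ᵒᵈ =>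
        (⟨zariskiSet (zeroLocus ℂ (OrderDual.ofDual P).asIdeal),
          @isIrreducible_zeroLocus _ _ _ (OrderDual.ofDual P).2, isClosed_zeroLocus _⟩ :
          TopologicalSpace.IrreducibleCloseds (ZariskiSpace (Fin N)))) ?_
    refine Monotone.strictMono_of_injective ?_ ?_
    · intro P Q h
      exact zeroLocus_anti_mono h
    · intro P Q h
      have h' : zeroLocus ℂ (OrderDual.ofDual P).asIdeal = zeroLocus ℂ (OrderDual.ofDual Q).asIdeal :=
        congrArg TopologicalSpace.IrreducibleCloseds.carrier h
      have hP := (OrderDual.ofDual P).2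
      have hQ := (OrderDual.ofDual Q).2
      apply OrderDual.ofDual.injective
      apply PrimeSpectrum.ext
      rw [← IsPrime.vanishingIdeal_zeroLocus (K := ℂ) (OrderDual.ofDual P).asIdeal, h',
        IsPrime.vanishingIdeal_zeroLocus]

end ZariskiSpace

/-! ## Subsets of affine spaces that are isomorphic to affine spaces -/

/-- `S ⊆ ℂ^σ` is the isomorphic image of `ℂ^N` under a polynomial map, with a polynomial
retraction. -/
def IsAffineOfDim {σ : Type*} (S : Set (σ → ℂ)) (N : ℕ) : Prop :=
  ∃ (φ : (Fin N → ℂ) → σ → ℂ) (ψ : (σ → ℂ) → Fin N → ℂ),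
    (∀ i, IsPolyFun fun x => φ x i) ∧ (∀ i, IsPolyFun fun v => ψ v i) ∧
    (∀ x, φ x ∈ S) ∧ (∀ x, ψ (φ x) = x) ∧ ∀ v ∈ S, φ (ψ v) = v

namespace IsAffineOfDim

variable {σ : Type*} {S : Set (σ → ℂ)} {N : ℕ}

theorem topologicalKrullDim_eq (hS : IsAffineOfDim S N) :
    topologicalKrullDim (zariskiSet S) = N := by
  obtain ⟨φ, ψ, hφ, hψ, hφS, hψφ, hφψ⟩ := hS
  let e : ZariskiSpace (Fin N) ≃ₜ zariskiSet S :=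
    { toFun := fun x => ⟨φ x, hφS x⟩
      invFun := fun v => ψ v.1
      left_inv := hψφ
      right_inv := fun v => Subtype.ext (hφψ v.1 v.2)
      continuous_toFun := (ZariskiSpace.continuous_of_isPolyFun hφ).subtype_mk _
      continuous_invFun := (ZariskiSpace.continuous_of_isPolyFun hψ).comp continuous_subtype_val }
  rw [← IsHomeomorph.topologicalKrullDim_eq e e.isHomeomorph, ZariskiSpace.topologicalKrullDim_eq]

theorem singleton_zero : IsAffineOfDim ({0} : Set (σ → ℂ)) 0 :=
  ⟨fun _ => 0, fun _ => 0, fun _ => IsPolyFun.const 0, fun _ => IsPolyFun.const 0, fun _ => rfl,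
    fun _ => Subsingleton.elim _ _, fun _ hv => (Set.mem_singleton_iff.1 hv).symm⟩

end IsAffineOfDim

/-- Replace the coordinates of `s` in `τ` by `w`. -/
def glue {σ : Type*} [DecidableEq σ] (τ : Finset σ) (s : σ → ℂ) (w : τ → ℂ) : σ → ℂ :=
  fun i => if h : i ∈ τ then w ⟨i, h⟩ else s i

theorem glue_of_mem {σ : Type*} [DecidableEq σ] {τ : Finset σ} (s : σ → ℂ) (w : τ → ℂ) {i : σ}
    (h : i ∈ τ) : glue τ s w i = w ⟨i, h⟩ := by simp [glue, h]

theorem glue_of_notMem {σ : Type*} [DecidableEq σ] {τ : Finset σ} (s : σ → ℂ) (w : τ → ℂ) {i : σ}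
    (h : i ∉ τ) : glue τ s w i = s i := by simp [glue, h]

theorem IsPolyFun.glue {σ κ : Type*} [DecidableEq σ] (τ : Finset σ) {f : (κ → ℂ) → σ → ℂ}
    {g : (κ → ℂ) → τ → ℂ} (hf : ∀ i, IsPolyFun fun v => f v i)
    (hg : ∀ i, IsPolyFun fun v => g v i) (i : σ) :
    IsPolyFun fun v => _root_.glue τ (f v) (g v) i := by
  by_cases h : i ∈ τ
  · simpa only [glue_of_mem _ _ h] using hg _
  · simpa only [glue_of_notMem _ _ h] using hf _

theorem LinearMap.exists_section_on_range {V W : Type*} [AddCommGroup V] [Module ℂ V]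
    [AddCommGroup W] [Module ℂ W] (E : V →ₗ[ℂ] W) :
    ∃ F : W →ₗ[ℂ] V, ∀ y ∈ LinearMap.range E, E (F y) = y := by
  obtain ⟨g, hg⟩ := LinearMap.exists_rightInverse_of_surjective E.rangeRestrict E.range_rangeRestrict
  obtain ⟨F, hF⟩ := LinearMap.exists_extend g
  refine ⟨F, fun y hy => ?_⟩
  have h1 : F y = g ⟨y, hy⟩ := congrArg (fun f => f ⟨y, hy⟩) hF
  have h2 := congrArg (fun f => (f ⟨y, hy⟩ : LinearMap.range E).1) hg
  rw [h1]
  exact h2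

/-- Splits a solution space `K` of linear equations into the directions `e`, which will be spent on
solving further equations, and a complement with coordinates `r`, which stays free. -/
theorem LinearMap.exists_complement_of_injective {V ρ : Type*} [AddCommGroup V] [Module ℂ V]
    [FiniteDimensional ℂ V] [Fintype ρ] (K : Submodule ℂ V) (e : (ρ → ℂ) →ₗ[ℂ] V)
    (heK : ∀ u, e u ∈ K) (he : Function.Injective e) :
    ∃ (k : ℕ) (i : (Fin k → ℂ) →ₗ[ℂ] V) (r : V →ₗ[ℂ] (Fin k → ℂ)),
      k + Fintype.card ρ = Module.finrank ℂ K ∧ (∀ z, i z ∈ K) ∧ (∀ u, r (e u) = 0) ∧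
      (∀ z, r (i z) = z) ∧ ∀ w ∈ K, ∃ u, w = i (r w) + e u := by
  let e' : (ρ → ℂ) →ₗ[ℂ] K := e.codRestrict K heK
  have he' : Function.Injective e' := fun a b h => he (congrArg Subtype.val h)
  obtain ⟨P, hP⟩ := Submodule.exists_isCompl (LinearMap.range e')
  let b : P ≃ₗ[ℂ] (Fin (Module.finrank ℂ P) → ℂ) := LinearEquiv.ofFinrankEq _ _ (by simp)
  obtain ⟨r, hr⟩ := LinearMap.exists_extend
    (b.toLinearMap ∘ₗ P.projectionOnto (LinearMap.range e') hP.symm)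
  have hr' : ∀ w : K, r w = b (P.projectionOnto (LinearMap.range e') hP.symm w) :=
    fun w => congrArg (fun f => f w) hr
  refine ⟨Module.finrank ℂ P, K.subtype ∘ₗ P.subtype ∘ₗ b.symm.toLinearMap, r, ?_, ?_, ?_, ?_, ?_⟩
  · have h1 := Submodule.finrank_add_eq_of_isCompl hP
    rw [LinearMap.finrank_range_of_inj he', Module.finrank_fintype_fun_eq_card] at h1
    omega
  · intro z
    exact (P.subtype (b.symm z)).2
  · intro u
    have := hr' (e' u)
    rw [Submodule.projectionOnto_apply_right hP.symm ⟨e' u, LinearMap.mem_range_self _ u⟩] at this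
    exact this.trans (map_zero b)
  · intro z
    have := hr' (P.subtype (b.symm z))
    simp only [Submodule.subtype_apply, Submodule.projectionOnto_apply_left] at this
    simpa using this
  · intro w hw
    obtain ⟨x, y, hxy⟩ : ∃ (x : P) (y : LinearMap.range e'), (x : K) + y = ⟨w, hw⟩ := by
      have : (⟨w, hw⟩ : K) ∈ P ⊔ LinearMap.range e' := by
        rw [hP.symm.sup_eq_top]; trivial
      obtain ⟨x, hx, y, hy, h⟩ := Submodule.mem_sup.1 this
      exact ⟨⟨x, hx⟩, ⟨y, hy⟩, h⟩
    obtain ⟨y, u, rfl⟩ := y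
    refine ⟨u, ?_⟩
    have h1 := hr' ⟨w, hw⟩
    rw [← hxy, map_add, Submodule.projectionOnto_apply_left,
      Submodule.projectionOnto_apply_right hP.symm ⟨e' u, LinearMap.mem_range_self _ u⟩,
      add_zero, hxy] at h1
    change r w = b x at h1
    have h2 := congrArg Subtype.val hxy
    simp only [Submodule.coe_add] at h2
    rw [h1]
    simp only [LinearMap.comp_apply, LinearEquiv.coe_coe, LinearEquiv.symm_apply_apply,
      Submodule.subtype_apply]
    rw [← h2]
    rfl

/-- Extension of an affine space `S` by a block `τ` of new variables that satisfies linear equations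
`E w = Q s` and equations `H = 0` that are solved by the translations along `e`. -/
theorem IsAffineOfDim.extend {σ κ ρ : Type*} [DecidableEq σ] [Fintype κ] [Fintype ρ]
    {S : Set (σ → ℂ)} {N : ℕ} (hS : IsAffineOfDim S N) (τ : Finset σ)
    (hSτ : ∀ s ∈ S, ∀ i ∈ τ, s i = 0)
    (E : (τ → ℂ) →ₗ[ℂ] (κ → ℂ)) {Q : (σ → ℂ) → κ → ℂ} (hQ : ∀ j, IsPolyFun fun v => Q v j)
    (hQE : ∀ s ∈ S, Q s ∈ LinearMap.range E)
    (e : (ρ → ℂ) →ₗ[ℂ] (τ → ℂ)) (hEe : ∀ u, E (e u) = 0)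
    {H : (σ → ℂ) → ρ → ℂ} (hH : ∀ j, IsPolyFun fun v => H v j)
    (hHe : ∀ s ∈ S, ∀ w, E w = Q s → ∀ u, H (glue τ s (w + e u)) = H (glue τ s w) + u) :
    ∃ k, k + Fintype.card ρ = Module.finrank ℂ (LinearMap.ker E) ∧
      IsAffineOfDim {v | glue τ v 0 ∈ S ∧ E (fun i => v i) = Q (glue τ v 0) ∧ H v = 0}
        (N + k) := by
  obtain ⟨φ, ψ, hφ, hψ, hφS, hψφ, hφψ⟩ := hS
  obtain ⟨F, hF⟩ := E.exists_section_on_range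
  -- If `e u = 0`, the translation rule for `H` at any point of the fibre reads `H = H + u`.
  have he : Function.Injective e := by
    rw [← LinearMap.ker_eq_bot, LinearMap.ker_eq_bot']
    intro u hu
    have := hHe _ (hφS 0) _ (hF _ (hQE _ (hφS 0))) u
    rw [hu, add_zero] at this
    simpa using this
  obtain ⟨k, i, r, hk, hiK, hre, hri, hK⟩ :=
    LinearMap.exists_complement_of_injective (LinearMap.ker E) e hEe he
  refine ⟨k, hk, ?_⟩
  have glue_self : ∀ s ∈ S, ∀ w, glue τ (glue τ s w) 0 = s := by
    intro s hs w
    funext j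
    by_cases h : j ∈ τ
    · simp [glue_of_mem _ _ h, hSτ s hs j h]
    · simp [glue_of_notMem _ _ h]
  have glue_res : ∀ v : σ → ℂ, glue τ (glue τ v 0) (fun j => v j) = v := by
    intro v
    funext j
    by_cases h : j ∈ τ
    · simp [glue_of_mem _ _ h]
    · simp [glue_of_notMem _ _ h]
  have res_glue : ∀ s w, (fun j : τ => glue τ s w j) = w := by
    intro s w
    funext j
    simp [glue_of_mem _ _ j.2]
  -- the base point of the fibre and the corrected point
  let w₀ : (Fin (N + k) → ℂ) → τ → ℂ := fun x =>
    F (Q (φ fun j => x (Fin.castAdd k j))) + i fun j => x (Fin.natAdd N j)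
  let s₀ : (Fin (N + k) → ℂ) → σ → ℂ := fun x => φ fun j => x (Fin.castAdd k j)
  have hs₀ : ∀ j, IsPolyFun fun x => s₀ x j := fun j => (hφ j).comp fun l => .coord _
  have hw₀ : ∀ j, IsPolyFun fun x => w₀ x j := fun j =>
    (IsPolyFun.linear F (fun l => (hQ l).comp hs₀) j).add
      (IsPolyFun.linear i (fun l => .coord _) j)
  have hEw₀ : ∀ x, E (w₀ x) = Q (s₀ x) := by
    intro x
    have h1 : E (i fun j => x (Fin.natAdd N j)) = 0 := hiK _
    simp only [w₀, map_add, h1, add_zero]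
    exact hF _ (hQE _ (hφS _))
  -- Translation by `e u` adds `u` to `H`, so the translation that lands on `H = 0` has `u = -H` at
  -- the uncorrected point.
  let u₀ : (Fin (N + k) → ℂ) → ρ → ℂ := fun x => -H (glue τ (s₀ x) (w₀ x))
  have hu₀ : ∀ j, IsPolyFun fun x => u₀ x j := fun j =>
    ((hH j).comp (IsPolyFun.glue τ hs₀ hw₀)).neg
  refine ⟨fun x => glue τ (s₀ x) (w₀ x + e (u₀ x)),
    fun v => Fin.append (ψ (glue τ v 0)) (r ((fun j : τ => v j) - F (Q (glue τ v 0)))),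
    ?_, ?_, ?_, ?_, ?_⟩
  · exact IsPolyFun.glue τ hs₀ fun j => (hw₀ j).add (IsPolyFun.linear e hu₀ j)
  · have h0 : ∀ j, IsPolyFun fun v : σ → ℂ => glue τ v 0 j :=
      IsPolyFun.glue τ (fun j => .coord j) fun j => .const 0
    intro j
    refine Fin.addCases (fun j => ?_) (fun j => ?_) j
    · simpa only [Fin.append_left] using (hψ j).comp h0
    · simp only [Fin.append_right]
      refine IsPolyFun.linear r (fun l => ?_) j
      exact (IsPolyFun.coord _).sub (IsPolyFun.linear F (fun l => (hQ l).comp h0) l)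
  · intro x
    refine ⟨?_, ?_, ?_⟩
    · rw [glue_self _ (hφS _)]
      exact hφS _
    · rw [glue_self _ (hφS _), res_glue, map_add, hEe, add_zero]
      exact hEw₀ x
    · rw [hHe _ (hφS _) _ (hEw₀ x)]
      exact add_neg_cancel _
  · intro x
    simp only
    rw [glue_self _ (hφS _), res_glue]
    have h1 : w₀ x + e (u₀ x) - F (Q (s₀ x)) = (i fun j => x (Fin.natAdd N j)) + e (u₀ x) := by
      simp only [w₀, s₀]
      abel
    rw [h1, map_add, hri, hre, add_zero]
    rw [hψφ]
    funext j
    refine Fin.addCases (fun j => ?_) (fun j => ?_) j <;> simp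
  · rintro v ⟨hv1, hv2, hv3⟩
    have hs : s₀ (Fin.append (ψ (glue τ v 0)) (r ((fun j : τ => v j) - F (Q (glue τ v 0))))) =
        glue τ v 0 := by
      simp only [s₀, Fin.append_left]
      exact hφψ _ hv1
    have hker : (fun j : τ => v j) - F (Q (glue τ v 0)) ∈ LinearMap.ker E := by
      rw [LinearMap.mem_ker, map_sub, hv2, hF _ (hQE _ hv1), sub_self]
    obtain ⟨u, hu⟩ := hK _ hker
    have hw : w₀ (Fin.append (ψ (glue τ v 0)) (r ((fun j : τ => v j) - F (Q (glue τ v 0))))) + e u =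
        fun j : τ => v j := by
      change F (Q (s₀ _)) + i (fun j => Fin.append _ _ (Fin.natAdd N j)) + e u = _
      rw [hs]
      simp only [Fin.append_right]
      rw [add_assoc, ← hu]
      abel
    have hu' : u₀ (Fin.append (ψ (glue τ v 0)) (r ((fun j : τ => v j) - F (Q (glue τ v 0))))) =
        u := by
      have h1 := hHe _ hv1 _ (by rw [hEw₀, hs]) u
      rw [hw, glue_res, hv3] at h1
      simp only [u₀, hs]
      exact (eq_neg_of_add_eq_zero_right h1.symm).symm
    simp only
    rw [hu', hs, hw, glue_res]

end

section

open Finset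

/-! ## Structure constants of modules with given generators -/

section Coefficients

variable {q : ℕ} (p : ℕ) (Y : ℕ → ℂ) (v : ℕ × ZMod q → ℂ)

/-- The coefficients of `f_k = t^k + ∑_{l ≥ 1} v_{l,k} t^{k+l}`. -/
def genCoeff (l : ℕ) (k : ZMod q) : ℂ := if l = 0 then 1 else v (l, k)

@[simp] theorem genCoeff_zero (k : ZMod q) : genCoeff v 0 k = 1 := rfl

theorem genCoeff_of_pos {l : ℕ} (hl : l ≠ 0) (k : ZMod q) : genCoeff v l k = v (l, k) := if_neg hl

/-- The coefficients in `y f_k = ∑_l N_l(k) f_{k+p+l}`, where `y = ∑_j Y_j t^{p+j}`. -/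
def mulCoeff (l : ℕ) (k : ZMod q) : ℂ :=
  ∑ j ∈ range (l + 1), Y j * genCoeff v (l - j) k -
    ∑ j : Fin l, genCoeff v (l - j) (k + p + (j : ℕ)) * mulCoeff j k
termination_by l
decreasing_by exact j.2

theorem mulCoeff_eq (l : ℕ) (k : ZMod q) :
    mulCoeff p Y v l k = ∑ j ∈ range (l + 1), Y j * genCoeff v (l - j) k -
      ∑ j ∈ range l, genCoeff v (l - j) (k + p + j) * mulCoeff p Y v j k := by
  rw [mulCoeff, Finset.sum_range fun j => genCoeff v (l - j) (k + p + j) * mulCoeff p Y v j k]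

/-- The coefficients in `t^s = ∑_l U_l f_{s+l}`. -/
def powCoeff (s : ZMod q) (l : ℕ) : ℂ :=
  (if l = 0 then 1 else 0) - ∑ j : Fin l, powCoeff s j * genCoeff v (l - j) (s + (j : ℕ))
termination_by l
decreasing_by exact j.2

theorem powCoeff_eq (s : ZMod q) (l : ℕ) :
    powCoeff v s l = (if l = 0 then 1 else 0) -
      ∑ j ∈ range l, powCoeff v s j * genCoeff v (l - j) (s + j) := by
  rw [powCoeff, Finset.sum_range fun j => powCoeff v s j * genCoeff v (l - j) (s + j)]

theorem mulCoeff_zero (k : ZMod q) : mulCoeff p Y v 0 k = Y 0 := by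
  simp [mulCoeff_eq p Y v 0 k]

theorem mulCoeff_one (k : ZMod q) :
    mulCoeff p Y v 1 k = Y 0 * (v (1, k) - v (1, k + p)) + Y 1 := by
  rw [mulCoeff_eq]
  simp [Finset.sum_range_succ, genCoeff_of_pos, mulCoeff_zero]
  ring

theorem powCoeff_zero (s : ZMod q) : powCoeff v s 0 = 1 := by
  simp [powCoeff_eq v s 0]

theorem isPolyFun_genCoeff (l : ℕ) (k : ZMod q) : IsPolyFun fun v => genCoeff v l k := by
  by_cases hl : l = 0
  · subst hl
    exact .const 1
  · simp only [genCoeff, if_neg hl]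
    exact .coord _

theorem isPolyFun_mulCoeff (l : ℕ) (k : ZMod q) : IsPolyFun fun v => mulCoeff p Y v l k := by
  induction l using Nat.strong_induction_on generalizing k with
  | _ l ih =>
    simp only [mulCoeff_eq p Y _ l k]
    refine (IsPolyFun.sum _ fun j _ => (IsPolyFun.const _).mul (isPolyFun_genCoeff _ _)).sub
      (IsPolyFun.sum _ fun j hj => (isPolyFun_genCoeff _ _).mul (ih j (mem_range.1 hj) k))

theorem isPolyFun_powCoeff (s : ZMod q) (l : ℕ) : IsPolyFun fun v => powCoeff v s l := by
  induction l using Nat.strong_induction_on with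
  | _ l ih =>
    simp only [powCoeff_eq _ s l]
    exact (IsPolyFun.const _).sub
      (IsPolyFun.sum _ fun j hj => (ih j (mem_range.1 hj)).mul (isPolyFun_genCoeff _ _))

variable {p Y v} {v' : ℕ × ZMod q → ℂ} {l : ℕ}

theorem genCoeff_congr (h : ∀ j < l, ∀ k, v' (j, k) = v (j, k)) {j : ℕ} (hj : j < l)
    (k : ZMod q) : genCoeff v' j k = genCoeff v j k := by
  by_cases h0 : j = 0
  · subst h0; rfl
  · rw [genCoeff_of_pos _ h0, genCoeff_of_pos _ h0, h j hj]

theorem mulCoeff_congr (h : ∀ j < l, ∀ k, v' (j, k) = v (j, k)) {j : ℕ} (hj : j < l)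
    (k : ZMod q) : mulCoeff p Y v' j k = mulCoeff p Y v j k := by
  induction j using Nat.strong_induction_on generalizing k with
  | _ j ih =>
    rw [mulCoeff_eq p Y v', mulCoeff_eq p Y v]
    congr 1
    · exact sum_congr rfl fun i _ => by rw [genCoeff_congr h (by omega)]
    · refine sum_congr rfl fun i hi => ?_
      rw [mem_range] at hi
      rw [genCoeff_congr h (by omega), ih i hi (by omega)]

theorem powCoeff_congr (h : ∀ j < l, ∀ k, v' (j, k) = v (j, k)) (s : ZMod q) {j : ℕ}
    (hj : j < l) : powCoeff v' s j = powCoeff v s j := by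
  induction j using Nat.strong_induction_on with
  | _ j ih =>
    rw [powCoeff_eq v', powCoeff_eq v]
    congr 1
    refine sum_congr rfl fun i hi => ?_
    rw [mem_range] at hi
    rw [genCoeff_congr h (by omega), ih i hi (by omega)]

/-- The top order part of `N_l` is linear. -/
theorem mulCoeff_sub (hY : Y 0 = 1) (hl : l ≠ 0) (h : ∀ j < l, ∀ k, v' (j, k) = v (j, k))
    (k : ZMod q) :
    mulCoeff p Y v' l k - mulCoeff p Y v l k =
      (v' (l, k) - v (l, k)) - (v' (l, k + p) - v (l, k + p)) := by
  have h1 : ∑ j ∈ range (l + 1), Y j * genCoeff v' (l - j) k -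
      ∑ j ∈ range (l + 1), Y j * genCoeff v (l - j) k = v' (l, k) - v (l, k) := by
    rw [← sum_sub_distrib, sum_eq_single 0]
    · simp [genCoeff_of_pos _ hl, hY]
    · intro j _ hj
      rw [genCoeff_congr h (by omega), sub_self]
    · simp
  have h2 : ∑ j ∈ range l, genCoeff v' (l - j) (k + p + j) * mulCoeff p Y v' j k -
      ∑ j ∈ range l, genCoeff v (l - j) (k + p + j) * mulCoeff p Y v j k =
      v' (l, k + p) - v (l, k + p) := by
    rw [← sum_sub_distrib, sum_eq_single 0]
    · simp [genCoeff_of_pos _ hl, mulCoeff_zero, hY]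
    · intro j hj hj0
      rw [mem_range] at hj
      rw [genCoeff_congr h (by omega), mulCoeff_congr h hj, sub_self]
    · intro h0
      exact absurd (mem_range.2 (by omega)) h0
  rw [mulCoeff_eq p Y v', mulCoeff_eq p Y v, ← h1, ← h2]
  ring

theorem powCoeff_sub (hl : l ≠ 0) (h : ∀ j < l, ∀ k, v' (j, k) = v (j, k)) (s : ZMod q) :
    powCoeff v' s l - powCoeff v s l = -(v' (l, s) - v (l, s)) := by
  have h2 : ∑ j ∈ range l, powCoeff v' s j * genCoeff v' (l - j) (s + j) -
      ∑ j ∈ range l, powCoeff v s j * genCoeff v (l - j) (s + j) = v' (l, s) - v (l, s) := by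
    rw [← sum_sub_distrib, sum_eq_single 0]
    · simp [genCoeff_of_pos _ hl, powCoeff_zero]
    · intro j hj hj0
      rw [mem_range] at hj
      rw [genCoeff_congr h (by omega), powCoeff_congr h s hj, sub_self]
    · intro h0
      exact absurd (mem_range.2 (by omega)) h0
  rw [powCoeff_eq v', powCoeff_eq v, ← h2]
  ring

/-- The part of `N_{l+1}` that involves the coefficients of order `≥ l`. -/
theorem mulCoeff_succ_sub (hY : Y 0 = 1) (hl : l ≠ 0) (h : ∀ j < l, ∀ k, v' (j, k) = v (j, k))
    (k : ZMod q) :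
    mulCoeff p Y v' (l + 1) k - mulCoeff p Y v (l + 1) k =
      ((v' (l + 1, k) - v (l + 1, k)) - (v' (l + 1, k + p) - v (l + 1, k + p))) +
      (Y 1 * (v' (l, k) - v (l, k)) -
        (v' (l, k + p + 1) - v (l, k + p + 1)) * mulCoeff p Y v' 1 k -
        v (1, k + p + l) * ((v' (l, k) - v (l, k)) - (v' (l, k + p) - v (l, k + p)))) := by
  have h1 : ∑ j ∈ range (l + 1 + 1), Y j * genCoeff v' (l + 1 - j) k -
      ∑ j ∈ range (l + 1 + 1), Y j * genCoeff v (l + 1 - j) k =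
      (v' (l + 1, k) - v (l + 1, k)) + Y 1 * (v' (l, k) - v (l, k)) := by
    rw [← sum_sub_distrib, sum_range_succ', sum_range_succ', sum_eq_zero]
    · simp [genCoeff_of_pos _ hl, genCoeff_of_pos _ (Nat.succ_ne_zero l), hY]
      ring
    · intro j _
      rw [genCoeff_congr h (by omega), sub_self]
  have h2 : ∑ j ∈ range (l + 1), genCoeff v' (l + 1 - j) (k + p + j) * mulCoeff p Y v' j k -
      ∑ j ∈ range (l + 1), genCoeff v (l + 1 - j) (k + p + j) * mulCoeff p Y v j k =
      (v' (l + 1, k + p) - v (l + 1, k + p)) +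
      ((v' (l, k + p + 1) - v (l, k + p + 1)) * mulCoeff p Y v' 1 k +
        v (1, k + p + l) * ((v' (l, k) - v (l, k)) - (v' (l, k + p) - v (l, k + p)))) := by
    rw [← sum_sub_distrib, sum_range_succ']
    have e1 : ∀ j, genCoeff v' (l + 1 - (j + 1)) (k + p + (j + 1 : ℕ)) * mulCoeff p Y v' (j + 1) k -
        genCoeff v (l + 1 - (j + 1)) (k + p + (j + 1 : ℕ)) * mulCoeff p Y v (j + 1) k =
        (genCoeff v' (l - j) (k + p + (j + 1 : ℕ)) - genCoeff v (l - j) (k + p + (j + 1 : ℕ))) *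
          mulCoeff p Y v' (j + 1) k +
        genCoeff v (l - j) (k + p + (j + 1 : ℕ)) *
          (mulCoeff p Y v' (j + 1) k - mulCoeff p Y v (j + 1) k) := by
      intro j
      rw [Nat.add_sub_add_right]
      ring
    simp only [e1, sum_add_distrib]
    -- Apart from the term split off before, only two products involve coefficients of order `l`:
    -- the coefficient of order `l` times `N_1`, at `j = 0`, and a coefficient of order `1` times
    -- the change of `N_l`, at `j = l - 1`.
    rw [sum_eq_single 0, sum_eq_single (l - 1), mulCoeff_zero, mulCoeff_zero]
    · have e2 : l - 1 + 1 = l := by omega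
      have e3 : l - (l - 1) = 1 := by omega
      rw [e2, e3, mulCoeff_sub hY hl h, genCoeff_of_pos _ one_ne_zero]
      simp [genCoeff_of_pos _ hl, genCoeff_of_pos _ (Nat.succ_ne_zero l), hY]
      ring
    · intro j hj hj1
      rw [mem_range] at hj
      rw [mulCoeff_congr h (by omega), sub_self, mul_zero]
    · intro h0
      exact absurd (mem_range.2 (by omega)) h0
    · intro j hj hj1
      rw [genCoeff_congr h (by omega), sub_self, zero_mul]
    · intro h0
      exact absurd (mem_range.2 (by omega)) h0
  rw [mulCoeff_eq p Y v', mulCoeff_eq p Y v, sub_sub_sub_comm, h1, h2]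
  ring

end Coefficients

/-! ## Sums over residue classes -/

section Classes

variable {d n : ℕ}

/-- The class modulo `d` of a residue modulo `d n`. -/
def residueClass (d n : ℕ) : ZMod (d * n) →+* ZMod d := ZMod.castHom (dvd_mul_right d n) (ZMod d)

theorem residueClass_surjective : Function.Surjective (residueClass d n) :=
  ZMod.castHom_surjective _

variable [NeZero d] [NeZero n]

/-- The residues modulo `d n` in a class modulo `d`. -/
def classFinset (n : ℕ) [NeZero n] (i : ZMod d) : Finset (ZMod (d * n)) :=
  univ.filter fun k => residueClass d n k = i

@[simp] theorem mem_classFinset {i : ZMod d} {k : ZMod (d * n)} :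
    k ∈ classFinset n i ↔ residueClass d n k = i := by simp [classFinset]

theorem sum_classFinset_add (i : ZMod d) (a : ZMod (d * n)) (F : ZMod (d * n) → ℂ) :
    ∑ k ∈ classFinset n i, F (k + a) = ∑ k ∈ classFinset n (i + residueClass d n a), F k := by
  refine sum_bij (fun k _ => k + a) ?_ ?_ ?_ ?_
  · intro k hk
    rw [mem_classFinset] at hk ⊢
    rw [map_add, hk]
  · intro a₁ _ a₂ _ h
    exact add_right_cancel h
  · intro b hb
    rw [mem_classFinset] at hb
    exact ⟨b - a, by rw [mem_classFinset, map_sub, hb, add_sub_cancel_right], sub_add_cancel b a⟩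
  · intro _ _
    rfl

theorem card_classFinset (i : ZMod d) : (classFinset n i).card = n := by
  have h1 : ∀ i : ZMod d, (classFinset n i).card = (classFinset n (0 : ZMod d)).card := by
    intro i
    obtain ⟨a, ha⟩ := residueClass_surjective (d := d) (n := n) i
    have := sum_classFinset_add (0 : ZMod d) a (fun _ => (1 : ℂ))
    simp only [ha, zero_add, sum_const, nsmul_eq_mul, mul_one] at this
    exact_mod_cast this.symm
  have h2 := Finset.card_eq_sum_card_fiberwise (s := (univ : Finset (ZMod (d * n))))
    (t := (univ : Finset (ZMod d))) (f := residueClass d n) (fun _ _ => by simp)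
  have h3 : ∀ i : ZMod d, #{a | residueClass d n a = i} = (classFinset n (0 : ZMod d)).card := h1
  simp only [h3, sum_const, card_univ, ZMod.card, smul_eq_mul] at h2
  rw [h1]
  exact (Nat.eq_of_mul_eq_mul_left (NeZero.pos d) h2).symm

/-- As `gcd(n, m) = 1`, translation by `dm` acts transitively on the residues modulo `dn` in a given
class modulo `d`. -/
theorem eq_of_forall_add_eq {m : ℕ} (hnm : Nat.Coprime n m) {T : Type*} {F : ZMod (d * n) → T}
    (hF : ∀ k, F (k + (d * m : ℕ)) = F k) {k k' : ZMod (d * n)}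
    (hk : residueClass d n k = residueClass d n k') : F k = F k' := by
  have h1 : ∀ t : ℕ, F (k + t * (d * m : ℕ)) = F k := by
    intro t
    induction t with
    | zero => simp
    | succ t ih =>
      rw [← ih, ← hF (k + t * (d * m : ℕ))]
      congr 1
      push_cast
      ring
  have h2 : residueClass d n (k' - k) = 0 := by rw [map_sub, hk, sub_self]
  have h3 : (d : ℕ) ∣ (k' - k).val := by
    rw [← ZMod.natCast_eq_zero_iff]
    rw [← h2, ← map_natCast (residueClass d n), ZMod.natCast_zmod_val]
  obtain ⟨u, hu⟩ := h3
  obtain ⟨t, ht⟩ : ∃ t : ℕ, ((t * m : ℕ) : ZMod n) = (u : ℕ) := by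
    refine ⟨((u : ZMod n) * (m : ZMod n)⁻¹).val, ?_⟩
    push_cast
    rw [ZMod.natCast_zmod_val, mul_assoc, mul_comm (m : ZMod n)⁻¹, ZMod.coe_mul_inv_eq_one m hnm.symm,
      mul_one]
  have h4 : ((d * (t * m) : ℕ) : ZMod (d * n)) = (d * u : ℕ) := by
    rw [ZMod.natCast_eq_natCast_iff] at ht ⊢
    exact Nat.ModEq.mul_left' d ht
  rw [← h1 t]
  congr 1
  have h5 : k' - k = ((d * u : ℕ) : ZMod (d * n)) := by
    rw [← hu, ZMod.natCast_zmod_val]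
  rw [← h4] at h5
  rw [← sub_add_cancel k' k, h5]
  push_cast
  ring

end Classes

end

section

open Finset

noncomputable section

/-! ## The equations of a cell -/

section GenData

variable {d n m : ℕ}

/-- The properties of the generators `α k ≡ k` modulo `d n` of an admissible semimodule that the
equations of the cell depend on. -/
structure GenData (d n m : ℕ) (α : ZMod (d * n) → ℤ) : Prop where
  add_le : ∀ k, α (k + (d * m : ℕ)) ≤ α k + (d * m : ℕ)
  adm : ∀ i : ZMod d, ∃ k, residueClass d n k = i ∧
    α (k + (d * m : ℕ) + (1 : ℕ)) ≤ α k + (d * m : ℕ) + (1 : ℕ)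

variable {q : ℕ}

/-- `α k + l ∉ Δ`: the coefficient of order `l` of `f_k` is a variable. -/
def IsVar (α : ZMod q → ℤ) (l : ℕ) (k : ZMod q) : Prop := α k + l < α (k + l)

/-- `α k + p + l ∉ Δ`: there is an equation of order `l` for `y f_k`. -/
def IsEqn (α : ZMod q → ℤ) (p l : ℕ) (k : ZMod q) : Prop := α k + p + l < α (k + p + l)

/-- `s + l ∉ Δ`: there is an equation of order `l` for `t^s`. -/
def IsPin (α : ZMod q → ℤ) (s : ℤ) (l : ℕ) : Prop := s + l < α (s + l)

/-- All residues in the class `i` have an equation of order `l`. -/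
def IsFull [NeZero d] [NeZero n] (α : ZMod (d * n) → ℤ) (p l : ℕ) (i : ZMod d) : Prop :=
  ∀ k ∈ classFinset n i, IsEqn α p l k

theorem IsPin.isVar {α : ZMod q → ℤ} {s : ℤ} (hs : α s ≤ s) {l : ℕ} (h : IsPin α s l) :
    IsVar α l s := by
  unfold IsVar IsPin at *
  omega

namespace GenData

variable {α : ZMod (d * n) → ℤ} {l : ℕ} {k : ZMod (d * n)}

/-- `Δ` is stable under adding `dm`, so a gap `α k + dm + l` forces `α k + l` to be a gap. With
`isVar_add_of_isEqn`, both unknowns in the linear part of an equation really occur. -/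
theorem isVar_of_isEqn (hα : GenData d n m α) (h : IsEqn α (d * m) l k) : IsVar α l k := by
  unfold IsVar IsEqn at *
  have h1 := hα.add_le (k + l)
  rw [add_right_comm] at h1
  omega

theorem isVar_add_of_isEqn (hα : GenData d n m α) (h : IsEqn α (d * m) l k) : IsVar α l (k + (d * m : ℕ)) := by
  unfold IsVar IsEqn at *
  have h1 := hα.add_le k
  omega

theorem not_isEqn_zero (hα : GenData d n m α) : ¬ IsEqn α (d * m) 0 k := by
  unfold IsEqn
  have := hα.add_le k
  simp only [Nat.cast_zero, add_zero]
  omega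

variable [NeZero d] [NeZero n]

theorem not_isFull_one (hα : GenData d n m α) (i : ZMod d) : ¬ IsFull α (d * m) 1 i := by
  intro h
  obtain ⟨k, hk, h1⟩ := hα.adm i
  have := h k (by simpa using hk)
  unfold IsEqn at this
  omega

end GenData

/-- If `α k + l` lies in `Δ`, the generator of its residue is at most `α k + l`, so the gap `α k + p
+ l + 1` is also a gap one order above `p` for that generator. Thus where an unknown of order `l` is
missing, the factor `N_1(k + l)` that would multiply it vanishes. -/
theorem isEqn_one_add {α : ZMod q → ℤ} {p l : ℕ} {k : ZMod q}
    (h : IsEqn α p (l + 1) k) (h' : ¬ IsVar α l k) : IsEqn α p 1 (k + l) := by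
  unfold IsVar IsEqn at *
  have e : k + l + p + (1 : ℕ) = k + p + (l + 1 : ℕ) := by push_cast; ring
  rw [e]
  push_cast at *
  omega

theorem isVar_add_one {α : ZMod q → ℤ} {p l : ℕ} {k : ZMod q}
    (h : IsEqn α p (l + 1) k) (h' : ¬ IsEqn α p 1 k) : IsVar α l (k + p + 1) := by
  unfold IsVar IsEqn at *
  have e : k + p + 1 + l = k + p + (l + 1 : ℕ) := by push_cast; ring
  rw [e]
  push_cast at *
  omega

/-- Summed over all residues, the strict inequalities `α k + p + l < α (k + p + l)` contradict the
invariance of `∑ α` under translation. -/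
theorem exists_not_isFull [NeZero d] [NeZero n] (α : ZMod (d * n) → ℤ) (p l : ℕ) :
    ∃ i : ZMod d, ¬ IsFull α p l i := by
  by_contra! h
  have h1 : ∑ k, α (k + (p + l : ℕ)) = ∑ k, α k :=
    Equiv.sum_comp (Equiv.addRight ((p + l : ℕ) : ZMod (d * n))) α
  have h2 : ∑ k, α k < ∑ k, α (k + (p + l : ℕ)) := by
    refine sum_lt_sum_of_nonempty univ_nonempty fun k _ => ?_
    have := h (residueClass d n k) k (by simp)
    unfold IsEqn at this
    push_cast
    rw [← add_assoc]
    omega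
  omega

end GenData

/-! ## Linear parts of the equations -/

section Linear

open Classical in
/-- The variables of order `l`. -/
def levelVars {q : ℕ} [NeZero q] (α : ZMod q → ℤ) (l : ℕ) : Finset (ℕ × ZMod q) :=
  (univ.filter (IsVar α l)).image (Prod.mk l)

@[simp] theorem mem_levelVars {q : ℕ} [NeZero q] {α : ZMod q → ℤ} {l l' : ℕ} {k : ZMod q} :
    (l', k) ∈ levelVars α l ↔ l' = l ∧ IsVar α l k := by
  simp only [levelVars, mem_image, mem_filter, mem_univ, true_and, Prod.mk.injEq]
  constructor
  · rintro ⟨a, ha, rfl, rfl⟩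
    exact ⟨rfl, ha⟩
  · rintro ⟨rfl, h⟩
    exact ⟨k, h, rfl, rfl⟩

open Classical in
theorem card_levelVars {q : ℕ} [NeZero q] (α : ZMod q → ℤ) (l : ℕ) :
    (levelVars α l).card = (univ.filter (IsVar α l)).card :=
  card_image_of_injective _ (Prod.mk_right_injective l)

variable {d n m : ℕ} [NeZero d] [NeZero n] {α : ZMod (d * n) → ℤ} (hα : GenData d n m α)

/-- The linear parts of the equations of order `l`. -/
def eqnMap (hα : GenData d n m α) (l : ℕ) :
    (levelVars α l → ℂ) →ₗ[ℂ] ({k // IsEqn α (d * m) l k} → ℂ) where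
  toFun w k := w ⟨(l, k), mem_levelVars.2 ⟨rfl, hα.isVar_of_isEqn k.2⟩⟩ -
    w ⟨(l, k + (d * m : ℕ)), mem_levelVars.2 ⟨rfl, hα.isVar_add_of_isEqn k.2⟩⟩
  map_add' w w' := by
    funext k
    simp only [Pi.add_apply]
    ring
  map_smul' c w := by
    funext k
    simp only [Pi.smul_apply, smul_eq_mul, RingHom.id_apply]
    ring

theorem eqnMap_apply (l : ℕ) (w : levelVars α l → ℂ) (k : {k // IsEqn α (d * m) l k}) :
    eqnMap hα l w k = w ⟨(l, k), mem_levelVars.2 ⟨rfl, hα.isVar_of_isEqn k.2⟩⟩ -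
    w ⟨(l, k + (d * m : ℕ)), mem_levelVars.2 ⟨rfl, hα.isVar_add_of_isEqn k.2⟩⟩ := rfl

open Classical in
/-- The sums of equations of order `l` over full classes. -/
def fullSum (α : ZMod (d * n) → ℤ) (p l : ℕ) :
    ({k // IsEqn α p l k} → ℂ) →ₗ[ℂ] ({i // IsFull α p l i} → ℂ) where
  toFun y i := ∑ k : {k // IsEqn α p l k}, if residueClass d n k = i then y k else 0
  map_add' y y' := by
    funext i
    simp only [Pi.add_apply, ← sum_add_distrib]
    exact sum_congr rfl fun k _ => by split_ifs <;> simp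
  map_smul' c y := by
    funext i
    simp only [Pi.smul_apply, smul_eq_mul, RingHom.id_apply, mul_sum]
    exact sum_congr rfl fun k _ => by split_ifs <;> simp

open Classical in
theorem fullSum_apply (p l : ℕ) (F : ZMod (d * n) → ℂ) (i : {i // IsFull α p l i}) :
    fullSum α p l (fun k => F k) i = ∑ k ∈ classFinset n i.1, F k := by
  change ∑ k : {k // IsEqn α p l k}, (if residueClass d n k = i then F k else 0) = _
  rw [← sum_filter]
  refine sum_bij (fun k _ => k.1) ?_ ?_ ?_ ?_
  · intro k hk
    simpa using hk
  · intro a _ b _ h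
    exact Subtype.ext h
  · intro k hk
    exact ⟨⟨k, i.2 k hk⟩, by simpa using hk, rfl⟩
  · intro _ _
    rfl

theorem fullSum_surjective (p l : ℕ) : Function.Surjective (fullSum α p l) := by
  classical
  intro z
  let rep : ZMod d → ZMod (d * n) := Function.surjInv residueClass_surjective
  have hrep : ∀ i, residueClass d n (rep i) = i := Function.surjInv_eq _
  refine ⟨fun k => if h : IsFull α p l (residueClass d n k) then
    if k = rep (residueClass d n k) then z ⟨_, h⟩ else 0 else 0, ?_⟩
  funext i
  rw [fullSum_apply p l (fun k => if h : IsFull α p l (residueClass d n k) then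
    if k = rep (residueClass d n k) then z ⟨_, h⟩ else 0 else 0) i, sum_eq_single (rep i.1)]
  · simp only [hrep]
    rw [dif_pos i.2, if_pos trivial]
  · intro k hk hki
    rw [mem_classFinset] at hk
    split_ifs with h1 h2
    · rw [hk] at h2
      exact absurd h2 hki
    · rfl
    · rfl
  · intro h
    exact absurd (mem_classFinset.2 (hrep i.1)) h

theorem Module.Dual.eq_sum_single {ι : Type*} [Fintype ι] [DecidableEq ι]
    (f : (ι → ℂ) →ₗ[ℂ] ℂ) (y : ι → ℂ) : f y = ∑ i, y i * f (Pi.single i 1) := by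
  conv_lhs => rw [← Finset.univ_sum_single y]
  rw [map_sum]
  refine sum_congr rfl fun i _ => ?_
  rw [← smul_eq_mul, ← map_smul, ← Pi.single_smul]
  simp

/-- Class sums of differences telescope to zero. Conversely, a functional that kills the range has
coefficients invariant under `k ↦ k + dm`, hence constant on classes modulo `d`, and zero on a class
in which some residue has no equation. So it is a combination of the sums over full classes. -/
theorem range_eqnMap (hnm : Nat.Coprime n m) (l : ℕ) :
    LinearMap.range (eqnMap hα l) = LinearMap.ker (fullSum α (d * m) l) := by
  classical
  apply le_antisymm
  · rintro _ ⟨w, rfl⟩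
    rw [LinearMap.mem_ker]
    funext i
    let G : ZMod (d * n) → ℂ := fun k => if h : IsVar α l k then
      w ⟨(l, k), mem_levelVars.2 ⟨rfl, h⟩⟩ else 0
    have h1 : eqnMap hα l w = fun k : {k // IsEqn α (d * m) l k} =>
        G k - G (k + (d * m : ℕ)) := by
      funext k
      rw [eqnMap_apply]
      simp only [G]
      rw [dif_pos (hα.isVar_of_isEqn k.2), dif_pos (hα.isVar_add_of_isEqn k.2)]
    rw [h1, fullSum_apply (d * m) l (fun k => G k - G (k + (d * m : ℕ))) i, sum_sub_distrib,
      sum_classFinset_add]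
    simp
  · intro y hy
    by_contra hy'
    obtain ⟨f, hf, hf'⟩ := Submodule.exists_le_ker_of_notMem hy'
    let c : ZMod (d * n) → ℂ := fun k => if h : IsEqn α (d * m) l k then
      f (Pi.single ⟨k, h⟩ 1) else 0
    -- The unknown at `k + dm` enters only the equations at `k + dm`, with sign `+`, and at `k`,
    -- with sign `-`.
    have hc : ∀ k, c (k + (d * m : ℕ)) = c k := by
      intro k
      by_cases hk : IsVar α l (k + (d * m : ℕ))
      · have h1 : f (eqnMap hα l (Pi.single ⟨(l, k + (d * m : ℕ)), mem_levelVars.2 ⟨rfl, hk⟩⟩ 1)) =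
            0 := hf' ⟨_, rfl⟩
        have h2 : eqnMap hα l (Pi.single ⟨(l, k + (d * m : ℕ)), mem_levelVars.2 ⟨rfl, hk⟩⟩ 1) =
            (fun k' => if k'.1 = k + (d * m : ℕ) then 1 else 0) -
              (fun k' => if k'.1 = k then 1 else 0) := by
          funext k'
          rw [eqnMap_apply]
          simp only [Pi.single_apply, Subtype.mk.injEq, Prod.mk.injEq, true_and, Pi.sub_apply,
            add_left_inj]
        have h3 : ∀ k₀, f (fun k' : {k // IsEqn α (d * m) l k} =>
            if k'.1 = k₀ then (1 : ℂ) else 0) = c k₀ := by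
          intro k₀
          simp only [c]
          split_ifs with h
          · congr 1
            funext k'
            simp [Pi.single_apply, Subtype.ext_iff]
          · convert map_zero f
            rename_i k'
            exact if_neg fun h' : k'.1 = k₀ => h (h' ▸ k'.2)
        rw [h2, map_sub, h3, h3] at h1
        exact sub_eq_zero.1 h1
      · have h1 : ¬ IsEqn α (d * m) l (k + (d * m : ℕ)) := fun h => hk (hα.isVar_of_isEqn h)
        have h2 : ¬ IsEqn α (d * m) l k := fun h => hk (hα.isVar_add_of_isEqn h)
        simp only [c, dif_neg h1, dif_neg h2]
    have hc' : ∀ k, ¬ IsFull α (d * m) l (residueClass d n k) → c k = 0 := by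
      intro k hk
      unfold IsFull at hk
      push Not at hk
      obtain ⟨k', hk', h'⟩ := hk
      rw [mem_classFinset] at hk'
      rw [← eq_of_forall_add_eq hnm hc hk']
      simp only [c, dif_neg h']
    apply hf
    rw [Module.Dual.eq_sum_single f y]
    let Y' : ZMod (d * n) → ℂ := fun k => if h : IsEqn α (d * m) l k then y ⟨k, h⟩ else 0
    have e1 : ∑ k : {k // IsEqn α (d * m) l k}, y k * f (Pi.single k 1) = ∑ k, Y' k * c k := by
      rw [← Finset.sum_subset (filter_subset (IsEqn α (d * m) l) univ),
        Finset.sum_subtype _ (p := IsEqn α (d * m) l) (by simp)]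
      · refine sum_congr rfl fun k _ => ?_
        simp only [Y', c, dif_pos k.2]
      · intro k _ hk
        rw [mem_filter, not_and] at hk
        simp only [Y', dif_neg (hk (mem_univ k)), zero_mul]
    rw [e1, ← sum_fiberwise (s := univ) (g := residueClass d n)]
    refine sum_eq_zero fun i _ => ?_
    by_cases hi : IsFull α (d * m) l i
    · have h1 : ∑ k ∈ classFinset n i, Y' k = 0 := by
        rw [← fullSum_apply (d * m) l Y' ⟨i, hi⟩]
        have h2 : (fun k : {k // IsEqn α (d * m) l k} => Y' k) = y := by
          funext k
          simp only [Y', dif_pos k.2]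
        rw [h2, LinearMap.mem_ker.1 hy]
        rfl
      obtain ⟨k₀, hk₀⟩ := residueClass_surjective (d := d) (n := n) i
      calc ∑ k with residueClass d n k = i, Y' k * c k
          = ∑ k ∈ classFinset n i, Y' k * c k₀ := by
            refine sum_congr rfl fun k hk => ?_
            rw [eq_of_forall_add_eq hnm hc (k := k) (k' := k₀)]
            rw [hk₀]
            exact (mem_filter.1 hk).2
        _ = 0 := by rw [← sum_mul, h1, zero_mul]
    · refine sum_eq_zero fun k hk => ?_
      rw [hc' k (by rwa [(mem_filter.1 hk).2]), mul_zero]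

open Classical in
theorem finrank_ker_eqnMap (hnm : Nat.Coprime n m) (l : ℕ) :
    Module.finrank ℂ (LinearMap.ker (eqnMap hα l)) + (univ.filter (IsEqn α (d * m) l)).card =
      (univ.filter (IsVar α l)).card + (univ.filter (IsFull α (d * m) l)).card := by
  have h1 := LinearMap.finrank_range_add_finrank_ker (eqnMap hα l)
  have h2 := LinearMap.finrank_range_add_finrank_ker (fullSum α (d * m) l)
  rw [LinearMap.range_eq_top.2 (fullSum_surjective (d * m) l), finrank_top,
    Module.finrank_fintype_fun_eq_card, Module.finrank_fintype_fun_eq_card,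
    Fintype.card_of_subtype (univ.filter (IsEqn α (d * m) l)) (by simp),
    Fintype.card_of_subtype (univ.filter (IsFull α (d * m) l)) (by simp),
    ← range_eqnMap hα hnm] at h2
  rw [Module.finrank_fintype_fun_eq_card, Fintype.card_coe, card_levelVars] at h1
  omega

end Linear

end

end

section

open Finset

noncomputable section

/-! ### Solving the equations of a cell order by order -/

section Levels

theorem residueClass_mul {d n : ℕ} (m : ℕ) : residueClass d n (d * m : ℕ) = 0 := by simp

variable {d n m : ℕ} [NeZero d] [NeZero n] {α : ZMod (d * n) → ℤ}
  {Y : ℕ → ℂ} {v v' : ℕ × ZMod (d * n) → ℂ} {l : ℕ}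

/-- `N_1(k) = v_{1,k} - v_{1,k+dm} + Y_1`, and the difference telescopes over a class, which has `n`
elements. This constant, nonzero for a generic branch, makes the later translations effective. -/
theorem sum_classFinset_mulCoeff_one (hY : Y 0 = 1) (i : ZMod d) (a : ZMod (d * n)) :
    ∑ k ∈ classFinset n i, mulCoeff (d * m) Y v 1 (k + a) = n * Y 1 := by
  have h := sum_classFinset_add (i + residueClass d n a) ((d * m : ℕ) : ZMod (d * n))
    (fun k => v (1, k))
  rw [residueClass_mul, add_zero] at h
  rw [sum_classFinset_add i a (fun k => mulCoeff (d * m) Y v 1 k)]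
  simp only [mulCoeff_one, hY, one_mul, sum_add_distrib, sum_sub_distrib, h, sub_self, zero_add,
    sum_const, card_classFinset, nsmul_eq_mul]

/-- Over a full class modulo `d` the unknowns of order `l + 1` telescope away. A shift by `dm` then
regroups the products of coefficients of orders `1` and `l` into values of `N_1`. -/
theorem sum_classFinset_mulCoeff_sub (hY : Y 0 = 1) (hl : l ≠ 0)
    (h : ∀ j < l, ∀ k, v' (j, k) = v (j, k)) (i : ZMod d) :
    ∑ k ∈ classFinset n i, mulCoeff (d * m) Y v' (l + 1) k -
      ∑ k ∈ classFinset n i, mulCoeff (d * m) Y v (l + 1) k =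
    ∑ k ∈ classFinset n i, (v' (l, k) - v (l, k)) * mulCoeff (d * m) Y v 1 (k + l) -
      ∑ k ∈ classFinset n i, (v' (l, k + (d * m : ℕ) + 1) - v (l, k + (d * m : ℕ) + 1)) *
        mulCoeff (d * m) Y v' 1 k := by
  have shift : ∀ F : ZMod (d * n) → ℂ,
      ∑ k ∈ classFinset n i, F (k + (d * m : ℕ)) = ∑ k ∈ classFinset n i, F k := by
    intro F
    rw [sum_classFinset_add, residueClass_mul, add_zero]
  rw [← sum_sub_distrib, sum_congr rfl fun k _ => mulCoeff_succ_sub hY hl h k]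
  have h1 := shift fun k => v' (l + 1, k) - v (l + 1, k)
  have h2 := shift fun k => v (1, k + l) * (v' (l, k) - v (l, k))
  simp only [mul_sub, sum_add_distrib, sum_sub_distrib, sub_mul, mulCoeff_one, hY, one_mul, mul_add]
    at h1 h2 ⊢
  have e : ∀ k : ZMod (d * n), k + (d * m : ℕ) + l = k + l + (d * m : ℕ) := fun k => by ring
  simp only [e] at h2 ⊢
  have c : ∀ k : ZMod (d * n), v' (l, k) * v (1, k + l) = v (1, k + l) * v' (l, k) :=
    fun k => mul_comm _ _
  have c' : ∀ k : ZMod (d * n), v (l, k) * v (1, k + l) = v (1, k + l) * v (l, k) :=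
    fun k => mul_comm _ _
  have c1 : ∀ k : ZMod (d * n), v' (l, k) * v (1, k + l + (d * m : ℕ)) =
    v (1, k + l + (d * m : ℕ)) * v' (l, k) := fun k => mul_comm _ _
  have c1' : ∀ k : ZMod (d * n), v (l, k) * v (1, k + l + (d * m : ℕ)) =
    v (1, k + l + (d * m : ℕ)) * v (l, k) := fun k => mul_comm _ _
  have c2 : ∀ k : ZMod (d * n), v' (l, k) * Y 1 = Y 1 * v' (l, k) := fun k => mul_comm _ _
  have c2' : ∀ k : ZMod (d * n), v (l, k) * Y 1 = Y 1 * v (l, k) := fun k => mul_comm _ _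
  simp only [c, c', c1, c1', c2, c2']
  linear_combination h2 - h1

variable (α) (m) in
/-- The conditions that are solved by translations of the variables of order `l`. -/
abbrev ShiftIndex (s : ℤ) (l : ℕ) : Type :=
  {i // IsFull α (d * m) (l + 1) i} ⊕ {_u : Unit // IsPin α s l}

variable (α) (m) (Y) in
/-- The effect of translations by class functions. -/
def shiftMap (s : ℤ) (l : ℕ) : (ZMod d → ℂ) →ₗ[ℂ] (ShiftIndex m α s l → ℂ) where
  toFun c x := match x with
    | Sum.inl i => n * Y 1 * (c i - c (i + 1))
    | Sum.inr _ => -c (residueClass d n s)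
  map_add' c c' := by
    funext x
    rcases x with x | x
    · simp only [Pi.add_apply]
      ring
    · simp only [Pi.add_apply]
      ring
  map_smul' a c := by
    funext x
    rcases x with x | x
    · simp only [Pi.smul_apply, smul_eq_mul, RingHom.id_apply]
      ring
    · simp only [Pi.smul_apply, smul_eq_mul, RingHom.id_apply]
      ring

theorem shiftMap_inl (s : ℤ) (c : ZMod d → ℂ) (i : {i // IsFull α (d * m) (l + 1) i}) :
    shiftMap m α Y s l c (Sum.inl i) = n * Y 1 * (c i - c (i + 1)) := rfl

theorem shiftMap_inr (s : ℤ) (c : ZMod d → ℂ) (i : {_u : Unit // IsPin α s l}) :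
    shiftMap m α Y s l c (Sum.inr i) = -c (residueClass d n s) := rfl

/-- Let a functional kill the range. Constant functions `c` show that its coefficient on the
equation for `t^s` is zero. Delta functions show that its coefficients on full classes, extended by
zero, are invariant under `i ↦ i + 1`; since some class is not full, they vanish. -/
theorem shiftMap_surjective (hY1 : Y 1 ≠ 0) (s : ℤ) :
    Function.Surjective (shiftMap m α Y s l) := by
  classical
  rw [← LinearMap.range_eq_top]
  by_contra hne
  obtain ⟨f, hf, hf'⟩ := Submodule.exists_le_ker_of_lt_top _ (lt_top_iff_ne_top.2 hne)
  have hf0 : ∀ c, f (shiftMap m α Y s l c) = 0 := fun c => hf' ⟨c, rfl⟩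
  let β : ZMod d → ℂ := fun i => if h : IsFull α (d * m) (l + 1) i then
    f (Pi.single (Sum.inl ⟨i, h⟩) 1) else 0
  let γ : ℂ := if h : IsPin α s l then f (Pi.single (Sum.inr ⟨(), h⟩) 1) else 0
  have key : ∀ c : ZMod d → ℂ, f (shiftMap m α Y s l c) =
      ∑ i, n * Y 1 * (c i - c (i + 1)) * β i - c (residueClass d n s) * γ := by
    intro c
    rw [Module.Dual.eq_sum_single f, Fintype.sum_sum_type, sub_eq_add_neg]
    congr 1
    · simp only [shiftMap_inl]
      rw [← Finset.sum_subset (filter_subset (IsFull α (d * m) (l + 1)) univ),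
        Finset.sum_subtype _ (p := IsFull α (d * m) (l + 1)) (by simp)]
      · refine sum_congr rfl fun k _ => ?_
        simp only [β, dif_pos k.2]
      · intro k _ hk
        rw [mem_filter, not_and] at hk
        simp only [β, dif_neg (hk (mem_univ k)), mul_zero]
    · simp only [shiftMap_inr]
      by_cases h : IsPin α s l
      · let : Unique {_u : Unit // IsPin α s l} := ⟨⟨⟨(), h⟩⟩, fun _ => Subsingleton.elim _ _⟩
        rw [Fintype.sum_unique]
        simp only [γ, dif_pos h, neg_mul]
      · have : IsEmpty {_u : Unit // IsPin α s l} := ⟨fun x => h x.2⟩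
        simp only [γ, dif_neg h, univ_eq_empty, sum_empty, mul_zero, neg_zero]
  have hγ : γ = 0 := by
    have := (key fun _ => 1).symm.trans (hf0 _)
    simpa using this
  have hβ : ∀ i, β (i + 1) = β i := by
    intro i
    have h1 := (key (Pi.single (i + 1) 1)).symm.trans (hf0 _)
    rw [hγ, mul_zero, sub_zero] at h1
    have h2 : ∀ j, n * Y 1 * ((Pi.single (i + 1) 1 : ZMod d → ℂ) j -
        (Pi.single (i + 1) 1 : ZMod d → ℂ) (j + 1)) * β j =
        n * Y 1 * ((if j = i + 1 then β j else 0) - (if j = i then β j else 0)) := by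
      intro j
      simp only [Pi.single_apply, add_left_inj]
      split_ifs <;> ring
    simp only [h2, ← mul_sum, sum_sub_distrib, sum_ite_eq', mem_univ, if_true] at h1
    have h3 : (n : ℂ) * Y 1 ≠ 0 := mul_ne_zero (NeZero.ne _) hY1
    exact sub_eq_zero.1 ((mul_eq_zero.1 h1).resolve_left h3)
  obtain ⟨i₀, hi₀⟩ := exists_not_isFull α (d * m) (l + 1)
  have hβ0 : ∀ i, β i = 0 := by
    have h1 : ∀ t : ℕ, β (i₀ + t) = 0 := by
      intro t
      induction t with
      | zero => simp only [Nat.cast_zero, add_zero, β, dif_neg hi₀]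
      | succ t ih => rw [Nat.cast_succ, ← add_assoc, hβ, ih]
    intro i
    have := h1 (i - i₀).val
    rwa [ZMod.natCast_zmod_val, add_sub_cancel] at this
  apply hf
  ext x
  rcases x with x | x
  · have := hβ0 x
    simp only [β, dif_pos x.2] at this
    simpa using this
  · have h1 := hγ
    simp only [γ, dif_pos x.2] at h1
    simpa using h1

variable (α) (m) (Y) in
/-- The coefficients of order at most `L` that satisfy all conditions on them. -/
def levelSet (s : ℤ) (L : ℕ) : Set (ℕ × ZMod (d * n) → ℂ) :=
  {v | (∀ l k, ¬ (1 ≤ l ∧ l ≤ L ∧ IsVar α l k) → v (l, k) = 0) ∧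
    (∀ l ≤ L, ∀ k, IsEqn α (d * m) l k → mulCoeff (d * m) Y v l k = 0) ∧
    (∀ l ≤ L, IsPin α s l → powCoeff v s l = 0) ∧
    ∀ i, IsFull α (d * m) (L + 1) i →
      ∑ k ∈ classFinset n i, mulCoeff (d * m) Y v (L + 1) k = 0}

theorem levelSet_zero (hα : GenData d n m α) {s : ℤ} (hs : α s ≤ s) : levelSet m α Y s 0 = {0} := by
  ext v
  constructor
  · intro hv
    rw [Set.mem_singleton_iff]
    funext x
    exact hv.1 x.1 x.2 (by omega)
  · rintro rfl
    refine ⟨fun _ _ _ => rfl, ?_, ?_, ?_⟩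
    · intro l hl k hk
      obtain rfl : l = 0 := by omega
      exact absurd hk hα.not_isEqn_zero
    · intro l hl hk
      obtain rfl : l = 0 := by omega
      unfold IsPin at hk
      simp only [Nat.cast_zero, add_zero] at hk
      omega
    · intro i hi
      exact absurd hi (hα.not_isFull_one i)

/-- Where `h` is not controlled because there is no unknown of order `l`, the factor `N_1(k + l)`
vanishes by an equation of order `1`. So `h` may be replaced by the constant `c i` on the class. -/
theorem IsFull.sum_mul_mulCoeff_one {i : ZMod d} (hi : IsFull α (d * m) (l + 1) i) {c : ZMod d → ℂ}
    {h : ZMod (d * n) → ℂ} (hh : ∀ k, IsVar α l k → h k = c (residueClass d n k)) (hY : Y 0 = 1)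
    (hv : ∀ k, IsEqn α (d * m) 1 k → mulCoeff (d * m) Y v 1 k = 0) :
    ∑ k ∈ classFinset n i, h k * mulCoeff (d * m) Y v 1 (k + l) = n * Y 1 * c i := by
  have h0 := sum_classFinset_mulCoeff_one (v := v) (m := m) hY i (l : ZMod (d * n))
  rw [← h0, sum_mul]
  refine sum_congr rfl fun k hk => ?_
  by_cases hvar : IsVar α l k
  · rw [hh k hvar, mem_classFinset.1 hk, mul_comm]
  · rw [hv _ (isEqn_one_add (hi k hk) hvar), mul_zero, zero_mul]

/-- The same argument for the shifted argument: either `N_1(k)` vanishes by an equation, or `k + dm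
+ 1` carries an unknown of order `l`. -/
theorem IsFull.sum_mul_mulCoeff_one' {i : ZMod d} (hi : IsFull α (d * m) (l + 1) i)
    {c : ZMod d → ℂ} {h : ZMod (d * n) → ℂ}
    (hh : ∀ k, IsVar α l k → h k = c (residueClass d n k)) (hY : Y 0 = 1)
    (hv : ∀ k, IsEqn α (d * m) 1 k → mulCoeff (d * m) Y v 1 k = 0) :
    ∑ k ∈ classFinset n i, h (k + (d * m : ℕ) + 1) * mulCoeff (d * m) Y v 1 k =
      n * Y 1 * c (i + 1) := by
  have h0 := sum_classFinset_mulCoeff_one (v := v) (m := m) hY i (0 : ZMod (d * n))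
  simp only [add_zero] at h0
  rw [← h0, sum_mul]
  refine sum_congr rfl fun k hk => ?_
  by_cases heqn : IsEqn α (d * m) 1 k
  · rw [hv _ heqn, mul_zero, zero_mul]
  · rw [hh _ (isVar_add_one (hi k hk) heqn), map_add, map_add, residueClass_mul, add_zero, map_one,
      mem_classFinset.1 hk, mul_comm]

/-- Translation of the variables by class functions. -/
def classTranslation (α : ZMod (d * n) → ℤ) (l : ℕ) : (ZMod d → ℂ) →ₗ[ℂ] (levelVars α l → ℂ) where
  toFun c x := c (residueClass d n x.1.2)
  map_add' _ _ := rfl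
  map_smul' _ _ := rfl

theorem eqnMap_classTranslation (hα : GenData d n m α) (c : ZMod d → ℂ) :
    eqnMap hα l (classTranslation α l c) = 0 := by
  funext k
  rw [eqnMap_apply]
  simp only [classTranslation, LinearMap.coe_mk, AddHom.coe_mk, map_add, residueClass_mul, add_zero,
    sub_self, Pi.zero_apply]

variable (α) (m) (Y) in
/-- The conditions that are solved by translations of the variables of order `l`. -/
def shiftConditions (s : ℤ) (l : ℕ) (v : ℕ × ZMod (d * n) → ℂ) : ShiftIndex m α s l → ℂ
  | Sum.inl i => ∑ k ∈ classFinset n i.1, mulCoeff (d * m) Y v (l + 1) k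
  | Sum.inr _ => powCoeff v s l

theorem glue_of_lt (v : ℕ × ZMod (d * n) → ℂ) (w : levelVars α l → ℂ) {j : ℕ} (hj : j ≠ l)
    (k : ZMod (d * n)) : glue (levelVars α l) v w (j, k) = v (j, k) :=
  glue_of_notMem _ _ fun h => hj (mem_levelVars.1 h).1

theorem glue_isVar (v : ℕ × ZMod (d * n) → ℂ) (w : levelVars α l → ℂ) {k : ZMod (d * n)}
    (h : IsVar α l k) : glue (levelVars α l) v w (l, k) = w ⟨(l, k), mem_levelVars.2 ⟨rfl, h⟩⟩ :=
  glue_of_mem _ _ _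

/-- The equations of order `l`, in terms of the variables of order `l`. -/
theorem mulCoeff_glue (hα : GenData d n m α) (hY : Y 0 = 1) (hl : l ≠ 0)
    (hv : ∀ k, v (l, k) = 0) (w : levelVars α l → ℂ) (k : {k // IsEqn α (d * m) l k}) :
    mulCoeff (d * m) Y (glue (levelVars α l) v w) l k =
      eqnMap hα l w k + mulCoeff (d * m) Y v l k := by
  rw [← sub_eq_iff_eq_add, mulCoeff_sub hY hl (fun j hj k => glue_of_lt v w hj.ne k),
    glue_isVar _ _ (hα.isVar_of_isEqn k.2), glue_isVar _ _ (hα.isVar_add_of_isEqn k.2), hv, hv,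
    eqnMap_apply]
  ring

/-- This is where both kinds of conditions, the class sums of order `l + 1` and the equation of
order `l` for `t^s`, are seen to move linearly under translations by class functions, although they
are polynomial in the unknowns. -/
theorem shiftConditions_glue (hα : GenData d n m α) (hY : Y 0 = 1) (hl : l ≠ 0) {s : ℤ}
    (hs : α s ≤ s) (hv : ∀ k, v (l, k) = 0)
    (hv1 : ∀ j < l, ∀ k, IsEqn α (d * m) j k → mulCoeff (d * m) Y v j k = 0)
    {w : levelVars α l → ℂ} (hw : eqnMap hα l w = fun k => -mulCoeff (d * m) Y v l k.1)
    (c : ZMod d → ℂ) :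
    shiftConditions m α Y s l (glue (levelVars α l) v (w + classTranslation α l c)) =
      shiftConditions m α Y s l (glue (levelVars α l) v w) + shiftMap m α Y s l c := by
  -- The equations of order `1` are needed on both sides. For `l = 1` they are the equations being
  -- solved; for `l > 1` they are unaffected by the unknowns of order `l`.
  have key : ∀ w', eqnMap hα l w' = (fun k => -mulCoeff (d * m) Y v l k.1) →
      ∀ k, IsEqn α (d * m) 1 k → mulCoeff (d * m) Y (glue (levelVars α l) v w') 1 k = 0 := by
    intro w' hw' k hk
    rcases (show l = 1 ∨ 1 < l by omega) with rfl | h1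
    · have := mulCoeff_glue hα hY hl hv w' ⟨k, hk⟩
      rw [hw', neg_add_cancel] at this
      exact this
    · rw [mulCoeff_congr (fun j hj k => glue_of_lt v w' hj.ne k) h1]
      exact hv1 1 h1 k hk
  have hagree : ∀ j < l, ∀ k, glue (levelVars α l) v (w + classTranslation α l c) (j, k) =
      glue (levelVars α l) v w (j, k) := by
    intro j hj k
    rw [glue_of_lt _ _ hj.ne, glue_of_lt _ _ hj.ne]
  have hdiff : ∀ k, IsVar α l k → glue (levelVars α l) v (w + classTranslation α l c) (l, k) -
      glue (levelVars α l) v w (l, k) = c (residueClass d n k) := by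
    intro k hk
    rw [glue_isVar _ _ hk, glue_isVar _ _ hk, Pi.add_apply, add_sub_cancel_left]
    rfl
  funext x
  rcases x with i | i
  · rw [Pi.add_apply, shiftMap_inl, ← sub_eq_iff_eq_add']
    change ∑ k ∈ classFinset n i.1, _ - ∑ k ∈ classFinset n i.1, _ = _
    rw [sum_classFinset_mulCoeff_sub hY hl hagree,
      i.2.sum_mul_mulCoeff_one (h := fun k => glue (levelVars α l) v (w + classTranslation α l c)
        (l, k) - glue (levelVars α l) v w (l, k)) hdiff hY (key w hw),
      i.2.sum_mul_mulCoeff_one' (h := fun k => glue (levelVars α l) v (w + classTranslation α l c)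
        (l, k) - glue (levelVars α l) v w (l, k)) hdiff hY
        (key _ (by rw [map_add, eqnMap_classTranslation, add_zero, hw]))]
    ring
  · rw [Pi.add_apply, shiftMap_inr, ← sub_eq_iff_eq_add']
    change powCoeff _ _ _ - powCoeff _ _ _ = _
    rw [powCoeff_sub hl hagree, hdiff _ (i.2.isVar hs)]

open Classical in
-- Exhibits one more order as a fibration of the type handled by `IsAffineOfDim.extend`. The class
-- sums of order `L + 1` recorded in the base are the solvability conditions of the new linear
-- equations.
theorem levelSet_succ (hα : GenData d n m α) (hY : Y 0 = 1) {s : ℤ} (L : ℕ) :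
    levelSet m α Y s (L + 1) = {v | glue (levelVars α (L + 1)) v 0 ∈ levelSet m α Y s L ∧
      eqnMap hα (L + 1) (fun i => v i) =
        (fun k => -mulCoeff (d * m) Y (glue (levelVars α (L + 1)) v 0) (L + 1) k.1) ∧
      shiftConditions m α Y s (L + 1) v = 0} := by
  ext v
  set v₀ := glue (levelVars α (L + 1)) v 0 with hv₀
  have hagree : ∀ j < L + 1, ∀ k, v₀ (j, k) = v (j, k) := fun j hj k => glue_of_lt _ _ hj.ne k
  have hres : glue (levelVars α (L + 1)) v₀ (fun i => v i) = v := by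
    funext j
    by_cases h : j ∈ levelVars α (L + 1)
    · simp [glue_of_mem _ _ h]
    · simp [hv₀, glue_of_notMem _ _ h]
  have hglue : (∀ k, v₀ (L + 1, k) = 0) → ∀ k : {k // IsEqn α (d * m) (L + 1) k},
      mulCoeff (d * m) Y v (L + 1) k =
        eqnMap hα (L + 1) (fun i => v i) k + mulCoeff (d * m) Y v₀ (L + 1) k := by
    intro h k
    have := mulCoeff_glue hα hY (Nat.succ_ne_zero L) h (fun i => v i) k
    rwa [hres] at this
  have hzero : (∀ l k, ¬ (1 ≤ l ∧ l ≤ L + 1 ∧ IsVar α l k) → v (l, k) = 0) ↔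
      (∀ l k, ¬ (1 ≤ l ∧ l ≤ L ∧ IsVar α l k) → v₀ (l, k) = 0) := by
    constructor
    · intro h l k hlk
      by_cases hl : l = L + 1
      · subst hl
        by_cases hk : IsVar α (L + 1) k
        · exact glue_isVar _ _ hk
        · rw [hv₀, glue_of_notMem _ _ (by simp [hk])]
          exact h _ _ (by tauto)
      · rw [hv₀, glue_of_lt _ _ hl]
        exact h _ _ fun h' => hlk ⟨h'.1, by omega, h'.2.2⟩
    · intro h l k hlk
      by_cases hl : l = L + 1
      · subst hl
        have hk : ¬ IsVar α (L + 1) k := fun hk => hlk ⟨by omega, le_rfl, hk⟩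
        rw [← h (L + 1) k (by omega), hv₀, glue_of_notMem _ _ (by simp [hk])]
      · rw [← glue_of_lt (α := α) v 0 hl]
        exact h _ _ fun h' => hlk ⟨h'.1, by omega, h'.2.2⟩
  -- The class sums of order `L + 1` do not see the unknowns of order `L + 1`, so they are
  -- conditions on the base.
  have hsum : ∀ i, ∑ k ∈ classFinset n i, mulCoeff (d * m) Y v (L + 1) k =
      ∑ k ∈ classFinset n i, mulCoeff (d * m) Y v₀ (L + 1) k := by
    intro i
    rw [← sub_eq_zero, ← sum_sub_distrib,
      sum_congr rfl fun k _ => mulCoeff_sub hY (Nat.succ_ne_zero L) (fun j hj k => (hagree j hj k).symm) k,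
      sum_sub_distrib]
    have := sum_classFinset_add i ((d * m : ℕ) : ZMod (d * n))
      fun k => v (L + 1, k) - v₀ (L + 1, k)
    rw [residueClass_mul, add_zero] at this
    rw [this, sub_self]
  constructor
  · rintro ⟨h1, h2, h3, h4⟩
    have h1' := hzero.1 h1
    have hz : ∀ k, v₀ (L + 1, k) = 0 := fun k => h1' _ _ (by omega)
    refine ⟨⟨h1', ?_, ?_, ?_⟩, ?_, ?_⟩
    · intro l hl k hk
      rw [mulCoeff_congr hagree (by omega)]
      exact h2 l (by omega) k hk
    · intro l hl hk
      rw [powCoeff_congr hagree _ (by omega)]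
      exact h3 l (by omega) hk
    · intro i hi
      rw [← hsum]
      exact sum_eq_zero fun k hk => h2 _ le_rfl k (hi k hk)
    · funext k
      have := hglue hz k
      rw [h2 _ le_rfl k k.2] at this
      exact eq_neg_of_add_eq_zero_left this.symm
    · funext x
      rcases x with i | i
      · exact h4 i i.2
      · exact h3 _ le_rfl i.2
  · rintro ⟨⟨h1, h2, h3, h4⟩, h5, h6⟩
    have hz : ∀ k, v₀ (L + 1, k) = 0 := fun k => h1 _ _ (by omega)
    refine ⟨hzero.2 h1, ?_, ?_, ?_⟩
    · intro l hl k hk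
      by_cases hl' : l = L + 1
      · subst hl'
        have := hglue hz ⟨k, hk⟩
        rw [h5, neg_add_cancel] at this
        exact this
      · rw [← mulCoeff_congr hagree (by omega)]
        exact h2 l (by omega) k hk
    · intro l hl hk
      by_cases hl' : l = L + 1
      · subst hl'
        exact congrFun h6 (Sum.inr ⟨(), hk⟩)
      · rw [← powCoeff_congr hagree _ (by omega)]
        exact h3 l (by omega) hk
    · intro i hi
      exact congrFun h6 (Sum.inl ⟨i, hi⟩)

open Classical in
-- Induction on `L` with `IsAffineOfDim.extend`. In the passage to order `L + 1` the full classes of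
-- that order reduce the rank of the linear system, which enlarges its kernel by exactly the number
-- of conditions already imposed on the base. The directions spent on the full classes of order `L +
-- 2` are carried along in the count as its second term.
theorem isAffineOfDim_levelSet (hα : GenData d n m α) (hnm : Nat.Coprime n m) (hY : Y 0 = 1)
    (hY1 : Y 1 ≠ 0) {s : ℤ} (hs : α s ≤ s) (L : ℕ) :
    ∃ N, N + (univ.filter (IsFull α (d * m) (L + 1))).card +
        ∑ l ∈ Icc 1 L, ((univ.filter (IsEqn α (d * m) l)).card + if IsPin α s l then 1 else 0) =
        ∑ l ∈ Icc 1 L, (univ.filter (IsVar α l)).card ∧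
      IsAffineOfDim (levelSet m α Y s L) N := by
  induction L with
  | zero =>
    refine ⟨0, ?_, ?_⟩
    · rw [filter_false_of_mem fun i _ => hα.not_isFull_one i]
      simp
    · rw [levelSet_zero hα hs]
      exact IsAffineOfDim.singleton_zero
  | succ L ih =>
    obtain ⟨N, hN, hS⟩ := ih
    obtain ⟨σ, hσ⟩ := LinearMap.exists_rightInverse_of_surjective (shiftMap m α Y s (L + 1))
      (LinearMap.range_eq_top.2 (shiftMap_surjective hY1 s))
    obtain ⟨k, hk, hext⟩ := hS.extend (levelVars α (L + 1))
      (fun v hv i hi => by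
        obtain ⟨j, k⟩ := i
        rw [mem_levelVars] at hi
        exact hv.1 _ _ (by omega))
      (eqnMap hα (L + 1))
      (Q := fun v k => -mulCoeff (d * m) Y v (L + 1) k)
      (fun k => (isPolyFun_mulCoeff _ _ _ _).neg)
      (fun v hv => by
        rw [range_eqnMap hα hnm, LinearMap.mem_ker]
        funext i
        rw [fullSum_apply (d * m) (L + 1) (fun k => -mulCoeff (d * m) Y v (L + 1) k) i,
          sum_neg_distrib, hv.2.2.2 i i.2, neg_zero]
        rfl)
      (classTranslation α (L + 1) ∘ₗ σ)
      (fun u => eqnMap_classTranslation hα _)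
      (H := shiftConditions m α Y s (L + 1))
      (fun x => by
        rcases x with i | i
        · exact IsPolyFun.sum _ fun k _ => isPolyFun_mulCoeff _ _ _ _
        · exact isPolyFun_powCoeff _ _)
      (fun v hv w hw u => by
        have := shiftConditions_glue hα hY (Nat.succ_ne_zero L) hs (fun k => hv.1 _ _ (by omega))
          (fun j hj => hv.2.1 j (by omega)) hw (σ u)
        rw [LinearMap.comp_apply, this]
        congr 1
        exact congrArg (fun f => f u) hσ)
    refine ⟨N + k, ?_, ?_⟩
    · have h1 := finrank_ker_eqnMap hα hnm (L + 1)
      rw [← hk, Fintype.card_sum,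
        Fintype.card_of_subtype (univ.filter (IsFull α (d * m) (L + 1 + 1))) (by simp)] at h1
      have h2 : Fintype.card {_u : Unit // IsPin α s (L + 1)} =
          if IsPin α s (L + 1) then 1 else 0 := by
        split_ifs with h
        · simp [h]
        · simp [h]
      rw [h2] at h1
      rw [sum_Icc_succ_top (by omega), sum_Icc_succ_top (by omega)]
      omega
    · rw [levelSet_succ hα hY]
      exact hext

variable (α) (m) (Y) in
/-- The coefficients of the generators of modules with `ord = Δ` that contain `t^s`. -/
def solutionSet (s : ℤ) : Set (ℕ × ZMod (d * n) → ℂ) :=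
  {v | (∀ l k, ¬ (1 ≤ l ∧ IsVar α l k) → v (l, k) = 0) ∧
    (∀ l k, IsEqn α (d * m) l k → mulCoeff (d * m) Y v l k = 0) ∧
    (∀ l, IsPin α s l → powCoeff v s l = 0)}

open Classical in
-- Beyond the largest order of an unknown there are no equations, hence no full classes, and the
-- correction term in the count disappears.
theorem isAffineOfDim_solutionSet (hα : GenData d n m α) (hnm : Nat.Coprime n m) (hY : Y 0 = 1)
    (hY1 : Y 1 ≠ 0) {s : ℤ} (hs : α s ≤ s) {L : ℕ} (hL : ∀ l k, IsVar α l k → l ≤ L) :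
    ∃ N, N +
        ∑ l ∈ Icc 1 L, ((univ.filter (IsEqn α (d * m) l)).card + if IsPin α s l then 1 else 0) =
        ∑ l ∈ Icc 1 L, (univ.filter (IsVar α l)).card ∧
      IsAffineOfDim (solutionSet m α Y s) N := by
  obtain ⟨N, hN, hS⟩ := isAffineOfDim_levelSet hα hnm hY hY1 hs L
  have hfull : ∀ i, ¬ IsFull α (d * m) (L + 1) i := by
    intro i hi
    obtain ⟨k, hk⟩ := residueClass_surjective (d := d) (n := n) i
    have := hL _ _ (hα.isVar_of_isEqn (hi k (by simpa using hk)))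
    omega
  have heq : levelSet m α Y s L = solutionSet m α Y s := by
    ext v
    constructor
    · rintro ⟨h1, h2, h3, -⟩
      exact ⟨fun l k h => h1 l k fun h' => h ⟨h'.1, h'.2.2⟩,
        fun l k h => h2 l (hL _ _ (hα.isVar_of_isEqn h)) k h,
        fun l h => h3 l (hL _ _ (h.isVar hs)) h⟩
    · rintro ⟨h1, h2, h3⟩
      exact ⟨fun l k h => h1 l k fun h' => h ⟨h'.1, hL _ _ h'.2, h'.2⟩,
        fun l _ k h => h2 l k h, fun l _ h => h3 l h, fun i hi => absurd hi (hfull i)⟩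
  refine ⟨N, ?_, heq ▸ hS⟩
  rw [filter_false_of_mem fun i _ => hfull i] at hN
  simpa using hN

end Levels

end

end

section

open Finset

noncomputable section

/-! ## Free modules over `ℂ⟦t^q⟧` with a basis of pairwise incongruent orders -/

section GenSpan

open PowerSeries

variable {q : ℕ} [NeZero q]

/-- The module over `ℂ⟦t^q⟧` generated by a family of power series. -/
def genSpan (b : ZMod q → ℂ⟦X⟧) : Submodule ℂ ℂ⟦X⟧ :=
  LinearMap.range
    (∑ k, (LinearMap.mulRight ℂ (b k)) ∘ₗ (expand q (NeZero.ne q)).toLinearMap ∘ₗ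
      (LinearMap.proj k : (ZMod q → ℂ⟦X⟧) →ₗ[ℂ] ℂ⟦X⟧))

variable {b : ZMod q → ℂ⟦X⟧}

theorem mem_genSpan {z : ℂ⟦X⟧} :
    z ∈ genSpan b ↔ ∃ g : ZMod q → ℂ⟦X⟧, z = ∑ k, expand q (NeZero.ne q) (g k) * b k := by
  simp [genSpan, LinearMap.mem_range, eq_comm]

theorem expand_mul_mem_genSpan {z : ℂ⟦X⟧} (hz : z ∈ genSpan b) (h : ℂ⟦X⟧) :
    expand q (NeZero.ne q) h * z ∈ genSpan b := by
  obtain ⟨g, rfl⟩ := mem_genSpan.1 hz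
  refine mem_genSpan.2 ⟨fun k => h * g k, ?_⟩
  rw [mul_sum]
  exact sum_congr rfl fun k _ => by rw [map_mul, mul_assoc]

theorem gen_mem_genSpan (k : ZMod q) : b k ∈ genSpan b := by
  classical
  refine mem_genSpan.2 ⟨Pi.single k 1, ?_⟩
  rw [sum_eq_single k]
  · simp
  · intro l _ hl
    simp [Pi.single_eq_of_ne hl]
  · simp

theorem mul_mem_genSpan {y : ℂ⟦X⟧} (h : ∀ k, y * b k ∈ genSpan b) {z : ℂ⟦X⟧}
    (hz : z ∈ genSpan b) : y * z ∈ genSpan b := by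
  obtain ⟨g, rfl⟩ := mem_genSpan.1 hz
  rw [mul_sum]
  refine Submodule.sum_mem _ fun k _ => ?_
  rw [mul_left_comm]
  exact expand_mul_mem_genSpan (h k) _

theorem coeff_expand_mul_eq_sum (g b : ℂ⟦X⟧) (k : ℕ) :
    coeff k (expand q (NeZero.ne q) g * b) =
      ∑ s ∈ range (k + 1), coeff s g * coeff k (X ^ (q * s) * b) := by
  have hq := NeZero.pos q
  rw [coeff_mul, Nat.sum_antidiagonal_eq_sum_range_succ
    (fun i j => coeff i (expand q (NeZero.ne q) g) * coeff j b)]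
  symm
  refine sum_bij_ne_zero (fun s _ _ => q * s) ?_ ?_ ?_ ?_
  · intro s _ hs
    rw [coeff_X_pow_mul'] at hs
    by_contra h
    rw [mem_range, not_lt] at h
    rw [if_neg (by omega), mul_zero] at hs
    exact hs rfl
  · intro s _ _ s' _ _ h
    exact Nat.eq_of_mul_eq_mul_left hq h
  · intro i hi hne
    have hdvd : q ∣ i := by
      by_contra h
      rw [coeff_expand_of_not_dvd _ _ _ h, zero_mul] at hne
      exact hne rfl
    obtain ⟨s, rfl⟩ := hdvd
    rw [mem_range] at hi
    have hs : s ≤ q * s := Nat.le_mul_of_pos_left s hq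
    refine ⟨s, mem_range.2 (by omega), ?_, rfl⟩
    rw [coeff_X_pow_mul', if_pos (by omega)]
    rwa [coeff_expand_mul] at hne
  · intro s _ hs
    rw [coeff_expand_mul, coeff_X_pow_mul']
    rw [coeff_X_pow_mul'] at hs
    split_ifs at hs ⊢ with h
    · rfl
    · simp at hs

/-- Gaussian elimination, one exponent at a time. No convergence is needed, because the coefficient
identity involves only the first `k + 1` of the `E a`. The last clause records that high order is
preserved. -/
theorem exists_triangular_expansion (E : ℕ → ℂ⟦X⟧) (h1 : ∀ a, coeff a (E a) = 1) (h : ℂ⟦X⟧) :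
    ∃ c : ℕ → ℂ, (∀ k, coeff k h = ∑ a ∈ range (k + 1), c a * coeff k (E a)) ∧
      ∀ N, (∀ k < N, coeff k h = 0) → ∀ k < N, c k = 0 := by
  let c : ℕ → ℂ := fun k => Nat.strongRec (fun k r =>
    coeff k h - ∑ a : Fin k, r a a.2 * coeff k (E a)) k
  have hc : ∀ k, c k = coeff k h - ∑ a ∈ range k, c a * coeff k (E a) := by
    intro k
    rw [Finset.sum_range fun a => c a * coeff k (E a)]
    simp only [c]
    rw [Nat.strongRec]
  refine ⟨c, fun k => ?_, fun N hN k => ?_⟩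
  · rw [sum_range_succ, h1, hc k]
    ring
  · induction k using Nat.strong_induction_on with
    | _ k ih =>
      intro hk
      rw [hc, hN k hk, sum_eq_zero, sub_zero]
      intro a ha
      rw [mem_range] at ha
      rw [ih a ha (by omega), zero_mul]

variable {γ : ZMod q → ℕ} (hγ : ∀ k, ((γ k : ℕ) : ZMod q) = k) (hb : ∀ k, order (b k) = γ k)

omit [NeZero q] in
include hγ in
theorem exists_eq_gen_add {a : ℕ} (ha : γ a ≤ a) : ∃ s, a = γ a + q * s := by
  have : ((γ a : ℕ) : ZMod q) = (a : ℕ) := hγ _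
  rw [ZMod.natCast_eq_natCast_iff] at this
  obtain ⟨s, hs⟩ := (Nat.modEq_iff_dvd' ha).1 this
  exact ⟨s, by omega⟩

include hγ hb in
-- The nonzero summands have orders in distinct residue classes modulo `q`, so the one of least
-- order cannot be cancelled.
theorem order_of_mem_genSpan {z : ℂ⟦X⟧} (hz : z ∈ genSpan b) (hz0 : z ≠ 0) :
    ∃ a : ℕ, order z = a ∧ γ a ≤ a := by
  classical
  obtain ⟨g, rfl⟩ := mem_genSpan.1 hz
  have hne : (univ.filter fun k => g k ≠ 0).Nonempty := by
    by_contra h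
    rw [not_nonempty_iff_eq_empty, filter_eq_empty_iff] at h
    apply hz0
    refine sum_eq_zero fun k _ => ?_
    rw [not_not.1 (h (mem_univ k)), map_zero, zero_mul]
  let o : ZMod q → ℕ := fun k => γ k + q * (g k).order.toNat
  have ho : ∀ k, g k ≠ 0 → order (expand q (NeZero.ne q) (g k) * b k) = o k := by
    intro k hk
    rw [order_mul, order_expand, hb, ← coe_toNat_order hk]
    simp only [o, nsmul_eq_mul]
    push_cast
    rw [add_comm]
  have ho' : ∀ k, ((o k : ℕ) : ZMod q) = k := by
    intro k
    simp only [o]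
    push_cast
    rw [hγ, ZMod.natCast_self, zero_mul, add_zero]
  obtain ⟨k₀, hk₀, hmin⟩ := exists_min_image _ o hne
  rw [mem_filter] at hk₀
  refine ⟨o k₀, ?_, ?_⟩
  · rw [order_eq_nat]
    constructor
    · rw [map_sum, sum_eq_single k₀]
      · exact (order_eq_nat.1 (ho k₀ hk₀.2)).1
      · intro k _ hk
        by_cases hgk : g k = 0
        · rw [hgk, map_zero, zero_mul, map_zero]
        · refine (order_eq_nat.1 (ho k hgk)).2 _ (lt_of_le_of_ne
            (hmin k (mem_filter.2 ⟨mem_univ _, hgk⟩)) fun h => hk ?_)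
          rw [← ho' k, ← h, ho' k₀]
      · simp
    · intro i hi
      rw [map_sum]
      refine sum_eq_zero fun k _ => ?_
      by_cases hgk : g k = 0
      · rw [hgk, map_zero, zero_mul, map_zero]
      · exact (order_eq_nat.1 (ho k hgk)).2 _
          (lt_of_lt_of_le hi (hmin k (mem_filter.2 ⟨mem_univ _, hgk⟩)))
  · rw [ho']
    exact Nat.le_add_right _ _

include hγ hb in
/-- A module over `ℂ⟦t^q⟧` whose orders include all large integers contains all power series of
large order. -/
theorem mem_genSpan_of_order {c : ℕ} (hc : ∀ a : ℕ, c ≤ a → γ a ≤ a) {h : ℂ⟦X⟧}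
    (hh : ∀ j < c, coeff j h = 0) : h ∈ genSpan b := by
  classical
  have hq := NeZero.pos q
  have hlead : ∀ k, coeff (γ k) (b k) ≠ 0 := fun k => (order_eq_nat.1 (hb k)).1
  -- One series with leading term `t^a` for each `a`: a normalized multiple of a generator when
  -- possible. The filler `t^a` occurs only for `a < c`, where its coefficient in the expansion of
  -- `h` is zero.
  let E : ℕ → ℂ⟦X⟧ := fun a => if γ a ≤ a then
    (coeff (γ a) (b a))⁻¹ • (X ^ (q * ((a - γ a) / q)) * b a) else X ^ a
  have hE : ∀ a, coeff a (E a) = 1 := by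
    intro a
    by_cases ha : γ a ≤ a
    · obtain ⟨s, hs⟩ := exists_eq_gen_add hγ ha
      simp only [E, if_pos ha]
      have h1 : (a - γ a) / q = s := by
        rw [show a - γ a = q * s by omega, Nat.mul_div_cancel_left _ hq]
      rw [h1, coeff_smul, smul_eq_mul, coeff_X_pow_mul', if_pos (by omega), show a - q * s = γ a by omega,
        inv_mul_cancel₀ (hlead _)]
    · simp [E, if_neg ha]
  obtain ⟨e, he, he0⟩ := exists_triangular_expansion E hE h
  let g : ZMod q → ℂ⟦X⟧ := fun k => mk fun s =>
    e (γ k + q * s) * (coeff (γ k) (b k))⁻¹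
  refine mem_genSpan.2 ⟨g, ?_⟩
  ext j
  rw [map_sum, he]
  simp only [coeff_expand_mul_eq_sum]
  rw [← sum_product']
  symm
  have hcast : ∀ (k : ZMod q) (s : ℕ), ((γ k + q * s : ℕ) : ZMod q) = k := by
    intro k s
    push_cast
    rw [hγ, ZMod.natCast_self, zero_mul, add_zero]
  refine sum_bij_ne_zero (fun x _ _ => γ x.1 + q * x.2) ?_ ?_ ?_ ?_
  · rintro ⟨k, s⟩ - hne
    rw [mem_range]
    by_contra hlt
    apply hne
    simp only at hlt ⊢
    rw [(order_eq_nat (n := γ k + q * s).1 ?_).2 j (by omega), mul_zero]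
    rw [order_mul, order_X_pow, hb]
    push_cast
    ring
  · rintro ⟨k, s⟩ - - ⟨k', s'⟩ - - heq
    simp only at heq
    have h1 : k = k' := by rw [← hcast k s, heq, hcast]
    subst h1
    have h2 : s = s' := Nat.eq_of_mul_eq_mul_left hq (by omega)
    rw [h2]
  · intro a ha hne
    have hca : c ≤ a := by
      by_contra hlt
      exact hne (by rw [he0 c hh a (by omega), zero_mul])
    obtain ⟨s, hs⟩ := exists_eq_gen_add hγ (hc a hca)
    have hle : s ≤ q * s := Nat.le_mul_of_pos_left s hq
    have ha' := mem_range.1 ha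
    refine ⟨((a : ZMod q), s), by simp only [mem_product, mem_univ, mem_range, true_and]; omega,
      ?_, hs.symm⟩
    simp only [g, coeff_mk]
    rw [← hs]
    have h1 : (a - γ a) / q = s := by
      rw [show a - γ a = q * s by omega, Nat.mul_div_cancel_left _ hq]
    simp only [E, if_pos (hc a hca), h1, coeff_smul, smul_eq_mul] at hne
    rwa [mul_assoc]
  · rintro ⟨k, s⟩ - -
    have h1 : γ k ≤ γ k + q * s := Nat.le_add_right _ _
    have h2 : γ ((γ k + q * s : ℕ) : ZMod q) = γ k := by rw [hcast]
    have h3 : (γ k + q * s - γ k) / q = s := by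
      rw [Nat.add_sub_cancel_left, Nat.mul_div_cancel_left _ hq]
    simp only [g, E, coeff_mk, hcast, if_pos h1, h3, coeff_smul, smul_eq_mul]
    ring

end GenSpan

end

end

section

open Finset

noncomputable section

/-! ## The semigroup of a generic branch -/

section Semigroup

variable {d n m : ℕ}

/-- The order `j d m + i (d m n + 1)` of the element `y^j (y^n - x^m)^i`. -/
def genOrder (d n m i j : ℕ) : ℕ := j * (d * m) + i * (d * m * n + 1)

/-- Modulo `d` the order is `i`. After cancelling the terms in `i` and a factor `d`, the order
modulo `n` is `j m`, which determines `j` by coprimality. -/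
theorem genOrder_injective (hnm : Nat.Coprime n m) {i j i' j' : ℕ} (hi : i < d) (hi' : i' < d)
    (hj : j < n) (hj' : j' < n)
    (h : ((genOrder d n m i j : ℕ) : ZMod (d * n)) = (genOrder d n m i' j' : ℕ)) :
    i = i' ∧ j = j' := by
  rw [ZMod.natCast_eq_natCast_iff] at h
  have h1 : i ≡ i' [MOD d] := by
    have h2 := h.of_mul_right n
    have h3 : ∀ a b, genOrder d n m a b ≡ a [MOD d] := by
      intro a b
      rw [genOrder, show b * (d * m) + a * (d * m * n + 1) = a + d * (b * m + a * m * n) by ring]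
      simp [Nat.ModEq]
    exact (h3 i j).symm.trans (h2.trans (h3 i' j'))
  have hii : i = i' := Nat.ModEq.eq_of_lt_of_lt h1 hi hi'
  subst hii
  refine ⟨rfl, ?_⟩
  have h4 : j * (d * m) ≡ j' * (d * m) [MOD (d * n)] := Nat.ModEq.add_right_cancel' _ h
  rw [show j * (d * m) = d * (j * m) by ring, show j' * (d * m) = d * (j' * m) by ring] at h4
  have h5 : j * m ≡ j' * m [MOD n] := Nat.ModEq.mul_left_cancel' (by omega) h4
  exact Nat.ModEq.eq_of_lt_of_lt (Nat.ModEq.cancel_right_of_coprime hnm h5) hj hj'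

variable [NeZero d] [NeZero n]

/-- The residues modulo `d n` of the elements `j d m + i (d m n + 1)`. -/
def genEquiv (d n m : ℕ) [NeZero d] [NeZero n] (hnm : Nat.Coprime n m) :
    Fin d × Fin n ≃ ZMod (d * n) :=
  Equiv.ofBijective (fun x => ((genOrder d n m x.1 x.2 : ℕ) : ZMod (d * n))) <| by
    rw [Fintype.bijective_iff_injective_and_card]
    refine ⟨fun x x' h => ?_, by simp [ZMod.card]⟩
    obtain ⟨h1, h2⟩ := genOrder_injective hnm x.1.2 x'.1.2 x.2.2 x'.2.2 h
    exact Prod.ext (Fin.ext h1) (Fin.ext h2)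

theorem genEquiv_apply (hnm : Nat.Coprime n m) (x : Fin d × Fin n) :
    genEquiv d n m hnm x = (genOrder d n m x.1 x.2 : ℕ) := rfl

/-- The least element of the semigroup `Γ` in a given residue class modulo `d n`. -/
def semigroupGen (d n m : ℕ) [NeZero d] [NeZero n] (hnm : Nat.Coprime n m) (k : ZMod (d * n)) : ℕ :=
  genOrder d n m ((genEquiv d n m hnm).symm k).1 ((genEquiv d n m hnm).symm k).2

variable (hnm : Nat.Coprime n m)

theorem semigroupGen_genEquiv (x : Fin d × Fin n) :
    semigroupGen d n m hnm (genEquiv d n m hnm x) = genOrder d n m x.1 x.2 := by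
  simp [semigroupGen]

theorem semigroupGen_genOrder {i j : ℕ} (hi : i < d) (hj : j < n) :
    semigroupGen d n m hnm (genOrder d n m i j : ℕ) = genOrder d n m i j :=
  semigroupGen_genEquiv hnm (⟨i, hi⟩, ⟨j, hj⟩)

theorem natCast_semigroupGen (k : ZMod (d * n)) : ((semigroupGen d n m hnm k : ℕ) : ZMod (d * n)) = k :=
  (genEquiv d n m hnm).apply_symm_apply k

/-- The largest generator. -/
def topGen (d n m : ℕ) : ℕ := genOrder d n m (d - 1) (n - 1)

theorem genOrder_add_genOrder {i j : ℕ} (hi : i < d) (hj : j < n) :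
    genOrder d n m i j + genOrder d n m (d - 1 - i) (n - 1 - j) = topGen d n m := by
  obtain ⟨i', rfl⟩ := Nat.exists_eq_add_of_lt hi
  obtain ⟨j', rfl⟩ := Nat.exists_eq_add_of_lt hj
  rw [topGen, show i + i' + 1 - 1 - i = i' by omega, show j + j' + 1 - 1 - j = j' by omega,
    show i + i' + 1 - 1 = i + i' by omega, show j + j' + 1 - 1 = j + j' by omega]
  simp only [genOrder]
  ring

theorem semigroupGen_add_semigroupGen (k : ZMod (d * n)) :
    semigroupGen d n m hnm k + semigroupGen d n m hnm ((topGen d n m : ℕ) - k) = topGen d n m := by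
  obtain ⟨⟨i, j⟩, rfl⟩ := (genEquiv d n m hnm).surjective k
  have h := genOrder_add_genOrder (m := m) i.2 j.2
  rw [semigroupGen_genEquiv]
  have h2 : ((topGen d n m : ℕ) : ZMod (d * n)) - genEquiv d n m hnm (i, j) =
      (genOrder d n m (d - 1 - i) (n - 1 - j) : ℕ) := by
    rw [genEquiv_apply, ← h]
    push_cast
    ring
  rw [h2, semigroupGen_genOrder hnm (by omega) (by omega), h]

omit [NeZero n] in
theorem lt_topGen (hn : 1 < n) (hm : n < m) : d * n < topGen d n m := by
  have hd : 0 < d := NeZero.pos d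
  have h1 : d * m ≤ (n - 1) * (d * m) := Nat.le_mul_of_pos_left _ (by omega)
  have h2 : d * n < d * m := Nat.mul_lt_mul_of_pos_left hm hd
  rw [topGen, genOrder]
  omega

/-- A residue class representative not below its generator is at least `d n` below it. -/
theorem add_le_of_lt_gen {q : ℕ} {α : ZMod q → ℤ} (hα : ∀ k, ((α k : ℤ) : ZMod q) = k) {a : ℤ}
    (h : a < α a) : a + q ≤ α a := by
  have h1 : ((α a - a : ℤ) : ZMod q) = 0 := by
    push_cast
    rw [hα, sub_self]
  rw [ZMod.intCast_zmod_eq_zero_iff_dvd] at h1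
  have := Int.le_of_dvd (by omega) h1
  omega

/-- Symmetry of the semigroup, with largest gap `topGen - dn`: the generators of the residues of `a`
and `b` add up to `topGen`, and a number below its generator is at least `dn` below. -/
theorem semigroupGen_symm {a b : ℤ} (hab : a + b + d * n = topGen d n m) :
    (semigroupGen d n m hnm a : ℤ) ≤ a ↔ b < semigroupGen d n m hnm b := by
  have h := semigroupGen_add_semigroupGen hnm (a : ZMod (d * n))
  have h2 : (topGen d n m : ℕ) - (a : ZMod (d * n)) = (b : ZMod (d * n)) := by
    have h3 := congrArg (Int.cast : ℤ → ZMod (d * n)) hab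
    push_cast at h3
    have h4 : ((d : ZMod (d * n)) * (n : ZMod (d * n))) = 0 := by
      exact_mod_cast ZMod.natCast_self (d * n)
    rw [h4, add_zero] at h3
    rw [← h3]
    ring
  rw [h2] at h
  have hγ : ∀ k : ZMod (d * n), (((semigroupGen d n m hnm k : ℕ) : ℤ) : ZMod (d * n)) = k := by
    intro k
    rw [Int.cast_natCast, natCast_semigroupGen]
  have h5 := add_le_of_lt_gen (α := fun k => (semigroupGen d n m hnm k : ℤ)) hγ (a := b)
  push_cast at h5
  constructor
  · intro h6
    have : (0 : ℤ) < d * n := by exact_mod_cast NeZero.pos (d * n)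
    omega
  · intro h6
    have := h5 h6
    omega

theorem semigroupGen_le_of_conductor_le {a : ℤ} (h : (topGen d n m : ℤ) < a + d * n) :
    (semigroupGen d n m hnm a : ℤ) ≤ a := by
  rw [semigroupGen_symm hnm (b := topGen d n m - d * n - a) (by ring)]
  have : (0 : ℤ) ≤ semigroupGen d n m hnm ((topGen d n m - d * n - a : ℤ) : ZMod (d * n)) := by
    positivity
  omega

theorem semigroupGen_zero : semigroupGen d n m hnm 0 = 0 := by
  have := semigroupGen_genOrder (d := d) hnm (NeZero.pos d) (NeZero.pos n)
  simpa [genOrder] using this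

end Semigroup

/-! ## The local ring of a generic branch -/

namespace GenericBranch

variable {d n m : ℕ} (C : GenericBranch d n m)

open PowerSeries

theorem order_y : order C.y = (d * m : ℕ) := by
  rw [order_eq_nat]
  exact ⟨by rw [C.coeff_dm]; exact one_ne_zero, C.coeff_of_lt⟩

/-- `y^n - x^m`. -/
def curveElt : ℂ⟦X⟧ := C.y ^ n - X ^ (d * m * n)

/-- Write `y = t^{dm} u` with `u = 1 + λ t + …`. Then `y^n - x^m = t^{dmn} (u^n - 1)`, and `u^n - 1`
starts with `n λ t`. Genericity of the branch enters the structure of `R` only here. -/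
theorem order_curveElt : order C.curveElt = (d * m * n + 1 : ℕ) := by
  obtain ⟨u, hu⟩ := X_pow_dvd_iff.2 C.coeff_of_lt
  have hu0 : constantCoeff u = 1 := by
    have := C.coeff_dm
    rw [hu, coeff_X_pow_mul', if_pos le_rfl, Nat.sub_self] at this
    simpa using this
  have hu1 : coeff 1 u ≠ 0 := by
    have := C.coeff_succ_ne_zero
    rwa [hu, coeff_X_pow_mul', if_pos (by omega), Nat.add_sub_cancel_left] at this
  have hC : C.curveElt = X ^ (d * m * n) * (u ^ n - 1) := by
    rw [curveElt, hu, mul_pow, ← pow_mul]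
    ring
  have h1 : order (u ^ n - 1) = (1 : ℕ) := by
    rw [order_eq_nat]
    constructor
    · rw [map_sub, coeff_one_pow, hu0, one_pow, mul_one, coeff_one, if_neg one_ne_zero, sub_zero]
      have := C.one_lt_n
      exact mul_ne_zero (by exact_mod_cast (by omega : n ≠ 0)) hu1
    · intro i hi
      obtain rfl : i = 0 := by omega
      simp [hu0]
  rw [hC, order_mul, order_X_pow, h1]
  push_cast
  ring

variable [NeZero d] [NeZero n]

/-- The basis `y^j (y^n - x^m)^i` of `R` over `ℂ⟦x⟧`. -/
def basisElt (k : ZMod (d * n)) : ℂ⟦X⟧ :=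
  C.y ^ (((genEquiv d n m C.coprime).symm k).2 : ℕ) *
    C.curveElt ^ (((genEquiv d n m C.coprime).symm k).1 : ℕ)

/-- The generators of `Γ` over `d n`. -/
def gen (k : ZMod (d * n)) : ℕ := semigroupGen d n m C.coprime k

theorem natCast_gen (k : ZMod (d * n)) : ((C.gen k : ℕ) : ZMod (d * n)) = k :=
  natCast_semigroupGen _ k

theorem order_basisElt (k : ZMod (d * n)) : order (C.basisElt k) = C.gen k := by
  rw [basisElt, order_mul, order_pow, order_pow, order_y, order_curveElt, gen, semigroupGen,
    genOrder]
  push_cast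
  simp only [nsmul_eq_mul]

theorem basisElt_genOrder {i j : ℕ} (hi : i < d) (hj : j < n) :
    C.basisElt (genOrder d n m i j : ℕ) = C.y ^ j * C.curveElt ^ i := by
  have : ((genOrder d n m i j : ℕ) : ZMod (d * n)) =
    genEquiv d n m C.coprime (⟨i, hi⟩, ⟨j, hj⟩) := rfl
  rw [basisElt, this, Equiv.symm_apply_apply]

theorem mem_genSpan_of_topGen_le {z : ℂ⟦X⟧}
    (hz : ∀ j, j + d * n ≤ topGen d n m → coeff j z = 0) : z ∈ genSpan C.basisElt := by
  have hlt := lt_topGen (d := d) C.one_lt_n C.n_lt_m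
  refine mem_genSpan_of_order (c := topGen d n m + 1 - d * n) C.natCast_gen C.order_basisElt
    (fun a ha => ?_) fun j hj => hz j (by omega)
  have := semigroupGen_le_of_conductor_le (d := d) C.coprime (a := (a : ℕ))
      (by exact_mod_cast (by omega : topGen d n m < a + d * n))
  exact_mod_cast this

/-- The only relation to check is at `j = n - 1`, where `y^n = (y^n - x^m) + x^m` raises `i` by one.
If this gives `i = d`, then `(y^n - x^m)^d` has order beyond the largest gap and lies in the span
automatically. -/
theorem y_mul_mem_genSpan {z : ℂ⟦X⟧} (hz : z ∈ genSpan C.basisElt) :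
    C.y * z ∈ genSpan C.basisElt := by
  refine mul_mem_genSpan (fun k => ?_) hz
  obtain ⟨⟨i, j⟩, rfl⟩ := (genEquiv d n m C.coprime).surjective k
  rw [genEquiv_apply, C.basisElt_genOrder i.2 j.2, ← mul_assoc, ← pow_succ']
  by_cases hj : (j : ℕ) + 1 < n
  · rw [← C.basisElt_genOrder i.2 hj]
    exact gen_mem_genSpan _
  · have hjn : (j : ℕ) + 1 = n := by omega
    have h1 : C.y ^ ((j : ℕ) + 1) * C.curveElt ^ (i : ℕ) =
        C.curveElt ^ ((i : ℕ) + 1) + X ^ (d * m * n) * C.curveElt ^ (i : ℕ) := by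
      rw [hjn, pow_succ, curveElt]
      ring
    rw [h1]
    refine Submodule.add_mem _ ?_ ?_
    · by_cases hi : (i : ℕ) + 1 < d
      · have := gen_mem_genSpan (b := C.basisElt) (genOrder d n m ((i : ℕ) + 1) 0 : ℕ)
        rwa [C.basisElt_genOrder hi (NeZero.pos n), pow_zero, one_mul] at this
      · refine C.mem_genSpan_of_topGen_le fun k hk => ?_
        have hid : (i : ℕ) + 1 = d := by omega
        have ho : order (C.curveElt ^ ((i : ℕ) + 1)) = (d * (d * m * n + 1) : ℕ) := by
          rw [order_pow, order_curveElt, hid]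
          push_cast
          simp only [nsmul_eq_mul]
        refine (order_eq_nat.1 ho).2 k ?_
        rw [topGen, genOrder] at hk
        obtain ⟨d', rfl⟩ := Nat.exists_eq_succ_of_ne_zero (NeZero.ne d)
        obtain ⟨n', rfl⟩ := Nat.exists_eq_succ_of_ne_zero (NeZero.ne n)
        simp only [Nat.succ_eq_add_one, Nat.add_sub_cancel] at hk ⊢
        nlinarith
    · have h2 : (X : ℂ⟦X⟧) ^ (d * m * n) = expand (d * n) (NeZero.ne _) (X ^ m) := by
        rw [map_pow, expand_X, ← pow_mul]
        ring_nf
      have := gen_mem_genSpan (b := C.basisElt) (genOrder d n m (i : ℕ) 0 : ℕ)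
      rw [C.basisElt_genOrder i.2 (NeZero.pos n), pow_zero, one_mul] at this
      rw [h2]
      exact expand_mul_mem_genSpan this _

theorem one_mem_genSpan : (1 : ℂ⟦X⟧) ∈ genSpan C.basisElt := by
  have := gen_mem_genSpan (b := C.basisElt) (genOrder d n m 0 0 : ℕ)
  rwa [C.basisElt_genOrder (NeZero.pos d) (NeZero.pos n), pow_zero, one_mul, pow_zero] at this

theorem aeval_mem_genSpan (p : MvPolynomial (Fin 2) ℂ) :
    MvPolynomial.aeval C.param p ∈ genSpan C.basisElt := by
  induction p using MvPolynomial.induction_on with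
  | C a =>
    rw [MvPolynomial.aeval_C, Algebra.algebraMap_eq_smul_one]
    exact Submodule.smul_mem _ _ C.one_mem_genSpan
  | add p q hp hq =>
    rw [map_add]
    exact Submodule.add_mem _ hp hq
  | mul_X p i hp =>
    have hcomm : MvPolynomial.aeval C.param (p * MvPolynomial.X i) =
        C.param i * MvPolynomial.aeval C.param p := by
      rw [map_mul, MvPolynomial.aeval_X]
      ring
    rw [hcomm]
    fin_cases i
    · change X ^ (d * n) * _ ∈ _
      rw [← expand_X (d * n) (NeZero.ne _)]
      exact expand_mul_mem_genSpan hp _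
    · exact C.y_mul_mem_genSpan hp

theorem coeff_subst_eq_zero {F : MvPowerSeries (Fin 2) ℂ} {N j : ℕ} (hF : (N : ℕ∞) ≤ F.order)
    (hj : j < N) : coeff j (MvPowerSeries.subst C.param F : ℂ⟦X⟧) = 0 := by
  have h1 := MvPowerSeries.le_order_subst C.hasSubst_param F
  have h2 : (1 : ℕ∞) ≤ ⨅ i, MvPowerSeries.order (C.param i) := by
    refine le_iInf fun i => ?_
    have h3 : ∀ z : ℂ⟦X⟧, constantCoeff z = 0 → (1 : ℕ∞) ≤ MvPowerSeries.order z := by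
      intro z hz
      rw [MvPowerSeries.one_le_order_iff_constCoeff_eq_zero]
      exact hz
    refine h3 (C.param i) ?_
    rw [← coeff_zero_eq_constantCoeff_apply]
    have hn := C.one_lt_n
    have hm := C.n_lt_m
    fin_cases i
    · change coeff 0 ((X : ℂ⟦X⟧) ^ (d * n)) = 0
      rw [coeff_X_pow, if_neg (NeZero.ne (d * n)).symm]
    · exact C.coeff_of_lt 0 (Nat.mul_pos C.d_pos (by omega))
  have h4 : (N : ℕ∞) ≤ order (MvPowerSeries.subst C.param F : ℂ⟦X⟧) := by
    rw [order_eq_order]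
    refine le_trans (le_trans hF ?_) h1
    calc F.order = 1 * F.order := (one_mul _).symm
      _ ≤ _ := by gcongr
  exact coeff_of_lt_order _ (lt_of_lt_of_le (by exact_mod_cast hj) h4)

/-- A truncation of `F` is a polynomial in `x` and `y`, handled by induction. The tail is
substituted to a series of order beyond the largest gap, so no completeness argument is required. -/
theorem subst_mem_genSpan (F : MvPowerSeries (Fin 2) ℂ) :
    (MvPowerSeries.subst C.param F : ℂ⟦X⟧) ∈ genSpan C.basisElt := by
  set N := topGen d n m + 1
  have h1 : F = (F.truncTotal N : MvPolynomial (Fin 2) ℂ) +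
      (F - (F.truncTotal N : MvPolynomial (Fin 2) ℂ)) := by ring
  rw [h1, MvPowerSeries.subst_add C.hasSubst_param, MvPowerSeries.subst_coe]
  refine Submodule.add_mem _ (C.aeval_mem_genSpan _) (C.mem_genSpan_of_topGen_le fun j hj => ?_)
  refine C.coeff_subst_eq_zero (N := N) (MvPowerSeries.le_order fun e he => ?_) (by omega)
  rw [map_sub, MvPolynomial.coeff_coe, MvPowerSeries.coeff_truncTotal _ (by exact_mod_cast he),
    sub_self]

omit [NeZero d] [NeZero n] in
theorem mem_localRing {z : ℂ⟦X⟧} :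
    z ∈ C.localRing ↔ ∃ F : MvPowerSeries (Fin 2) ℂ, MvPowerSeries.subst C.param F = z := by
  rw [localRing, AlgHom.mem_range, MvPowerSeries.coe_substAlgHom]

omit [NeZero d] [NeZero n] in
theorem y_mem_localRing : C.y ∈ C.localRing :=
  C.mem_localRing.2 ⟨MvPowerSeries.X 1, by
    rw [MvPowerSeries.subst_X C.hasSubst_param]; rfl⟩

theorem expand_mem_localRing (g : ℂ⟦X⟧) : expand (d * n) (NeZero.ne _) g ∈ C.localRing := by
  refine C.mem_localRing.2 ⟨PowerSeries.subst (MvPowerSeries.X 0 : MvPowerSeries (Fin 2) ℂ) g, ?_⟩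
  have h0 : PowerSeries.HasSubst (MvPowerSeries.X 0 : MvPowerSeries (Fin 2) ℂ) :=
    PowerSeries.HasSubst.X 0
  rw [expand_apply, PowerSeries.subst, MvPowerSeries.subst_comp_subst_apply h0.const
    C.hasSubst_param]
  simp only [MvPowerSeries.subst_X C.hasSubst_param]
  rfl

theorem mem_localRing_iff {z : ℂ⟦X⟧} : z ∈ C.localRing ↔ z ∈ genSpan C.basisElt := by
  constructor
  · rw [mem_localRing]
    rintro ⟨F, rfl⟩
    exact C.subst_mem_genSpan F
  · rw [mem_genSpan]
    rintro ⟨g, rfl⟩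
    refine Subalgebra.sum_mem _ fun k _ => Subalgebra.mul_mem _ (C.expand_mem_localRing _) ?_
    refine Subalgebra.mul_mem _ (Subalgebra.pow_mem _ C.y_mem_localRing _)
      (Subalgebra.pow_mem _ (Subalgebra.sub_mem _ (Subalgebra.pow_mem _ C.y_mem_localRing _) ?_) _)
    have h2 : (X : ℂ⟦X⟧) ^ (d * m * n) = expand (d * n) (NeZero.ne _) (X ^ m) := by
      rw [map_pow, expand_X, ← pow_mul]
      ring_nf
    rw [h2]
    exact C.expand_mem_localRing _

theorem basisElt_mem_localRing (k : ZMod (d * n)) : C.basisElt k ∈ C.localRing :=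
  C.mem_localRing_iff.2 (gen_mem_genSpan k)

/-- Membership in a subspace stable under `ℂ⟦x⟧` and `y`. -/
theorem mul_mem_of_stable {M : Submodule ℂ ℂ⟦X⟧}
    (hx : ∀ (g w : ℂ⟦X⟧), w ∈ M → expand (d * n) (NeZero.ne _) g * w ∈ M)
    (hy : ∀ w ∈ M, C.y * w ∈ M) {r w : ℂ⟦X⟧} (hr : r ∈ C.localRing) (hw : w ∈ M) : r * w ∈ M := by
  have hyp : ∀ (j : ℕ), ∀ w ∈ M, C.y ^ j * w ∈ M := by
    intro j
    induction j with
    | zero => intro w hw; simpa using hw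
    | succ j ih => intro w hw; rw [pow_succ, mul_assoc]; exact ih _ (hy w hw)
  have hf : ∀ w ∈ M, C.curveElt * w ∈ M := by
    intro w hw
    have h2 : (X : ℂ⟦X⟧) ^ (d * m * n) = expand (d * n) (NeZero.ne _) (X ^ m) := by
      rw [map_pow, expand_X, ← pow_mul]
      ring_nf
    rw [curveElt, sub_mul, h2]
    exact Submodule.sub_mem _ (hyp _ _ hw) (hx _ _ hw)
  have hfp : ∀ (j : ℕ), ∀ w ∈ M, C.curveElt ^ j * w ∈ M := by
    intro j
    induction j with
    | zero => intro w hw; simpa using hw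
    | succ j ih => intro w hw; rw [pow_succ, mul_assoc]; exact ih _ (hf w hw)
  obtain ⟨g, rfl⟩ := mem_genSpan.1 (C.mem_localRing_iff.1 hr)
  rw [sum_mul]
  refine Submodule.sum_mem _ fun k _ => ?_
  rw [mul_assoc, basisElt, mul_assoc]
  exact hx _ _ (hyp _ _ (hfp _ _ hw))

theorem exists_mem_localRing_order {a : ℕ} (ha : C.gen a ≤ a) :
    ∃ r ∈ C.localRing, order r = a := by
  obtain ⟨s, hs⟩ := exists_eq_gen_add C.natCast_gen ha
  refine ⟨expand (d * n) (NeZero.ne _) (X ^ s) * C.basisElt a,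
    Subalgebra.mul_mem _ (C.expand_mem_localRing _) (C.basisElt_mem_localRing _), ?_⟩
  rw [order_mul, order_expand, order_X_pow, C.order_basisElt]
  conv_rhs => rw [hs]
  push_cast
  simp only [nsmul_eq_mul]
  push_cast
  ring

theorem order_of_mem_localRing {r : ℂ⟦X⟧} (hr : r ∈ C.localRing) (hr0 : r ≠ 0) :
    ∃ a : ℕ, order r = a ∧ C.gen a ≤ a :=
  order_of_mem_genSpan C.natCast_gen C.order_basisElt (C.mem_localRing_iff.1 hr) hr0

end GenericBranch

/-! ### Orders of power series regarded as Laurent series, and the semigroup of the branch -/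

section Laurent

open PowerSeries

theorem coeff_ofPowerSeries_of_neg (z : ℂ⟦X⟧) {a : ℤ} (ha : a < 0) :
    (HahnSeries.ofPowerSeries ℤ ℂ z).coeff a = 0 := by
  rw [HahnSeries.ofPowerSeries_apply]
  refine HahnSeries.embDomain_of_notMem_range ?_
  rintro ⟨b, hb⟩
  simp at hb
  omega

theorem order_ofPowerSeries {z : ℂ⟦X⟧} {a : ℕ} (h : order z = a) :
    HahnSeries.order (HahnSeries.ofPowerSeries ℤ ℂ z) = a := by
  have h1 := order_eq_nat.1 h
  refine le_antisymm (HahnSeries.order_le_of_coeff_ne_zero ?_) ?_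
  · rw [HahnSeries.ofPowerSeries_apply_coeff]
    exact h1.1
  · by_contra! hlt
    have hz : (HahnSeries.ofPowerSeries ℤ ℂ z) ≠ 0 := by
      intro h0
      have h2 := HahnSeries.ofPowerSeries_apply_coeff (Γ := ℤ) z a
      rw [h0] at h2
      exact h1.1 (by simpa using h2.symm)
    have h3 := HahnSeries.coeff_order_eq_zero.not.2 hz
    rcases lt_or_ge (HahnSeries.order (HahnSeries.ofPowerSeries ℤ ℂ z)) 0 with h4 | h4
    · exact h3 (coeff_ofPowerSeries_of_neg z h4)
    · obtain ⟨b, hb⟩ := Int.eq_ofNat_of_zero_le h4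
      rw [hb] at h3 hlt
      have h5 := HahnSeries.ofPowerSeries_apply_coeff (Γ := ℤ) z b
      exact h3 (h5.trans (h1.2 b (by omega)))

end Laurent

namespace GenericBranch

variable {d n m : ℕ} (C : GenericBranch d n m) [NeZero d] [NeZero n]

open PowerSeries

theorem mem_Γ_iff {a : ℤ} : a ∈ C.Γ ↔ (C.gen a : ℤ) ≤ a := by
  constructor
  · rintro ⟨_, ⟨⟨r, hr⟩, rfl⟩, hr0, rfl⟩
    have hr0' : r ≠ 0 := by
      rintro rfl
      exact hr0 (by simp)
    obtain ⟨a, ha, hga⟩ := C.order_of_mem_localRing hr hr0'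
    rw [order_ofPowerSeries ha]
    exact_mod_cast hga
  · intro ha
    obtain ⟨a, rfl⟩ := Int.eq_ofNat_of_zero_le (le_trans (by positivity) ha)
    obtain ⟨r, hr, hra⟩ := C.exists_mem_localRing_order (a := a) (by exact_mod_cast ha)
    refine ⟨_, ⟨⟨r, hr⟩, rfl⟩, ?_, order_ofPowerSeries hra⟩
    rw [Ne, map_eq_zero_iff _ HahnSeries.ofPowerSeries_injective]
    rintro rfl
    simp at hra

end GenericBranch

end

end

section

open Finset

noncomputable section

/-! ## Subspaces of `ℂ⟦t⟧` with given orders -/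

section Orders

open PowerSeries

/-- `A` is the set of orders of the nonzero elements of the open subspace `M` of `ℂ⟦t⟧`. -/
structure HasOrders (M : Submodule ℂ ℂ⟦X⟧) (A : Set ℕ) : Prop where
  order_mem : ∀ w ∈ M, w ≠ 0 → ∃ a ∈ A, order w = a
  exists_order : ∀ a ∈ A, ∃ w ∈ M, order w = a
  isOpen : ∃ N, ∀ w : ℂ⟦X⟧, (∀ j < N, coeff j w = 0) → w ∈ M

namespace HasOrders

variable {M M' : Submodule ℂ ℂ⟦X⟧} {A : Set ℕ} (h : HasOrders M A)
include h

theorem eq_zero {w : ℂ⟦X⟧} (hw : w ∈ M) (h0 : ∀ a ∈ A, coeff a w = 0) : w = 0 := by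
  by_contra hne
  obtain ⟨a, ha, hwa⟩ := h.order_mem w hw hne
  exact (order_eq_nat.1 hwa).1 (h0 a ha)

theorem finite_compl : Aᶜ.Finite := by
  obtain ⟨N, hN⟩ := h.isOpen
  refine (Set.finite_lt_nat N).subset fun a ha => ?_
  by_contra hlt
  have h1 : (X : ℂ⟦X⟧) ^ a ∈ M := hN _ fun j hj => by
    rw [coeff_X_pow, if_neg]
    simp only [Set.mem_ofPred_eq] at hlt
    omega
  obtain ⟨b, hb, hab⟩ := h.order_mem _ h1 (pow_ne_zero _ X_ne_zero)
  rw [order_X_pow] at hab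
  exact ha ((by exact_mod_cast hab : a = b) ▸ hb)

/-- Reduction of power series modulo `M`. -/
theorem exists_reduction (w : ℂ⟦X⟧) :
    ∃ c : ℂ⟦X⟧, (∀ a ∈ A, coeff a c = 0) ∧ w - c ∈ M ∧
      ∀ k, (∀ j < k, coeff j w = 0) → ∀ j < k, coeff j c = 0 := by
  classical
  obtain ⟨N, hN⟩ := h.isOpen
  choose! e he ho using h.exists_order
  let E : ℕ → ℂ⟦X⟧ := fun a => if a ∈ A then (coeff a (e a))⁻¹ • e a else X ^ a
  have hE : ∀ a, coeff a (E a) = 1 := by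
    intro a
    by_cases ha : a ∈ A
    · simp only [E, if_pos ha, coeff_smul, smul_eq_mul]
      exact inv_mul_cancel₀ (order_eq_nat.1 (ho a ha)).1
    · simp [E, if_neg ha]
  obtain ⟨ε, hε, hε0⟩ := exists_triangular_expansion E hE w
  let c : ℂ⟦X⟧ := PowerSeries.mk fun a => if a ∈ A then 0 else ε a
  have hlow : ∀ a j, j < a → coeff j (E a) = 0 := by
    intro a j hj
    by_cases ha : a ∈ A
    · simp only [E, if_pos ha, coeff_smul, (order_eq_nat.1 (ho a ha)).2 j hj, smul_zero]
    · simp only [E, if_neg ha, coeff_X_pow, if_neg hj.ne]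
  refine ⟨c, fun a ha => by simp [c, ha], ?_, fun k hk j hj => ?_⟩
  · have h1 : w - c - ∑ a ∈ (range N).filter (· ∈ A), ε a • E a ∈ M := by
      refine hN _ fun j hj => ?_
      rw [map_sub, map_sub, map_sum, hε]
      have h2 : ∑ a ∈ range (j + 1), ε a * coeff j (E a) = ∑ a ∈ range N, ε a * coeff j (E a) := by
        refine sum_subset (range_subset_range.2 (by omega)) fun a _ ha => ?_
        rw [mem_range, not_lt] at ha
        rw [hlow a j (by omega), mul_zero]
      have h3 : coeff j c = ∑ a ∈ (range N).filter (¬ · ∈ A), ε a * coeff j (E a) := by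
        simp only [c, coeff_mk]
        rw [sum_filter, sum_eq_single j]
        · by_cases hjA : j ∈ A
          · simp [hjA]
          · simp [hjA, hE]
        · intro a _ haj
          by_cases haA : a ∈ A
          · simp [haA]
          · simp only [haA, not_false_eq_true, if_true, E, if_false, coeff_X_pow, if_neg haj.symm,
              mul_zero]
        · intro hj'
          exact absurd (mem_range.2 hj) hj'
      rw [h2, h3, ← sum_filter_add_sum_filter_not (range N) (· ∈ A)]
      simp only [coeff_smul, smul_eq_mul]
      ring
    have h4 : ∑ a ∈ (range N).filter (· ∈ A), ε a • E a ∈ M := by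
      refine Submodule.sum_mem _ fun a ha => Submodule.smul_mem _ _ ?_
      have haA := (mem_filter.1 ha).2
      simp only [E, if_pos haA]
      exact Submodule.smul_mem _ _ (he a haA)
    have h5 := Submodule.add_mem _ h1 h4
    rwa [sub_add_cancel] at h5
  · simp only [c, coeff_mk, hε0 k hk j hj, ite_self]

/-- Reducing an element of the larger space modulo the smaller one leaves an element without
exponents in the common set of orders, hence zero. -/
theorem eq_of_le (h' : HasOrders M' A) (hle : M ≤ M') : M = M' := by
  refine le_antisymm hle fun w hw => ?_
  obtain ⟨c, hc, hwc, -⟩ := h.exists_reduction w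
  have h1 : c ∈ M' := by
    have := Submodule.sub_mem _ hw (hle hwc)
    rwa [sub_sub_cancel] at this
  rwa [h'.eq_zero h1 hc, sub_zero] at hwc

/-- Elements of `M` with given leading term and no other terms with exponents in `A`. -/
theorem exists_reduced {a : ℕ} (ha : a ∈ A) :
    ∃ f ∈ M, coeff a f = 1 ∧ (∀ j < a, coeff j f = 0) ∧ ∀ j, j ≠ a → j ∈ A → coeff j f = 0 := by
  obtain ⟨c, hc, hwc, hlow⟩ := h.exists_reduction (X ^ a)
  refine ⟨_, hwc, ?_, ?_, ?_⟩
  · rw [map_sub, hc a ha, coeff_X_pow_self, sub_zero]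
  · intro j hj
    rw [map_sub, hlow a (fun i hi => by rw [coeff_X_pow, if_neg hi.ne]) j hj, coeff_X_pow,
      if_neg hj.ne, sub_zero]
  · intro j hj hjA
    rw [map_sub, hc j hjA, coeff_X_pow, if_neg hj, sub_zero]

/-- The monomials `t^g` with `g` a gap form a basis of the quotient. -/
theorem finrank_quotient : Module.finrank ℂ (ℂ⟦X⟧ ⧸ M) = Aᶜ.ncard := by
  classical
  have hfin := h.finite_compl
  let G := hfin.toFinset
  let T : (G → ℂ) →ₗ[ℂ] ℂ⟦X⟧ ⧸ M :=
    M.mkQ ∘ₗ ∑ g : G, (LinearMap.toSpanSingleton ℂ ℂ⟦X⟧ (X ^ (g : ℕ))) ∘ₗ LinearMap.proj g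
  have hT : ∀ c, T c = M.mkQ (∑ g : G, c g • X ^ (g : ℕ)) := by
    intro c
    simp [T]
  have hcoeff : ∀ (c : G → ℂ) (j : ℕ), coeff j (∑ g : G, c g • (X : ℂ⟦X⟧) ^ (g : ℕ)) =
      if hj : j ∈ G then c ⟨j, hj⟩ else 0 := by
    intro c j
    simp only [map_sum, coeff_smul, coeff_X_pow, smul_eq_mul, mul_ite, mul_one, mul_zero]
    split_ifs with hj
    · rw [sum_eq_single ⟨j, hj⟩]
      · simp
      · intro g _ hg
        rw [if_neg]
        rintro rfl
        exact hg rfl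
      · simp
    · refine sum_eq_zero fun g _ => if_neg ?_
      rintro rfl
      exact hj g.2
  have hbij : Function.Bijective T := by
    constructor
    · rw [← LinearMap.ker_eq_bot, LinearMap.ker_eq_bot']
      intro c hc
      rw [hT, Submodule.mkQ_apply, Submodule.Quotient.mk_eq_zero] at hc
      have h0 := h.eq_zero hc fun a ha => by
        rw [hcoeff, dif_neg]
        simpa [G] using ha
      ext g
      have := hcoeff c g
      rw [h0, dif_pos g.2] at this
      simpa using this.symm
    · intro z
      obtain ⟨w, rfl⟩ := M.mkQ_surjective z
      obtain ⟨c, hc, hwc, -⟩ := h.exists_reduction w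
      refine ⟨fun g => coeff (g : ℕ) c, ?_⟩
      rw [hT, ← sub_eq_zero, ← map_sub, Submodule.mkQ_apply, Submodule.Quotient.mk_eq_zero]
      have h1 : ∑ g : G, (coeff (g : ℕ) c) • (X : ℂ⟦X⟧) ^ (g : ℕ) = c := by
        ext j
        rw [hcoeff]
        split_ifs with hj
        · rfl
        · refine (hc j ?_).symm
          simpa [G] using hj
      rw [h1, ← neg_sub]
      exact Submodule.neg_mem _ hwc
  rw [← (LinearEquiv.ofBijective T hbij).finrank_eq, Module.finrank_fintype_fun_eq_card,
    Fintype.card_coe, Set.ncard_eq_toFinset_card _ hfin]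

end HasOrders

theorem hasOrders_genSpan {q : ℕ} [NeZero q] {b : ZMod q → ℂ⟦X⟧} {γ : ZMod q → ℕ}
    (hγ : ∀ k, ((γ k : ℕ) : ZMod q) = k) (hb : ∀ k, order (b k) = γ k) :
    HasOrders (genSpan b) {a | γ a ≤ a} where
  order_mem w hw hw0 := by
    obtain ⟨a, ha, hγa⟩ := order_of_mem_genSpan hγ hb hw hw0
    exact ⟨a, hγa, ha⟩
  exists_order a ha := by
    obtain ⟨s, hs⟩ := exists_eq_gen_add hγ ha
    refine ⟨_, expand_mul_mem_genSpan (gen_mem_genSpan (a : ZMod q)) (X ^ s), ?_⟩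
    rw [order_mul, order_expand, order_X_pow, hb]
    conv_rhs => rw [hs]
    push_cast
    simp only [nsmul_eq_mul]
    ring
  isOpen := ⟨univ.sup γ, fun w hw => mem_genSpan_of_order hγ hb
    (fun a ha => le_trans (le_sup (mem_univ _)) ha) hw⟩

theorem gapCount_eq_ncard {Δ : Set ℤ} : gapCount Δ = ({a : ℕ | (a : ℤ) ∈ Δ}ᶜ).ncard := by
  rw [gapCount, ← Set.ncard_image_of_injective _ (Nat.cast_injective : Function.Injective (Nat.cast : ℕ → ℤ))]
  congr 1
  ext a
  simp only [Set.mem_ofPred_eq, Set.mem_image, Set.mem_compl_iff]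
  constructor
  · rintro ⟨h1, h2⟩
    obtain ⟨b, rfl⟩ := Int.eq_ofNat_of_zero_le h1
    exact ⟨b, h2, rfl⟩
  · rintro ⟨b, h, rfl⟩
    exact ⟨by positivity, h⟩

end Orders

/-! ## Duality -/

namespace GenericBranch

variable {d n m : ℕ} (C : GenericBranch d n m)

open PowerSeries

/-- `t^s R`. -/
def shiftedRing (s : ℕ) : Submodule ℂ ℂ⟦X⟧ :=
  (Subalgebra.toSubmodule C.localRing).map (LinearMap.mulLeft ℂ (X ^ s))

theorem mem_shiftedRing {s : ℕ} {w : ℂ⟦X⟧} :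
    w ∈ C.shiftedRing s ↔ ∃ r ∈ C.localRing, X ^ s * r = w := by
  simp [shiftedRing]

theorem mul_mem_shiftedRing {s : ℕ} {r w : ℂ⟦X⟧} (hr : r ∈ C.localRing)
    (hw : w ∈ C.shiftedRing s) : r * w ∈ C.shiftedRing s := by
  obtain ⟨r', hr', rfl⟩ := C.mem_shiftedRing.1 hw
  exact C.mem_shiftedRing.2 ⟨r * r', Subalgebra.mul_mem _ hr hr', by ring⟩

variable [NeZero d] [NeZero n]

theorem toSubmodule_localRing : Subalgebra.toSubmodule C.localRing = genSpan C.basisElt := by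
  ext z
  rw [Subalgebra.mem_toSubmodule, mem_localRing_iff]

theorem hasOrders_localRing : HasOrders (Subalgebra.toSubmodule C.localRing) {a | C.gen a ≤ a} := by
  rw [toSubmodule_localRing]
  exact hasOrders_genSpan C.natCast_gen C.order_basisElt

theorem delta_eq : C.delta = ({a : ℕ | C.gen a ≤ a}ᶜ).ncard :=
  C.hasOrders_localRing.finrank_quotient

/-- The orders of the elements of `t^s R`. -/
def shiftedOrders (s : ℕ) : Set ℕ := {a | ∃ b : ℕ, C.gen b ≤ b ∧ a = s + b}

theorem mem_shiftedOrders {s a : ℕ} :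
    a ∈ C.shiftedOrders s ↔ (C.gen ((a - s : ℤ) : ZMod (d * n)) : ℤ) ≤ (a - s : ℤ) := by
  constructor
  · rintro ⟨b, hb, rfl⟩
    have : (((s + b : ℕ) : ℤ) - s) = b := by push_cast; ring
    rw [this, Int.cast_natCast]
    exact_mod_cast hb
  · intro h
    obtain ⟨b, hb⟩ := Int.eq_ofNat_of_zero_le (le_trans (by positivity) h)
    refine ⟨b, ?_, by omega⟩
    rw [hb, Int.cast_natCast] at h
    exact_mod_cast h

theorem hasOrders_shiftedRing (s : ℕ) : HasOrders (C.shiftedRing s) (C.shiftedOrders s) where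
  order_mem w hw hw0 := by
    obtain ⟨r, hr, rfl⟩ := C.mem_shiftedRing.1 hw
    obtain ⟨b, hb, hrb⟩ := C.hasOrders_localRing.order_mem r hr (right_ne_zero_of_mul hw0)
    refine ⟨s + b, ⟨b, hb, rfl⟩, ?_⟩
    rw [order_mul, order_X_pow, hrb]
    push_cast
    rfl
  exists_order := by
    rintro a ⟨b, hb, rfl⟩
    obtain ⟨r, hr, hrb⟩ := C.hasOrders_localRing.exists_order b hb
    refine ⟨_, C.mem_shiftedRing.2 ⟨r, hr, rfl⟩, ?_⟩
    rw [order_mul, order_X_pow, hrb]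
    push_cast
    rfl
  isOpen := by
    obtain ⟨N, hN⟩ := C.hasOrders_localRing.isOpen
    refine ⟨s + N, fun w hw => ?_⟩
    obtain ⟨u, rfl⟩ := X_pow_dvd_iff.2 fun j (hj : j < s) => hw j (by omega)
    refine C.mem_shiftedRing.2 ⟨u, hN u fun j hj => ?_, rfl⟩
    have := hw (j + s) (by omega)
    rwa [coeff_X_pow_mul] at this

/-- The residue pairing: `R` is Gorenstein. -/
theorem exists_duality (s : ℕ) : ∃ Φ : ℂ⟦X⟧ →ₗ[ℂ] ℂ, (∀ w ∈ C.shiftedRing s, Φ w = 0) ∧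
    ∀ w, (∀ r ∈ C.localRing, Φ (w * r) = 0) → w ∈ C.shiftedRing s := by
  have hlt := lt_topGen (d := d) C.one_lt_n C.n_lt_m
  have hS := C.hasOrders_shiftedRing s
  -- The largest gap of `s + Γ`. The functional `Φ` is chosen to vanish on `t^s R` and not on `t^κ`,
  -- so it is nonzero on every series of order `κ`.
  set κ := s + (topGen d n m - d * n) with hκ
  have hκS : κ ∉ C.shiftedOrders s := by
    rw [C.mem_shiftedOrders, gen, semigroupGen_symm (b := 0) _ (by omega)]
    simp [semigroupGen_zero]
  have hbig : ∀ a, κ < a → a ∈ C.shiftedOrders s := by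
    intro a ha
    rw [C.mem_shiftedOrders]
    exact semigroupGen_le_of_conductor_le _ (by push_cast [hκ] at *; omega)
  have hX : (X : ℂ⟦X⟧) ^ κ ∉ C.shiftedRing s := by
    intro hmem
    obtain ⟨a, ha, hoa⟩ := hS.order_mem _ hmem (pow_ne_zero _ X_ne_zero)
    rw [order_X_pow] at hoa
    exact hκS ((by exact_mod_cast hoa : κ = a) ▸ ha)
  have hbigmem : ∀ w : ℂ⟦X⟧, (∀ j ≤ κ, coeff j w = 0) → w ∈ C.shiftedRing s := by
    intro w hw
    obtain ⟨c, hc, hwc, hlow⟩ := hS.exists_reduction w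
    have hc0 : c = 0 := by
      ext j
      rw [map_zero]
      by_cases hj : j ≤ κ
      · exact hlow (κ + 1) (fun i hi => hw i (by omega)) j (by omega)
      · exact hc j (hbig j (by omega))
    rwa [hc0, sub_zero] at hwc
  obtain ⟨Φ, hΦX, hΦ⟩ := Submodule.exists_le_ker_of_notMem hX
  have hΦ0 : ∀ w ∈ C.shiftedRing s, Φ w = 0 := fun w hw => hΦ hw
  have hΦ1 : ∀ w : ℂ⟦X⟧, order w = κ → Φ w ≠ 0 := by
    intro w hw
    have h1 := order_eq_nat.1 hw
    have h2 : w - coeff κ w • X ^ κ ∈ C.shiftedRing s := by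
      refine hbigmem _ fun j hj => ?_
      rw [map_sub, coeff_smul, coeff_X_pow]
      rcases eq_or_lt_of_le hj with rfl | hj'
      · simp
      · rw [if_neg hj'.ne, h1.2 j hj']
        simp
    have h3 := hΦ0 _ h2
    rw [map_sub, map_smul, sub_eq_zero] at h3
    rw [h3]
    exact mul_ne_zero h1.1 hΦX
  refine ⟨Φ, hΦ0, fun w hw => ?_⟩
  obtain ⟨c, hc, hwc, -⟩ := hS.exists_reduction w
  have hcr : ∀ r ∈ C.localRing, Φ (c * r) = 0 := by
    intro r hr
    have h1 := hΦ0 _ (C.mul_mem_shiftedRing hr hwc)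
    rw [mul_sub, map_sub, mul_comm r w, hw r hr, zero_sub, neg_eq_zero] at h1
    rwa [mul_comm]
  by_cases hc0 : c = 0
  · rwa [hc0, sub_zero] at hwc
  · exfalso
    obtain ⟨a, ha⟩ : ∃ a : ℕ, order c = a := ⟨_, (coe_toNat_order hc0).symm⟩
    have haS : a ∉ C.shiftedOrders s := fun h => (order_eq_nat.1 ha).1 (hc a h)
    have hle : a ≤ κ := by
      by_contra hlt
      exact haS (hbig a (by omega))
    -- Since `a` is a gap of `s + Γ`, symmetry puts `κ - a` in `Γ`. An element of `R` of that order
    -- moves `c` to order `κ`, where `Φ` does not vanish.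
    have h2 : (C.gen ((κ - a : ℤ) : ZMod (d * n)) : ℤ) ≤ (κ - a : ℤ) := by
      by_contra h3
      apply haS
      rw [C.mem_shiftedOrders, gen, semigroupGen_symm (b := κ - a) _ (by push_cast [hκ] at *; omega)]
      exact not_le.1 h3
    obtain ⟨b, hb⟩ := Nat.exists_eq_add_of_le hle
    have h4 : ((κ : ℤ) - a) = b := by omega
    rw [h4, Int.cast_natCast] at h2
    obtain ⟨r, hr, hrb⟩ := C.exists_mem_localRing_order (a := b) (by exact_mod_cast h2)
    refine hΦ1 (c * r) ?_ (hcr r hr)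
    rw [order_mul, ha, hrb, hb]
    push_cast
    rfl

end GenericBranch

end

end

section

noncomputable section

/-! ## Charts of Grassmannians -/

section Grassmannian

variable {V : Type*} [AddCommGroup V] [Module ℂ V] {k : ℕ}

/-- The matrix entries of a framed quotient. -/
def FramedQuotient.entries (q : FramedQuotient V k) : ZariskiSpace (V × Fin k) :=
  fun vi => q.1 vi.1 vi.2

theorem FramedQuotient.continuous_entries :
    Continuous (FramedQuotient.entries : FramedQuotient V k → ZariskiSpace (V × Fin k)) :=
  continuous_induced_dom

theorem FramedQuotient.continuous_iff {T : Type*} [TopologicalSpace T]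
    {f : T → FramedQuotient V k} : Continuous f ↔ Continuous fun t => (f t).entries :=
  continuous_induced_rng

theorem FramedQuotient.continuous_toGrassmannian :
    Continuous (FramedQuotient.toGrassmannian : FramedQuotient V k → Module.Grassmannian ℂ V k) :=
  continuous_coinduced_rng

/-- Change of the framing. -/
def FramedQuotient.trans (A : (Fin k → ℂ) ≃ₗ[ℂ] (Fin k → ℂ)) (q : FramedQuotient V k) :
    FramedQuotient V k :=
  ⟨A.toLinearMap ∘ₗ q.1, A.surjective.comp q.2⟩

theorem FramedQuotient.continuous_trans (A : (Fin k → ℂ) ≃ₗ[ℂ] (Fin k → ℂ)) :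
    Continuous (FramedQuotient.trans A : FramedQuotient V k → FramedQuotient V k) := by
  rw [FramedQuotient.continuous_iff]
  have h : Continuous (X := ZariskiSpace (V × Fin k)) (Y := ZariskiSpace (V × Fin k))
      fun w vi => A (fun i => w (vi.1, i)) vi.2 := by
    refine ZariskiSpace.continuous_of_isPolyFun
      (f := fun (w : V × Fin k → ℂ) (vi : V × Fin k) => A (fun i => w (vi.1, i)) vi.2) fun vi => ?_
    exact IsPolyFun.linear A.toLinearMap
      (f := fun (w : V × Fin k → ℂ) (i : Fin k) => w (vi.1, i)) (fun i => IsPolyFun.coord _) vi.2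
  exact Continuous.comp (Y := ZariskiSpace (V × Fin k)) h FramedQuotient.continuous_entries

theorem FramedQuotient.toGrassmannian_eq_iff {q q' : FramedQuotient V k} :
    q.toGrassmannian = q'.toGrassmannian ↔ LinearMap.ker q.1 = LinearMap.ker q'.1 :=
  ⟨fun h => congrArg Module.Grassmannian.toSubmodule h, fun h => Module.Grassmannian.ext h⟩

theorem FramedQuotient.exists_trans_eq {q q' : FramedQuotient V k}
    (h : LinearMap.ker q.1 = LinearMap.ker q'.1) : ∃ A, FramedQuotient.trans A q' = q := by
  refine ⟨(q'.1.quotKerEquivOfSurjective q'.2).symm.trans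
    ((Submodule.quotEquivOfEq _ _ h.symm).trans (q.1.quotKerEquivOfSurjective q.2)), ?_⟩
  refine Subtype.ext (LinearMap.ext fun v => ?_)
  simp only [FramedQuotient.trans, LinearMap.comp_apply, LinearEquiv.coe_coe,
    LinearEquiv.trans_apply]
  have h1 : (q'.1.quotKerEquivOfSurjective q'.2).symm (q'.1 v) = Submodule.Quotient.mk v := by
    rw [LinearEquiv.symm_apply_eq]
    rfl
  rw [h1]
  rfl

theorem FramedQuotient.trans_toGrassmannian (A : (Fin k → ℂ) ≃ₗ[ℂ] (Fin k → ℂ))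
    (q : FramedQuotient V k) : (FramedQuotient.trans A q).toGrassmannian = q.toGrassmannian := by
  rw [FramedQuotient.toGrassmannian_eq_iff]
  exact LinearEquiv.ker_comp A q.1

/-- Framings with the same kernel differ by an element of `GL_k`, so the saturation of an open set
is the union of its translates. -/
theorem FramedQuotient.isOpenMap_toGrassmannian :
    IsOpenMap (FramedQuotient.toGrassmannian : FramedQuotient V k → Module.Grassmannian ℂ V k) := by
  intro O hO
  rw [isOpen_coinduced]
  have h : FramedQuotient.toGrassmannian ⁻¹' (FramedQuotient.toGrassmannian '' O) =
      ⋃ A, (FramedQuotient.trans A : FramedQuotient V k → _) ⁻¹' O := by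
    ext q
    simp only [Set.mem_preimage, Set.mem_image, Set.mem_iUnion]
    constructor
    · rintro ⟨q', hq', h⟩
      obtain ⟨A, hA⟩ := FramedQuotient.exists_trans_eq (FramedQuotient.toGrassmannian_eq_iff.1 h)
      exact ⟨A, hA ▸ hq'⟩
    · rintro ⟨A, hA⟩
      exact ⟨_, hA, FramedQuotient.trans_toGrassmannian A q⟩
  rw [h]
  exact isOpen_iUnion fun A => hO.preimage (FramedQuotient.continuous_trans A)

/-- Clearing denominators. -/
theorem MvPolynomial.exists_homogenization {σ τ : Type*} (p : MvPolynomial σ ℂ)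
    {Dt : (τ → ℂ) → ℂ} (hDt : IsPolyFun Dt) {N : σ → (τ → ℂ) → ℂ} (hN : ∀ i, IsPolyFun (N i)) :
    ∃ (K : ℕ) (P : (τ → ℂ) → ℂ), IsPolyFun P ∧ ∀ x w, (∀ i, w i * Dt x = N i x) →
      MvPolynomial.eval w p * Dt x ^ K = P x := by
  induction p using MvPolynomial.induction_on with
  | C a => exact ⟨0, fun _ => a, IsPolyFun.const a, fun x w _ => by simp⟩
  | add p p' hp hp' =>
    obtain ⟨K, P, hP, h⟩ := hp
    obtain ⟨K', P', hP', h'⟩ := hp'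
    refine ⟨K + K', fun x => P x * Dt x ^ K' + P' x * Dt x ^ K,
      (hP.mul (hDt.pow _)).add (hP'.mul (hDt.pow _)), fun x w hw => ?_⟩
    beta_reduce
    rw [map_add, ← h x w hw, ← h' x w hw]
    ring
  | mul_X p i hp =>
    obtain ⟨K, P, hP, h⟩ := hp
    refine ⟨K + 1, fun x => P x * N i x, hP.mul (hN i), fun x w hw => ?_⟩
    beta_reduce
    rw [map_mul, MvPolynomial.eval_X, ← h x w hw, ← hw i]
    ring

/-- Regular functions of the framings are regular on the Grassmannian. -/
theorem FramedQuotient.continuous_of_entries {σ T : Type*} [TopologicalSpace T]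
    {ι : T → Module.Grassmannian ℂ V k} (hι : Continuous ι) {θ : T → ZariskiSpace σ}
    {Dt : (V × Fin k → ℂ) → ℂ} (hDt : IsPolyFun Dt) {N : σ → (V × Fin k → ℂ) → ℂ}
    (hN : ∀ i, IsPolyFun (N i)) (hex : ∀ t, ∃ q : FramedQuotient V k, q.toGrassmannian = ι t)
    (h : ∀ t (q : FramedQuotient V k), q.toGrassmannian = ι t →
      Dt q.entries ≠ 0 ∧ ∀ i, θ t i * Dt q.entries = N i q.entries) : Continuous θ := by
  rw [ZariskiSpace.continuous_iff]
  intro p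
  obtain ⟨K, P, hP, hPp⟩ := MvPolynomial.exists_homogenization p hDt hN
  have hiff : ∀ t (q : FramedQuotient V k), q.toGrassmannian = ι t →
      (P q.entries ≠ 0 ↔ MvPolynomial.eval (θ t) p ≠ 0) := by
    intro t q hq
    obtain ⟨h1, h2⟩ := h t q hq
    rw [← hPp q.entries (θ t) h2, Ne, mul_eq_zero, not_or]
    exact ⟨fun h => h.1, fun h => ⟨h, pow_ne_zero _ h1⟩⟩
  -- Whether `p` vanishes at `θ t` can be read off from any framing of `ι t`. So the locus is the
  -- preimage of the image of the open set `P ≠ 0` of framings.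
  have hO := (FramedQuotient.isOpenMap_toGrassmannian _
    ((ZariskiSpace.isOpen_of_isPolyFun hP).preimage
      (FramedQuotient.continuous_entries (V := V) (k := k)))).preimage hι
  convert hO using 1
  ext t
  simp only [Set.mem_ofPred_eq, Set.mem_preimage, Set.mem_image]
  constructor
  · intro ht
    obtain ⟨q, hq⟩ := hex t
    exact ⟨q, (hiff t q hq).2 ht, hq⟩
  · rintro ⟨q, hq, hqt⟩
    exact (hiff t q hqt).1 hq

end Grassmannian

end

end

section

open Finset

noncomputable section

/-! ## Modules with given orders -/

section GenModule

open PowerSeries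

variable {q : ℕ}

/-- The power series `t^a + ∑ v_{l,a} t^{a+l}`. -/
def genSeries (v : ℕ × ZMod q → ℂ) (a : ℕ) : ℂ⟦X⟧ :=
  X ^ a * PowerSeries.mk fun l => genCoeff v l (a : ZMod q)

theorem coeff_genSeries_add (v : ℕ × ZMod q → ℂ) (a l : ℕ) :
    coeff (a + l) (genSeries v a) = genCoeff v l (a : ZMod q) := by
  rw [genSeries, add_comm, coeff_X_pow_mul, coeff_mk]

theorem coeff_genSeries_of_lt (v : ℕ × ZMod q → ℂ) {a j : ℕ} (h : j < a) :
    coeff j (genSeries v a) = 0 := by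
  rw [genSeries, coeff_X_pow_mul', if_neg (by omega)]

theorem coeff_genSeries_self (v : ℕ × ZMod q → ℂ) (a : ℕ) : coeff a (genSeries v a) = 1 := by
  have := coeff_genSeries_add v a 0
  rwa [add_zero, genCoeff_zero] at this

theorem order_genSeries (v : ℕ × ZMod q → ℂ) (a : ℕ) : order (genSeries v a) = a := by
  rw [order_eq_nat]
  exact ⟨by rw [coeff_genSeries_self]; exact one_ne_zero, fun j hj => coeff_genSeries_of_lt v hj⟩

theorem genSeries_add_mul [NeZero q] (v : ℕ × ZMod q → ℂ) (a s : ℕ) :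
    genSeries v (a + q * s) = expand q (NeZero.ne q) (X ^ s) * genSeries v a := by
  rw [genSeries, genSeries, map_pow, expand_X]
  have : ((a + q * s : ℕ) : ZMod q) = a := by
    push_cast
    rw [ZMod.natCast_self, zero_mul, add_zero]
  rw [this]
  ring

/-- The elements of `M` among the formal combinations of the series `t^a + ∑ v_{l,a} t^{a+l}`. -/
theorem HasOrders.mem_iff_of_coeff_eq {M : Submodule ℂ ℂ⟦X⟧} {A : Set ℕ} (h : HasOrders M A)
    {v : ℕ × ZMod q → ℂ} (hF : ∀ a ∈ A, genSeries v a ∈ M) {z : ℂ⟦X⟧} {a : ℕ} {N : ℕ → ℂ}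
    (hz : ∀ j < a, coeff j z = 0)
    (hzN : ∀ l, coeff (a + l) z =
      ∑ j ∈ range (l + 1), N j * genCoeff v (l - j) ((a + j : ℕ) : ZMod q)) :
    z ∈ M ↔ ∀ j, a + j ∉ A → N j = 0 := by
  classical
  have hsum : ∀ L l, coeff (a + l) (∑ j ∈ range L, N j • genSeries v (a + j)) =
      ∑ j ∈ (range L).filter (· ≤ l), N j * genCoeff v (l - j) ((a + j : ℕ) : ZMod q) := by
    intro L l
    rw [map_sum, sum_filter]
    refine sum_congr rfl fun j _ => ?_
    rw [coeff_smul, smul_eq_mul]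
    split_ifs with hj
    · rw [show a + l = a + j + (l - j) by omega, coeff_genSeries_add]
    · rw [coeff_genSeries_of_lt v (by omega), mul_zero]
  have hlow : ∀ L, ∀ i < a + L, coeff i (z - ∑ j ∈ range L, N j • genSeries v (a + j)) = 0 := by
    intro L i hi
    rcases lt_or_ge i a with hia | hia
    · rw [map_sub, hz i hia, zero_sub, neg_eq_zero, map_sum]
      refine sum_eq_zero fun j _ => ?_
      rw [coeff_smul, coeff_genSeries_of_lt v (by omega), smul_zero]
    · obtain ⟨l, rfl⟩ := Nat.exists_eq_add_of_le hia
      rw [map_sub, hsum, hzN, sub_eq_zero]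
      refine sum_congr ?_ fun _ _ => rfl
      ext j
      simp only [mem_range, mem_filter]
      omega
  constructor
  · intro hzM j
    induction j using Nat.strong_induction_on with
    | _ j ih =>
      intro hj
      by_contra hne
      -- At the first `j` with `a + j ∉ A` and `N j ≠ 0`, all earlier terms belong to `M`.
      -- Subtracting them leaves an element of `M` of order `a + j`, which is not an admissible
      -- order.
      have h1 : z - ∑ i ∈ range j, N i • genSeries v (a + i) ∈ M := by
        refine Submodule.sub_mem _ hzM (Submodule.sum_mem _ fun i hi => ?_)
        by_cases hiA : a + i ∈ A
        · exact Submodule.smul_mem _ _ (hF _ hiA)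
        · rw [ih i (mem_range.1 hi) hiA, zero_smul]
          exact Submodule.zero_mem _
      have h2 : order (z - ∑ i ∈ range j, N i • genSeries v (a + i)) = (a + j : ℕ) := by
        rw [order_eq_nat]
        refine ⟨?_, hlow j⟩
        rw [map_sub, hsum, hzN, sum_range_succ, Nat.sub_self, genCoeff_zero, mul_one]
        have : (range j).filter (· ≤ j) = range j :=
          filter_true_of_mem fun i hi => (mem_range.1 hi).le
        rwa [this, add_sub_cancel_left]
      have h3 : z - ∑ i ∈ range j, N i • genSeries v (a + i) ≠ 0 := by
        intro h0
        rw [h0, order_zero] at h2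
        exact ENat.top_ne_natCast _ h2
      obtain ⟨b, hb, hob⟩ := h.order_mem _ h1 h3
      rw [h2] at hob
      exact hj ((by exact_mod_cast hob : a + j = b) ▸ hb)
  · intro hN
    obtain ⟨L, hL⟩ := h.isOpen
    have h1 := hL _ fun i hi => hlow L i (by omega)
    have h2 : ∑ j ∈ range L, N j • genSeries v (a + j) ∈ M := by
      refine Submodule.sum_mem _ fun i _ => ?_
      by_cases hiA : a + i ∈ A
      · exact Submodule.smul_mem _ _ (hF _ hiA)
      · rw [hN i hiA, zero_smul]
        exact Submodule.zero_mem _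
    have h3 := Submodule.add_mem _ h1 h2
    rwa [sub_add_cancel] at h3

/-- The `d n`-invariant set with given generators. -/
def genOrders (α : ZMod q → ℕ) : Set ℕ := {a | α a ≤ a}

variable [NeZero q] {α : ZMod q → ℕ}

/-- The module generated by the series `t^{α_k} + ∑ v_{l,k} t^{α_k+l}`. -/
def genModule (α : ZMod q → ℕ) (v : ℕ × ZMod q → ℂ) : Submodule ℂ ℂ⟦X⟧ :=
  genSpan fun k => genSeries v (α k)

variable (hα : ∀ k, ((α k : ℕ) : ZMod q) = k)
include hα

theorem hasOrders_genModule (v : ℕ × ZMod q → ℂ) : HasOrders (genModule α v) (genOrders α) :=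
  hasOrders_genSpan hα fun _ => order_genSeries v _

omit [NeZero q] in
theorem gen_mem_genOrders (k : ZMod q) : α k ∈ genOrders α := by
  change α (α k : ℕ) ≤ α k
  rw [hα]

theorem genSeries_mem_genModule (v : ℕ × ZMod q → ℂ) {a : ℕ} (ha : a ∈ genOrders α) :
    genSeries v a ∈ genModule α v := by
  obtain ⟨s, hs⟩ := exists_eq_gen_add hα ha
  rw [hs, genSeries_add_mul]
  exact expand_mul_mem_genSpan (gen_mem_genSpan (b := fun k => genSeries v (α k)) _) _

omit [NeZero q] in
theorem notMem_genOrders_iff {k : ZMod q} {l : ℕ} :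
    α k + l ∉ genOrders α ↔ IsVar (fun k => (α k : ℤ)) l k := by
  rw [IsVar]
  change ¬ α ((α k + l : ℕ) : ZMod q) ≤ _ ↔ _
  push_cast
  rw [hα, not_le]
  exact_mod_cast Iff.rfl

/-- The recursion for `mulCoeff` is the formal expansion of `y f_k` in the series `t^a + …` over all
exponents `a`, gaps included. Membership means that the coefficients at the gaps vanish.
`X_pow_mem_iff` is the same statement for `t^s`. -/
theorem mul_genSeries_mem_iff {p : ℕ} {y : ℂ⟦X⟧} (hy : ∀ j < p, coeff j y = 0)
    (v : ℕ × ZMod q → ℂ) (k : ZMod q) :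
    y * genSeries v (α k) ∈ genModule α v ↔
      ∀ l, IsEqn (fun k => (α k : ℤ)) p l k →
        mulCoeff p (fun j => coeff (p + j) y) v l k = 0 := by
  obtain ⟨u, rfl⟩ := X_pow_dvd_iff.2 hy
  have hu : ∀ j, coeff (p + j) (X ^ p * u) = coeff j u := by
    intro j
    rw [add_comm, coeff_X_pow_mul]
  have h1 : X ^ p * u * genSeries v (α k) =
      X ^ (α k + p) * (u * PowerSeries.mk fun l => genCoeff v l k) := by
    rw [genSeries, hα]
    ring
  rw [(hasOrders_genModule hα v).mem_iff_of_coeff_eq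
    (fun a ha => genSeries_mem_genModule hα v ha) (a := α k + p)
    (N := fun l => mulCoeff p (fun j => coeff (p + j) (X ^ p * u)) v l k)]
  · refine forall_congr' fun l => imp_congr ?_ Iff.rfl
    rw [IsEqn]
    change ¬ α ((α k + p + l : ℕ) : ZMod q) ≤ _ ↔ _
    push_cast
    rw [hα, not_le]
    exact_mod_cast Iff.rfl
  · intro j hj
    rw [h1, coeff_X_pow_mul', if_neg (by omega)]
  · intro l
    rw [h1, add_comm, coeff_X_pow_mul, coeff_mul,
      Nat.sum_antidiagonal_eq_sum_range_succ (fun i j => coeff i u * coeff j _)]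
    conv_rhs => rw [sum_range_succ, Nat.sub_self, genCoeff_zero, mul_one, mulCoeff_eq]
    simp only [coeff_mk, hu]
    rw [add_comm, sub_add_eq_add_sub, eq_sub_iff_add_eq]
    congr 1
    refine sum_congr rfl fun j _ => ?_
    push_cast
    rw [hα, mul_comm]

theorem X_pow_mem_iff (v : ℕ × ZMod q → ℂ) (s : ℕ) :
    (X : ℂ⟦X⟧) ^ s ∈ genModule α v ↔
      ∀ l, IsPin (fun k => (α k : ℤ)) s l → powCoeff v (s : ZMod q) l = 0 := by
  rw [(hasOrders_genModule hα v).mem_iff_of_coeff_eq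
    (fun a ha => genSeries_mem_genModule hα v ha) (a := s) (N := fun l => powCoeff v (s : ZMod q) l)]
  · refine forall_congr' fun l => imp_congr ?_ Iff.rfl
    rw [IsPin]
    change ¬ α ((s + l : ℕ) : ZMod q) ≤ _ ↔ _
    push_cast
    rw [not_le]
    exact_mod_cast Iff.rfl
  · intro j hj
    rw [coeff_X_pow, if_neg hj.ne]
  · intro l
    rw [coeff_X_pow, sum_range_succ, Nat.sub_self, genCoeff_zero, mul_one, powCoeff_eq]
    push_cast
    rw [add_sub_cancel]
    simp

/-- The difference of two reduced generators with the same leading term has only gap exponents, so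
it is zero if it lies in the module. Thus the reduced basis is determined by the module. -/
theorem genSeries_injective {v v' : ℕ × ZMod q → ℂ} (hv : ∀ l k, ¬ (1 ≤ l ∧
      IsVar (fun k => (α k : ℤ)) l k) → v (l, k) = 0)
    (hv' : ∀ l k, ¬ (1 ≤ l ∧ IsVar (fun k => (α k : ℤ)) l k) → v' (l, k) = 0)
    (h : genModule α v = genModule α v') : v = v' := by
  ext ⟨l, k⟩
  by_cases hl : 1 ≤ l ∧ IsVar (fun k => (α k : ℤ)) l k
  swap
  · rw [hv l k hl, hv' l k hl]
  have hmem : genSeries v (α k) - genSeries v' (α k) ∈ genModule α v :=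
    Submodule.sub_mem _ (genSeries_mem_genModule hα v (gen_mem_genOrders hα k))
      (h ▸ genSeries_mem_genModule hα v' (gen_mem_genOrders hα k))
  have h0 := (hasOrders_genModule hα v).eq_zero hmem fun a ha => by
    rcases lt_or_ge a (α k) with hak | hak
    · rw [map_sub, coeff_genSeries_of_lt v hak, coeff_genSeries_of_lt v' hak, sub_zero]
    · obtain ⟨j, rfl⟩ := Nat.exists_eq_add_of_le hak
      have hj : ¬ (1 ≤ j ∧ IsVar (fun k => (α k : ℤ)) j k) := fun hj =>
        (notMem_genOrders_iff hα).2 hj.2 ha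
      rw [map_sub, coeff_genSeries_add, coeff_genSeries_add, hα]
      rcases Nat.eq_zero_or_pos j with rfl | hj0
      · simp
      · rw [genCoeff_of_pos _ hj0.ne', genCoeff_of_pos _ hj0.ne', hv j k hj, hv' j k hj, sub_zero]
  have h1 := congrArg (coeff (α k + l)) h0
  rw [map_sub, coeff_genSeries_add, coeff_genSeries_add, hα, map_zero, sub_eq_zero,
    genCoeff_of_pos _ (by omega), genCoeff_of_pos _ (by omega)] at h1
  exact h1

end GenModule

end

end

section

open Finset
open scoped PowerSeries LaurentSeries

noncomputable section

/-! ## Duality between ideals and modules -/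

namespace GenericBranch

variable {d n m : ℕ} (C : GenericBranch d n m)

open PowerSeries

/-- The ideal `{r ∈ R : r M ⊆ t^s R}`. -/
def colon (s : ℕ) (M : Submodule ℂ ℂ⟦X⟧) : Ideal C.localRing where
  carrier := {r | ∀ w ∈ M, (r : ℂ⟦X⟧) * w ∈ C.shiftedRing s}
  add_mem' {r r'} hr hr' w hw := by
    rw [Subalgebra.coe_add, add_mul]
    exact Submodule.add_mem _ (hr w hw) (hr' w hw)
  zero_mem' w _ := by
    rw [Subalgebra.coe_zero, zero_mul]
    exact Submodule.zero_mem _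
  smul_mem' c r hr w hw := by
    rw [smul_eq_mul, Subalgebra.coe_mul, mul_assoc]
    exact C.mul_mem_shiftedRing c.2 (hr w hw)

theorem mem_colon {s : ℕ} {M : Submodule ℂ ℂ⟦X⟧} {r : C.localRing} :
    r ∈ C.colon s M ↔ ∀ w ∈ M, (r : ℂ⟦X⟧) * w ∈ C.shiftedRing s := Iff.rfl

/-- The module `t^s I⁻¹ ∩ ℂ⟦t⟧`. -/
def dualModule (s : ℕ) (I : Ideal C.localRing) : Submodule ℂ ℂ⟦X⟧ where
  carrier := {w | ∀ r ∈ I, (r : ℂ⟦X⟧) * w ∈ C.shiftedRing s}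
  add_mem' {w w'} hw hw' r hr := by
    rw [mul_add]
    exact Submodule.add_mem _ (hw r hr) (hw' r hr)
  zero_mem' r _ := by
    rw [mul_zero]
    exact Submodule.zero_mem _
  smul_mem' c w hw r hr := by
    rw [mul_smul_comm]
    exact Submodule.smul_mem _ _ (hw r hr)

theorem mul_mem_dualModule {s : ℕ} {I : Ideal C.localRing} {r w : ℂ⟦X⟧} (hr : r ∈ C.localRing)
    (hw : w ∈ C.dualModule s I) : r * w ∈ C.dualModule s I := by
  intro r' hr'
  rw [mul_left_comm]
  exact C.mul_mem_shiftedRing hr (hw r' hr')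

theorem shiftedRing_le_dualModule (s : ℕ) (I : Ideal C.localRing) :
    C.shiftedRing s ≤ C.dualModule s I :=
  fun _ hw r _ => C.mul_mem_shiftedRing r.2 hw

theorem mem_dual_iff {s : ℕ} {I : Ideal C.localRing} {z : ℂ⸨X⸩} {w : ℂ⟦X⟧}
    (h : HahnSeries.single (s : ℤ) (1 : ℂ) * z = HahnSeries.ofPowerSeries ℤ ℂ w) :
    z ∈ C.dual I ↔ w ∈ C.dualModule s I := by
  have hX : HahnSeries.single (s : ℤ) (1 : ℂ) = HahnSeries.ofPowerSeries ℤ ℂ (X ^ s) := by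
    rw [HahnSeries.ofPowerSeries_X_pow]
  have hne : HahnSeries.single (s : ℤ) (1 : ℂ) ≠ 0 := by
    rw [Ne, HahnSeries.single_eq_zero_iff]
    exact one_ne_zero
  refine forall_congr' fun r => imp_congr_right fun hr => ?_
  rw [mem_shiftedRing]
  constructor
  · rintro ⟨f, hf⟩
    refine ⟨f, f.2, HahnSeries.ofPowerSeries_injective (Γ := ℤ) ?_⟩
    rw [map_mul, map_mul, ← hX, ← hf, ← h]
    ring
  · rintro ⟨f, hf, hfw⟩
    refine ⟨⟨f, hf⟩, mul_left_cancel₀ hne ?_⟩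
    rw [← mul_assoc, h, hX, ← map_mul, ← map_mul, mul_comm w, hfw]

theorem eq_ofPowerSeries_of_order {z : ℂ⸨X⸩} {o : ℤ} {j : ℕ} (h : o + HahnSeries.order z = j) :
    HahnSeries.single o (1 : ℂ) * z =
      HahnSeries.ofPowerSeries ℤ ℂ (X ^ j * z.powerSeriesPart) := by
  conv_lhs => rw [← LaurentSeries.single_order_mul_powerSeriesPart z]
  rw [map_mul, HahnSeries.ofPowerSeries_X_pow, ← mul_assoc, HahnSeries.single_mul_single, h,
    mul_one]

variable [NeZero d] [NeZero n]

theorem hasOrders_dualModule {Δ : Set ℤ} {τ s : ℕ} (hs : (s : ℤ) = τ - C.e Δ) {I : C.Hilb τ}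
    (hI : I ∈ C.cell Δ τ) :
    HasOrders (C.dualModule s I.1) {a : ℕ | (a : ℤ) ∈ Δ} where
  order_mem w hw hw0 := by
    refine ⟨_, ?_, (coe_toNat_order hw0).symm⟩
    change _ = Δ at hI
    change _ ∈ Δ
    rw [← hI, ← hs]
    set z : ℂ⸨X⸩ := HahnSeries.single (-(s : ℤ)) 1 * HahnSeries.ofPowerSeries ℤ ℂ w with hz
    have h1 : HahnSeries.single (s : ℤ) (1 : ℂ) * z = HahnSeries.ofPowerSeries ℤ ℂ w := by
      rw [hz, ← mul_assoc, HahnSeries.single_mul_single, add_neg_cancel, mul_one]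
      exact one_mul _
    refine ⟨_, ⟨z, (C.mem_dual_iff h1).2 hw, h1.symm⟩, ?_,
      order_ofPowerSeries (coe_toNat_order hw0).symm⟩
    rwa [Ne, map_eq_zero_iff _ HahnSeries.ofPowerSeries_injective]
  exists_order a ha := by
    change _ = Δ at hI
    change _ ∈ Δ at ha
    rw [← hI, ← hs] at ha
    obtain ⟨_, ⟨z, hz, rfl⟩, hne, ho⟩ := ha
    have h1 := eq_ofPowerSeries_of_order (z := HahnSeries.single (s : ℤ) (1 : ℂ) * z) (o := 0)
      (j := a) (by rw [ho, zero_add])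
    have h2 : HahnSeries.single (0 : ℤ) (1 : ℂ) = 1 := rfl
    rw [h2, one_mul] at h1
    set w := X ^ a * LaurentSeries.powerSeriesPart (HahnSeries.single (s : ℤ) (1 : ℂ) * z)
    refine ⟨w, (C.mem_dual_iff h1).1 hz, ?_⟩
    have hw0 : w ≠ 0 := by
      intro h0
      rw [h0, map_zero] at h1
      exact hne h1
    have h3 := order_ofPowerSeries (coe_toNat_order hw0).symm
    rw [← h1, ho] at h3
    rw [← coe_toNat_order hw0]
    exact_mod_cast h3.symm
  isOpen := by
    obtain ⟨N, hN⟩ := (C.hasOrders_shiftedRing s).isOpen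
    exact ⟨N, fun w hw => C.shiftedRing_le_dualModule s _ (hN w hw)⟩

/-- `dualModule` sees only the part of `t^s I⁻¹` inside `ℂ⟦t⟧`. The additional hypothesis, that `I`
contains all elements of high order, excludes elements of negative order. -/
theorem mem_cell {Δ : Set ℤ} {τ s : ℕ} (hs : (s : ℤ) = τ - C.e Δ) {I : C.Hilb τ}
    (hΔ : ∀ b ∈ Δ, 0 ≤ b) (h : HasOrders (C.dualModule s I.1) {a : ℕ | (a : ℤ) ∈ Δ})
    (hI : ∀ r : C.localRing, (∀ j, j + d * n ≤ s + topGen d n m → coeff j (r : ℂ⟦X⟧) = 0) →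
      r ∈ I.1) : I ∈ C.cell Δ τ := by
  have hlt := lt_topGen (d := d) C.one_lt_n C.n_lt_m
  change _ = Δ
  rw [← hs]
  ext a
  constructor
  · rintro ⟨_, ⟨z, hz, rfl⟩, hne, ho⟩
    have ha : 0 ≤ a := by
      by_contra! ha
      -- If `t^s z` has order `a < 0`, then `t^j` lies in `I` for this `j`, and the element `t^j z`
      -- of `R` has order `topGen - dn`, the largest gap of `Γ`.
      obtain ⟨j, hj⟩ : ∃ j : ℕ, (j : ℤ) = s + topGen d n m - d * n - a :=
        ⟨(s + topGen d n m - d * n - a : ℤ).toNat, Int.toNat_of_nonneg (by zify at hlt; omega)⟩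
      have hXj : (X : ℂ⟦X⟧) ^ j ∈ C.localRing := by
        rw [mem_localRing_iff]
        refine C.mem_genSpan_of_topGen_le fun i hi => ?_
        rw [coeff_X_pow, if_neg]
        zify at hi
        omega
      have hXI : (⟨X ^ j, hXj⟩ : C.localRing) ∈ I.1 := by
        refine hI _ fun i hi => ?_
        rw [coeff_X_pow, if_neg]
        zify at hi
        omega
      obtain ⟨f, hf⟩ := hz _ hXI
      have h1 := eq_ofPowerSeries_of_order (z := HahnSeries.single (s : ℤ) (1 : ℂ) * z) (o := j)
        (j := s + (topGen d n m - d * n)) (by rw [ho]; push_cast [hlt.le]; omega)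
      have h2 : HahnSeries.single (j : ℤ) (1 : ℂ) * (HahnSeries.single (s : ℤ) (1 : ℂ) * z) =
          HahnSeries.ofPowerSeries ℤ ℂ (X ^ s * (f : ℂ⟦X⟧)) := by
        rw [map_mul, ← hf, HahnSeries.ofPowerSeries_X_pow, HahnSeries.ofPowerSeries_X_pow]
        ring
      rw [h2, pow_add, mul_assoc] at h1
      have h3 := mul_left_cancel₀ (pow_ne_zero s X_ne_zero)
        (HahnSeries.ofPowerSeries_injective h1)
      have h4 : order (f : ℂ⟦X⟧) = (topGen d n m - d * n : ℕ) := by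
        rw [h3, order_mul, order_X_pow]
        have h5 : order (LaurentSeries.powerSeriesPart (HahnSeries.single (s : ℤ) (1 : ℂ) * z)) = (0 : ℕ) := by
          rw [order_eq_nat]
          refine ⟨?_, by simp⟩
          rw [LaurentSeries.powerSeriesPart_coeff, Nat.cast_zero, add_zero]
          exact HahnSeries.coeff_order_eq_zero.not.2 hne
        rw [h5]
        simp
      have hf0 : (f : ℂ⟦X⟧) ≠ 0 := by
        intro h0
        rw [h0, order_zero] at h4
        exact ENat.top_ne_natCast _ h4
      obtain ⟨b, hb, hgb⟩ := C.order_of_mem_localRing f.2 hf0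
      have hb' : topGen d n m - d * n = b := by
        rw [h4] at hb
        exact_mod_cast hb
      have h6 : (C.gen ((b : ℤ) : ZMod (d * n)) : ℤ) ≤ b := by
        rw [Int.cast_natCast]
        exact_mod_cast hgb
      rw [gen, semigroupGen_symm (b := 0) _ (by zify at hlt; omega)] at h6
      simp [semigroupGen_zero] at h6
    obtain ⟨b, rfl⟩ := Int.eq_ofNat_of_zero_le ha
    have h1 := eq_ofPowerSeries_of_order (z := HahnSeries.single (s : ℤ) (1 : ℂ) * z) (o := 0)
      (j := b) (by rw [ho, zero_add])
    have h2 : HahnSeries.single (0 : ℤ) (1 : ℂ) = 1 := rfl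
    rw [h2, one_mul] at h1
    have hw0 : X ^ b * LaurentSeries.powerSeriesPart (HahnSeries.single (s : ℤ) (1 : ℂ) * z) ≠ 0 := by
      intro h0
      rw [h0, map_zero] at h1
      exact hne h1
    obtain ⟨a, ha, hoa⟩ := h.order_mem _ ((C.mem_dual_iff h1).1 hz) hw0
    have h3 := order_ofPowerSeries hoa
    rw [← h1, ho] at h3
    rw [h3]
    exact ha
  · intro ha
    obtain ⟨b, rfl⟩ := Int.eq_ofNat_of_zero_le (hΔ a ha)
    obtain ⟨w, hw, hwb⟩ := h.exists_order b ha
    set z : ℂ⸨X⸩ := HahnSeries.single (-(s : ℤ)) 1 * HahnSeries.ofPowerSeries ℤ ℂ w with hz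
    have h1 : HahnSeries.single (s : ℤ) (1 : ℂ) * z = HahnSeries.ofPowerSeries ℤ ℂ w := by
      rw [hz, ← mul_assoc, HahnSeries.single_mul_single, add_neg_cancel, mul_one]
      exact one_mul _
    refine ⟨_, ⟨z, (C.mem_dual_iff h1).2 hw, h1.symm⟩, ?_, order_ofPowerSeries hwb⟩
    rw [Ne, map_eq_zero_iff _ HahnSeries.ofPowerSeries_injective]
    rintro rfl
    rw [order_zero] at hwb
    exact ENat.top_ne_natCast _ hwb

/-- Such an `r` is divisible by `t^s` times a power of `t` at the conductor of `R`, so `r w / t^s`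
lies in `R` for every power series `w`. -/
theorem mem_colon_of_coeff_eq_zero {s : ℕ} (M : Submodule ℂ ℂ⟦X⟧) (r : C.localRing)
    (hr : ∀ j, j + d * n ≤ s + topGen d n m → coeff j (r : ℂ⟦X⟧) = 0) : r ∈ C.colon s M := by
  have hlt := lt_topGen (d := d) C.one_lt_n C.n_lt_m
  intro w _
  obtain ⟨u, hu⟩ := X_pow_dvd_iff.2 fun j (hj : j < s + (topGen d n m - d * n) + 1) =>
    hr j (by omega)
  refine C.mem_shiftedRing.2 ⟨X ^ (topGen d n m - d * n + 1) * (u * w), ?_, ?_⟩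
  · rw [mem_localRing_iff]
    refine C.mem_genSpan_of_topGen_le fun j hj => ?_
    rw [coeff_X_pow_mul', if_neg (by omega)]
  · rw [hu]
    ring

/-! ## The pairing -/

/-- The map `r ↦ (Φ(r u_i))_i`. -/
def pairing {ι : Type*} (Φ : ℂ⟦X⟧ →ₗ[ℂ] ℂ) (u : ι → ℂ⟦X⟧) : C.localRing →ₗ[ℂ] (ι → ℂ) :=
  LinearMap.pi fun i => Φ ∘ₗ LinearMap.mulLeft ℂ (u i) ∘ₗ (Subalgebra.val C.localRing).toLinearMap

omit [NeZero d] [NeZero n] in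
theorem pairing_apply {ι : Type*} (Φ : ℂ⟦X⟧ →ₗ[ℂ] ℂ) (u : ι → ℂ⟦X⟧) (r : C.localRing) (i : ι) :
    C.pairing Φ u r i = Φ (u i * r) := rfl

/-- The residue pairing relative to `t^s R`. -/
structure IsDuality (s : ℕ) (Φ : ℂ⟦X⟧ →ₗ[ℂ] ℂ) : Prop where
  eq_zero : ∀ w ∈ C.shiftedRing s, Φ w = 0
  mem : ∀ w, (∀ r ∈ C.localRing, Φ (w * r) = 0) → w ∈ C.shiftedRing s

variable {C} {s : ℕ} {Φ : ℂ⟦X⟧ →ₗ[ℂ] ℂ} (hΦ : C.IsDuality s Φ)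
include hΦ

omit [NeZero d] [NeZero n] in
-- A functional that kills the range gives a combination of the `u i` orthogonal to `R`, hence an
-- element of `t^s R`.
theorem IsDuality.pairing_surjective {ι : Type*} [Fintype ι] {u : ι → ℂ⟦X⟧}
    (hu : ∀ c : ι → ℂ, ∑ i, c i • u i ∈ C.shiftedRing s → c = 0) :
    Function.Surjective (C.pairing Φ u) := by
  classical
  rw [← LinearMap.range_eq_top]
  by_contra hne
  obtain ⟨f, hf0, hf⟩ := Submodule.exists_le_ker_of_lt_top _ (lt_top_iff_ne_top.2 hne)
  apply hf0
  have h1 : (fun i => f (Pi.single i 1)) = 0 := by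
    refine hu _ (hΦ.mem _ fun r hr => ?_)
    have h2 := hf (LinearMap.mem_range_self (C.pairing Φ u) ⟨r, hr⟩)
    rw [LinearMap.mem_ker, LinearMap.pi_apply_eq_sum_univ f] at h2
    rw [← h2, sum_mul, map_sum]
    refine sum_congr rfl fun i _ => ?_
    rw [smul_mul_assoc, map_smul, pairing_apply, smul_eq_mul, smul_eq_mul, mul_comm]
    congr 2
    funext j
    simp [Pi.single_apply, eq_comm]
  refine LinearMap.ext fun x => ?_
  rw [LinearMap.pi_apply_eq_sum_univ f, LinearMap.zero_apply]
  refine sum_eq_zero fun i _ => ?_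
  have h3 := congrFun h1 i
  have h4 : (fun j => if i = j then (1 : ℂ) else 0) = Pi.single i 1 := by
    funext j
    simp [Pi.single_apply, eq_comm]
  rw [h4, h3]
  simp

/-- Elements of `R` dual to the monomials outside of `t^s R`. -/
theorem IsDuality.exists_dual_basis : ∃ ρ : ℕ → C.localRing, ∀ g ∉ C.shiftedOrders s,
    ∀ u : ℂ⟦X⟧, (∀ a ∈ C.shiftedOrders s, coeff a u = 0) → Φ (u * ρ g) = coeff g u := by
  classical
  have hS := C.hasOrders_shiftedRing s
  let G := hS.finite_compl.toFinset
  have hG : ∀ g, g ∈ G ↔ g ∉ C.shiftedOrders s := by simp [G]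
  have hcoeff : ∀ (c : G → ℂ) (j : ℕ), coeff j (∑ g : G, c g • (X : ℂ⟦X⟧) ^ (g : ℕ)) =
      if hj : j ∈ G then c ⟨j, hj⟩ else 0 := by
    intro c j
    simp only [map_sum, coeff_smul, coeff_X_pow, smul_eq_mul, mul_ite, mul_one, mul_zero]
    split_ifs with hj
    · rw [sum_eq_single ⟨j, hj⟩]
      · simp
      · intro g _ hg
        rw [if_neg]
        rintro rfl
        exact hg rfl
      · simp
    · refine sum_eq_zero fun g _ => if_neg ?_
      rintro rfl
      exact hj g.2
  have hsurj := hΦ.pairing_surjective (u := fun g : G => (X : ℂ⟦X⟧) ^ (g : ℕ)) fun c hc => by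
    have h0 := hS.eq_zero hc fun a ha => by
      rw [hcoeff, dif_neg fun h => (hG a).1 h ha]
    ext g
    have := hcoeff c g
    rw [h0, dif_pos g.2] at this
    simpa using this.symm
  -- For `g` not a gap of `s + Γ` the prescribed vector is zero; these values of `ρ` are never used.
  choose ρ hρ using fun g : ℕ => hsurj fun h => if (h : ℕ) = g then 1 else 0
  refine ⟨ρ, fun g hg u hu => ?_⟩
  have hu' : u = ∑ h : G, coeff (h : ℕ) u • (X : ℂ⟦X⟧) ^ (h : ℕ) := by
    ext j
    rw [hcoeff fun h => coeff (h : ℕ) u]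
    split_ifs with hj
    · rfl
    · exact hu j (not_not.1 fun h => hj ((hG j).2 h))
  conv_lhs => rw [hu']
  rw [sum_mul, map_sum, sum_eq_single ⟨g, (hG g).2 hg⟩]
  · have h1 := congrFun (hρ g) ⟨g, (hG g).2 hg⟩
    rw [pairing_apply] at h1
    rw [smul_mul_assoc, map_smul, h1]
    simp
  · intro h _ hne
    have h1 := congrFun (hρ g) h
    rw [pairing_apply, if_neg fun h' => hne (Subtype.ext h')] at h1
    rw [smul_mul_assoc, map_smul, h1, smul_zero]
  · simp

end GenericBranch

end

end

section

open Finset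
open scoped PowerSeries LaurentSeries

noncomputable section

/-! ## Coordinates on the cells -/

theorem IsPolyFun.det {σ ι : Type*} [Fintype ι] [DecidableEq ι] {M : (σ → ℂ) → Matrix ι ι ℂ}
    (hM : ∀ i j, IsPolyFun fun x => M x i j) : IsPolyFun fun x => (M x).det := by
  simp only [Matrix.det_apply']
  exact IsPolyFun.sum _ fun g _ => (IsPolyFun.const _).mul (IsPolyFun.prod _ fun i _ => hM _ _)

namespace GenericBranch

variable {d n m : ℕ} (C : GenericBranch d n m) [NeZero d] [NeZero n]

open PowerSeries

/-- The generators `α` of `Δ ∋ s`, and the elements `β` of `Δ` outside of `s + Γ`. -/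
structure CellData (α : ZMod (d * n) → ℕ) (s τ : ℕ) (β : Fin τ → ℕ) : Prop where
  natCast : ∀ k, ((α k : ℕ) : ZMod (d * n)) = k
  genData : GenData d n m fun k => (α k : ℤ)
  le : α s ≤ s
  shiftedOrders_subset : C.shiftedOrders s ⊆ genOrders α
  injective : Function.Injective β
  range_eq : Set.range β = genOrders α \ C.shiftedOrders s

/-- The coefficients of `y`, starting with the first nonzero one. -/
def yCoeff (j : ℕ) : ℂ := coeff (d * m + j) C.y

/-- The coordinates of the modules `t^s I⁻¹`. -/
abbrev moduleSet (α : ZMod (d * n) → ℕ) (s : ℕ) : Set (ℕ × ZMod (d * n) → ℂ) :=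
  solutionSet m (fun k => (α k : ℤ)) C.yCoeff s

variable {C} {α : ZMod (d * n) → ℕ} {s τ : ℕ} {β : Fin τ → ℕ} (h : C.CellData α s τ β)
  {v : ℕ × ZMod (d * n) → ℂ}

section

include h

theorem CellData.mem_genOrders (i : Fin τ) : β i ∈ genOrders α := by
  have := h.range_eq ▸ Set.mem_range_self i
  exact this.1

theorem CellData.notMem_shiftedOrders (i : Fin τ) : β i ∉ C.shiftedOrders s := by
  have := h.range_eq ▸ Set.mem_range_self i
  exact this.2

theorem CellData.y_mul_mem (hv : v ∈ C.moduleSet α s) {w : ℂ⟦X⟧} (hw : w ∈ genModule α v) :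
    C.y * w ∈ genModule α v :=
  mul_mem_genSpan (fun k => (mul_genSeries_mem_iff h.natCast C.coeff_of_lt v k).2
    fun l hl => hv.2.1 l k hl) hw

theorem CellData.mul_mem (hv : v ∈ C.moduleSet α s) {r w : ℂ⟦X⟧} (hr : r ∈ C.localRing)
    (hw : w ∈ genModule α v) : r * w ∈ genModule α v :=
  C.mul_mem_of_stable (fun g _ hw => expand_mul_mem_genSpan hw g)
    (fun _ hw => h.y_mul_mem hv hw) hr hw

theorem CellData.shiftedRing_le (hv : v ∈ C.moduleSet α s) : C.shiftedRing s ≤ genModule α v := by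
  intro w hw
  obtain ⟨r, hr, rfl⟩ := C.mem_shiftedRing.1 hw
  have hX := (X_pow_mem_iff h.natCast v s).2 fun l hl => by simpa using hv.2.2 l hl
  have h1 := h.mul_mem hv hr hX
  rwa [mul_comm r] at h1

/-- The series `t^{β_i} + …` span the module modulo `t^s R`. -/
theorem CellData.exists_sub_mem (hv : v ∈ C.moduleSet α s) {w : ℂ⟦X⟧} (hw : w ∈ genModule α v) :
    ∃ c : Fin τ → ℂ, w - ∑ i, c i • genSeries v (β i) ∈ C.shiftedRing s := by
  have hM := hasOrders_genModule h.natCast v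
  have hS := C.hasOrders_shiftedRing s
  set M' := C.shiftedRing s ⊔ Submodule.span ℂ (Set.range fun i => genSeries v (β i)) with hM'
  have hle : M' ≤ genModule α v := by
    refine sup_le (h.shiftedRing_le hv) (Submodule.span_le.2 ?_)
    rintro _ ⟨i, rfl⟩
    exact genSeries_mem_genModule h.natCast v (h.mem_genOrders i)
  have hord : HasOrders M' (genOrders α) := by
    refine ⟨fun w hw => hM.order_mem w (hle hw), fun a ha => ?_, ?_⟩
    · by_cases haS : a ∈ C.shiftedOrders s
      · obtain ⟨w, hw, hwa⟩ := hS.exists_order a haS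
        exact ⟨w, Submodule.mem_sup_left hw, hwa⟩
      · obtain ⟨i, rfl⟩ : a ∈ Set.range β := h.range_eq ▸ ⟨ha, haS⟩
        exact ⟨_, Submodule.mem_sup_right (Submodule.subset_span ⟨i, rfl⟩), order_genSeries v _⟩
    · obtain ⟨N, hN⟩ := hS.isOpen
      exact ⟨N, fun w hw => Submodule.mem_sup_left (hN w hw)⟩
  rw [← hord.eq_of_le hM hle, hM', Submodule.mem_sup] at hw
  obtain ⟨x, hx, y, hy, rfl⟩ := hw
  obtain ⟨c, rfl⟩ := (Submodule.mem_span_range_iff_exists_fun ℂ).1 hy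
  exact ⟨c, by rwa [add_sub_cancel_right]⟩

/-- A nonzero combination would have one of the pairwise distinct orders `β i`, none of which is an
order of `t^s R`. -/
theorem CellData.eq_zero_of_sum_mem {c : Fin τ → ℂ}
    (hc : ∑ i, c i • genSeries v (β i) ∈ C.shiftedRing s) : c = 0 := by
  classical
  by_contra hne
  have hnon : (univ.filter fun i => c i ≠ 0).Nonempty := by
    by_contra h0
    rw [not_nonempty_iff_eq_empty, filter_eq_empty_iff] at h0
    exact hne (funext fun i => not_not.1 (h0 (mem_univ i)))
  obtain ⟨i₀, hi₀, hmin⟩ := exists_min_image _ β hnon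
  have ho : order (∑ i, c i • genSeries v (β i)) = β i₀ := by
    rw [order_eq_nat]
    constructor
    · rw [map_sum, sum_eq_single i₀]
      · rw [coeff_smul, coeff_genSeries_self, smul_eq_mul, mul_one]
        exact (mem_filter.1 hi₀).2
      · intro i _ hi
        by_cases hci : c i = 0
        · rw [hci, zero_smul, map_zero]
        · rw [coeff_smul, coeff_genSeries_of_lt, smul_zero]
          exact lt_of_le_of_ne (hmin i (mem_filter.2 ⟨mem_univ _, hci⟩))
            fun h' => hi (h.injective h').symm
      · simp
    · intro j hj
      rw [map_sum]
      refine sum_eq_zero fun i _ => ?_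
      by_cases hci : c i = 0
      · rw [hci, zero_smul, map_zero]
      · rw [coeff_smul, coeff_genSeries_of_lt, smul_zero]
        exact lt_of_lt_of_le hj (hmin i (mem_filter.2 ⟨mem_univ _, hci⟩))
  have h0 : ∑ i, c i • genSeries v (β i) ≠ 0 := by
    intro h0
    rw [h0, order_zero] at ho
    exact ENat.top_ne_natCast _ ho
  obtain ⟨a, ha, hoa⟩ := (C.hasOrders_shiftedRing s).order_mem _ hc h0
  rw [ho] at hoa
  exact h.notMem_shiftedOrders i₀ ((by exact_mod_cast hoa : β i₀ = a) ▸ ha)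

variable {Φ : ℂ⟦X⟧ →ₗ[ℂ] ℂ} (hΦ : C.IsDuality s Φ)
include hΦ

theorem CellData.pairing_surjective (v : ℕ × ZMod (d * n) → ℂ) :
    Function.Surjective (C.pairing Φ fun i => genSeries v (β i)) :=
  hΦ.pairing_surjective fun _ hc => h.eq_zero_of_sum_mem hc

/-- As `M` is an `R`-module, `r M ⊆ t^s R` is equivalent to `Φ(r M) = 0` by nondegeneracy. This can
be tested on the series `t^{β_i} + …`, which span `M` modulo `t^s R`. -/
theorem CellData.ker_pairing (hv : v ∈ C.moduleSet α s) :
    LinearMap.ker (C.pairing Φ fun i => genSeries v (β i)) =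
      (C.colon s (genModule α v)).restrictScalars ℂ := by
  ext r
  rw [LinearMap.mem_ker, Submodule.restrictScalars_mem, mem_colon]
  constructor
  · intro hr
    have h1 : ∀ w ∈ genModule α v, Φ (w * r) = 0 := by
      intro w hw
      obtain ⟨c, hc⟩ := h.exists_sub_mem hv hw
      have h2 := hΦ.eq_zero _ (C.mul_mem_shiftedRing r.2 hc)
      rw [mul_comm, sub_mul, map_sub, sub_eq_zero, sum_mul, map_sum] at h2
      rw [h2]
      refine sum_eq_zero fun i _ => ?_
      rw [smul_mul_assoc, map_smul]
      have h3 := congrFun hr i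
      rw [pairing_apply] at h3
      rw [h3]
      simp
    intro w hw
    refine hΦ.mem _ fun r' hr' => ?_
    rw [mul_assoc, mul_comm]
    rw [mul_comm w r']
    exact h1 _ (h.mul_mem hv hr' hw)
  · intro hr
    funext i
    rw [pairing_apply, mul_comm]
    exact hΦ.eq_zero _ (hr _ (genSeries_mem_genModule h.natCast v (h.mem_genOrders i)))

/-- Biduality. If `w` multiplies the colon ideal into `t^s R`, then `Φ(w ·)` vanishes on the kernel
of the pairing, so it is a combination of the functionals `Φ(f_{β_i} ·)`. By nondegeneracy `w`
agrees with this combination of the `f_{β_i}` modulo `t^s R`. -/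
theorem CellData.dualModule_colon (hv : v ∈ C.moduleSet α s) :
    C.dualModule s (C.colon s (genModule α v)) = genModule α v := by
  refine le_antisymm (fun w hw => ?_) fun w hw r hr => hr w hw
  have hle : LinearMap.ker (C.pairing Φ fun i => genSeries v (β i)) ≤
      LinearMap.ker (Φ ∘ₗ LinearMap.mulLeft ℂ w ∘ₗ (Subalgebra.val C.localRing).toLinearMap) := by
    intro r hr
    rw [h.ker_pairing hΦ hv] at hr
    rw [LinearMap.mem_ker]
    change Φ (w * r) = 0
    rw [mul_comm]
    exact hΦ.eq_zero _ (hw r hr)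
  have hspan := mem_span_of_iInf_ker_le_ker
    (L := fun i => LinearMap.proj i ∘ₗ C.pairing Φ fun i => genSeries v (β i)) (fun r hr => hle (by
      rw [Submodule.mem_iInf] at hr
      exact funext hr))
  obtain ⟨c, hc⟩ := (Submodule.mem_span_range_iff_exists_fun ℂ).1 hspan
  have hc' : ∀ r : C.localRing, Φ (w * r) = ∑ i, c i * Φ (genSeries v (β i) * r) := by
    intro r
    have := LinearMap.congr_fun hc r
    rw [LinearMap.sum_apply] at this
    exact this.symm
  have h1 : w - ∑ i, c i • genSeries v (β i) ∈ C.shiftedRing s := by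
    refine hΦ.mem _ fun r hr => ?_
    rw [sub_mul, map_sub, hc' ⟨r, hr⟩, sum_mul, map_sum, sub_eq_zero]
    exact sum_congr rfl fun i _ => by rw [smul_mul_assoc, map_smul, smul_eq_mul]
  have h2 := Submodule.add_mem _ (h.shiftedRing_le hv h1)
    (Submodule.sum_mem _ fun i (_ : i ∈ univ) => Submodule.smul_mem _ (c i)
      (genSeries_mem_genModule h.natCast v (h.mem_genOrders i)))
  rwa [sub_add_cancel] at h2

/-- The framing of `R / I`. -/
def CellData.framing (v : ℕ × ZMod (d * n) → ℂ) : FramedQuotient C.localRing τ :=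
  ⟨C.pairing Φ fun i => genSeries v (β i), h.pairing_surjective hΦ v⟩

theorem CellData.finite_and_finrank (hv : v ∈ C.moduleSet α s) :
    Module.Finite ℂ (C.localRing ⧸ (C.colon s (genModule α v)).restrictScalars ℂ) ∧
    Module.finrank ℂ (C.localRing ⧸ (C.colon s (genModule α v)).restrictScalars ℂ) = τ := by
  rw [← h.ker_pairing hΦ hv]
  exact ⟨(h.framing hΦ v).toGrassmannian.finite_quotient, by
    rw [((C.pairing Φ fun i => genSeries v (β i)).quotKerEquivOfSurjective
      (h.pairing_surjective hΦ v)).finrank_eq]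
    simp⟩

/-- The ideal with given coordinates. -/
def CellData.toHilb (v : C.moduleSet α s) : C.Hilb τ :=
  ⟨C.colon s (genModule α v.1), h.finite_and_finrank hΦ v.2⟩

theorem CellData.framing_toGrassmannian (v : C.moduleSet α s) :
    (h.framing hΦ v.1).toGrassmannian =
      grassmannianMk τ ((h.toHilb hΦ v).1.restrictScalars ℂ) (h.toHilb hΦ v).2.1
        (h.toHilb hΦ v).2.2 :=
  Module.Grassmannian.ext (h.ker_pairing hΦ v.2)

theorem CellData.toHilb_mem_cell {Δ : Set ℤ} (hΔ : ∀ b ∈ Δ, 0 ≤ b)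
    (hΔα : {a : ℕ | (a : ℤ) ∈ Δ} = genOrders α) (hs : (s : ℤ) = τ - C.e Δ)
    (v : C.moduleSet α s) : h.toHilb hΦ v ∈ C.cell Δ τ := by
  refine C.mem_cell hs hΔ ?_ fun r hr => C.mem_colon_of_coeff_eq_zero _ r hr
  change HasOrders (C.dualModule s (C.colon s (genModule α v.1))) _
  rw [h.dualModule_colon hΦ v.2, hΔα]
  exact hasOrders_genModule h.natCast _

theorem CellData.toHilb_injective : Function.Injective (h.toHilb hΦ) := by
  intro v v' hvv'
  have h1 : C.colon s (genModule α v.1) = C.colon s (genModule α v'.1) := congrArg Subtype.val hvv'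
  refine Subtype.ext (genSeries_injective h.natCast v.2.1 v'.2.1 ?_)
  rw [← h.dualModule_colon hΦ v.2, h1, h.dualModule_colon hΦ v'.2]

/-- The reduced generators of `M = t^s I⁻¹ ∩ ℂ⟦t⟧` provide the coordinates. The ideal `I` is
contained in the colon ideal of `M`, and both have colength `τ`, so they coincide. -/
theorem CellData.exists_toHilb_eq {Δ : Set ℤ} 
    (hΔα : {a : ℕ | (a : ℤ) ∈ Δ} = genOrders α) (hs : (s : ℤ) = τ - C.e Δ) {I : C.Hilb τ}
    (hI : I ∈ C.cell Δ τ) : ∃ v, h.toHilb hΦ v = I := by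
  classical
  have hM := C.hasOrders_dualModule hs hI
  rw [hΔα] at hM
  set M := C.dualModule s I.1 with hMdef
  choose f hf hf1 hflow hf0 using fun k => hM.exists_reduced (gen_mem_genOrders h.natCast k)
  let v : ℕ × ZMod (d * n) → ℂ := fun lk =>
    if 1 ≤ lk.1 ∧ IsVar (fun k => (α k : ℤ)) lk.1 lk.2 then coeff (α lk.2 + lk.1) (f lk.2) else 0
  have hfv : ∀ k, genSeries v (α k) = f k := by
    intro k
    ext j
    rcases lt_or_ge j (α k) with hj | hj
    · rw [coeff_genSeries_of_lt v hj, hflow k j hj]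
    · obtain ⟨l, rfl⟩ := Nat.exists_eq_add_of_le hj
      rw [coeff_genSeries_add, h.natCast]
      rcases Nat.eq_zero_or_pos l with rfl | hl
      · rw [genCoeff_zero, add_zero, hf1]
      · rw [genCoeff_of_pos _ hl.ne']
        by_cases hvar : IsVar (fun k => (α k : ℤ)) l k
        · simp only [v]
          rw [if_pos ⟨hl, hvar⟩]
        · simp only [v]
          rw [if_neg fun h' => hvar h'.2, hf0 k _ (by omega)]
          by_contra hmem
          exact hvar ((notMem_genOrders_iff h.natCast).1 hmem)
  have hle : genModule α v ≤ M := by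
    intro w hw
    obtain ⟨g, rfl⟩ := mem_genSpan.1 hw
    refine Submodule.sum_mem _ fun k _ => ?_
    rw [hfv]
    exact C.mul_mem_dualModule (C.expand_mem_localRing _) (hf k)
  have heq : genModule α v = M := (hasOrders_genModule h.natCast v).eq_of_le hM hle
  have hv : v ∈ C.moduleSet α s := by
    refine ⟨fun l k hlk => if_neg hlk, fun l k => ?_, fun l hl => ?_⟩
    · refine (mul_genSeries_mem_iff h.natCast C.coeff_of_lt v k).1 ?_ l
      rw [heq, hfv]
      exact C.mul_mem_dualModule C.y_mem_localRing (hf k)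
    · have := (X_pow_mem_iff h.natCast v s).1 (heq ▸ C.shiftedRing_le_dualModule s I.1
        (C.mem_shiftedRing.2 ⟨1, Subalgebra.one_mem _, mul_one _⟩)) l hl
      simpa using this
  refine ⟨⟨v, hv⟩, Subtype.ext ?_⟩
  change C.colon s (genModule α v) = I.1
  have hIle : I.1 ≤ C.colon s (genModule α v) := by
    intro r hr w hw
    rw [heq] at hw
    exact hw r hr
  obtain ⟨hfin, hrank⟩ := h.finite_and_finrank hΦ hv
  have hfinI := I.2.1
  have hrankI := I.2.2
  have hle' : I.1.restrictScalars ℂ ≤ (C.colon s (genModule α v)).restrictScalars ℂ := hIle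
  have hinj := (LinearMap.injective_iff_surjective_of_finrank_eq_finrank
    (hrankI.trans hrank.symm)).2 (Submodule.factor_surjective hle')
  refine le_antisymm (fun r hr => ?_) hIle
  have h1 : Submodule.factor hle' (Submodule.Quotient.mk r) = 0 :=
    (Submodule.Quotient.mk_eq_zero _).2 hr
  exact (Submodule.Quotient.mk_eq_zero (I.1.restrictScalars ℂ)).1
    (hinj (h1.trans (map_zero _).symm))

end

end GenericBranch

end

end

section

open Finset
open scoped PowerSeries LaurentSeries

noncomputable section

/-! ## The dimension of the cells -/

namespace GenericBranch

variable {d n m : ℕ} {C : GenericBranch d n m} [NeZero d] [NeZero n]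

open PowerSeries

theorem genSeries_eq_sum {q : ℕ} {v : ℕ × ZMod q → ℂ} {L : ℕ} (hv : ∀ l k, L < l → v (l, k) = 0)
    (a : ℕ) : genSeries v a = X ^ a + ∑ l ∈ Icc 1 L, v (l, (a : ZMod q)) • (X : ℂ⟦X⟧) ^ (a + l) := by
  ext j
  rw [map_add, map_sum]
  simp only [coeff_smul, coeff_X_pow, smul_eq_mul, mul_ite, mul_one, mul_zero]
  rcases lt_or_ge j a with hj | hj
  · rw [coeff_genSeries_of_lt v hj, if_neg hj.ne, zero_add, sum_eq_zero]
    intro l _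
    rw [if_neg (by omega)]
  · obtain ⟨l, rfl⟩ := Nat.exists_eq_add_of_le hj
    rw [coeff_genSeries_add]
    rcases Nat.eq_zero_or_pos l with rfl | hl
    · rw [genCoeff_zero, if_pos (by omega), sum_eq_zero, add_zero]
      intro l hl
      rw [mem_Icc] at hl
      rw [if_neg (by omega)]
    · rw [genCoeff_of_pos _ hl.ne', if_neg (by omega), zero_add]
      by_cases hlL : l ≤ L
      · rw [sum_eq_single l]
        · simp
        · intro l' _ hl'
          rw [if_neg (by omega)]
        · intro hl'
          rw [mem_Icc] at hl'
          omega
      · rw [hv l _ (by omega), sum_eq_zero]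
        intro l' hl'
        rw [mem_Icc] at hl'
        rw [if_neg (by omega)]

theorem isVar_le_sup {q : ℕ} [NeZero q] {α : ZMod q → ℕ} {l : ℕ} {k : ZMod q}
    (hl : IsVar (fun k => (α k : ℤ)) l k) : l ≤ univ.sup α := by
  have h1 : α (k + l) ≤ univ.sup α := le_sup (mem_univ _)
  rw [IsVar] at hl
  omega

variable {α : ZMod (d * n) → ℕ} {s τ : ℕ} {β : Fin τ → ℕ} (h : C.CellData α s τ β)
  {Φ : ℂ⟦X⟧ →ₗ[ℂ] ℂ} (hΦ : C.IsDuality s Φ)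
include h hΦ

/-- The orders `l` of unknowns are bounded, so each series `t^{β_i} + …` is a finite sum and its
pairing with a fixed element of `R` is polynomial in the coordinates. -/
theorem CellData.continuous_framing :
    Continuous fun v : zariskiSet (C.moduleSet α s) => h.framing hΦ v.1 := by
  rw [FramedQuotient.continuous_iff]
  let P : (ℕ × ZMod (d * n) → ℂ) → C.localRing × Fin τ → ℂ := fun v ri =>
    Φ (X ^ β ri.2 * (ri.1 : ℂ⟦X⟧)) + ∑ l ∈ Icc 1 (univ.sup α),
      v (l, (β ri.2 : ZMod (d * n))) * Φ (X ^ (β ri.2 + l) * (ri.1 : ℂ⟦X⟧))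
  have hP : ∀ ri, IsPolyFun fun v => P v ri := fun ri =>
    (IsPolyFun.const _).add (IsPolyFun.sum _ fun l _ =>
      (IsPolyFun.coord _).mul (IsPolyFun.const _))
  have hcont := (ZariskiSpace.continuous_of_isPolyFun hP).comp
    (continuous_subtype_val (p := fun v => v ∈ zariskiSet (C.moduleSet α s)))
  refine hcont.congr fun v => ?_
  funext ri
  change P v.1 ri = Φ (genSeries v.1 (β ri.2) * ri.1)
  rw [genSeries_eq_sum (L := univ.sup α) fun l k hl => v.2.1 l k fun hlk => by
    have := isVar_le_sup hlk.2
    omega]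
  rw [add_mul, sum_mul, map_add, map_sum]
  simp only [smul_mul_assoc, map_smul, smul_eq_mul, P]

theorem CellData.continuous_toHilb :
    Continuous (X := zariskiSet (C.moduleSet α s)) (h.toHilb hΦ) := by
  refine continuous_induced_rng.2 ?_
  refine (FramedQuotient.continuous_toGrassmannian.comp (h.continuous_framing hΦ)).congr fun v => ?_
  exact h.framing_toGrassmannian hΦ v

/-- The coordinates of a module are regular functions of the framings of the ideal. -/
theorem CellData.continuous_of_toHilb {T : Type*} [TopologicalSpace T] {I : T → C.Hilb τ}
    (hI : Continuous I) {θ : T → zariskiSet (C.moduleSet α s)}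
    (hθ : ∀ t, h.toHilb hΦ (θ t) = I t) : Continuous θ := by
  classical
  refine Continuous.subtype_mk (f := fun t => (θ t).1) ?_ fun t => (θ t).2
  obtain ⟨ρ, hρ⟩ := hΦ.exists_dual_basis
  -- `P` is the matrix of a framing on the dual elements `ρ (β j)`; its determinant is the common
  -- denominator. The vector `cr g` contains the Cramer numerators that express the image of `ρ g`
  -- through the images of the `ρ (β j)`.
  let P : (C.localRing × Fin τ → ℂ) → Matrix (Fin τ) (Fin τ) ℂ :=
    fun x => Matrix.of fun i j => x (ρ (β j), i)
  have hP : ∀ i j, IsPolyFun fun x => P x i j := fun i j => IsPolyFun.coord _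
  let cr : ℕ → (C.localRing × Fin τ → ℂ) → Fin τ → ℂ :=
    fun g x => (P x).cramer fun i => x (ρ g, i)
  have hcr : ∀ g j, IsPolyFun fun x => cr g x j := by
    intro g j
    simp only [cr, Matrix.cramer_apply]
    refine IsPolyFun.det fun i j' => ?_
    simp only [Matrix.updateCol_apply]
    split_ifs
    · exact IsPolyFun.coord _
    · exact hP i j'
  let N : ℕ × ZMod (d * n) → (C.localRing × Fin τ → ℂ) → ℂ := fun lk x =>
    if 1 ≤ lk.1 ∧ IsVar (fun k => (α k : ℤ)) lk.1 lk.2 then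
      ∑ j, cr (α lk.2 + lk.1) x j * Φ (X ^ α lk.2 * (ρ (β j) : ℂ⟦X⟧)) -
        (P x).det * Φ (X ^ α lk.2 * (ρ (α lk.2 + lk.1) : ℂ⟦X⟧)) else 0
  have hN : ∀ lk, IsPolyFun (N lk) := by
    intro lk
    simp only [N]
    split_ifs
    · exact (IsPolyFun.sum _ fun j _ => (hcr _ j).mul (IsPolyFun.const _)).sub
        ((IsPolyFun.det hP).mul (IsPolyFun.const _))
    · exact IsPolyFun.const 0
  have hι := (continuous_induced_dom (t := grassmannianTopology C.localRing τ)
    (f := fun I : C.Hilb τ => grassmannianMk τ (I.1.restrictScalars ℂ) I.2.1 I.2.2)).comp hI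
  have hmk : ∀ t, (h.framing hΦ (θ t).1).toGrassmannian =
      grassmannianMk τ ((I t).1.restrictScalars ℂ) (I t).2.1 (I t).2.2 := by
    intro t
    rw [← hθ t]
    exact h.framing_toGrassmannian hΦ _
  refine FramedQuotient.continuous_of_entries hι (Dt := fun x => (P x).det) (N := N)
    (IsPolyFun.det hP) hN (fun t => ⟨_, hmk t⟩) fun t q hq => ?_
  rw [Function.comp_apply, ← hmk t, FramedQuotient.toGrassmannian_eq_iff] at hq
  suffices key : ∀ v : ℕ × ZMod (d * n) → ℂ, v ∈ C.moduleSet α s →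
      LinearMap.ker q.1 = LinearMap.ker (h.framing hΦ v).1 →
      (P q.entries).det ≠ 0 ∧ ∀ i, v i * (P q.entries).det = N i q.entries from key _ (θ t).2 hq
  clear hq
  intro v hv hq
  have hker : ∀ r : C.localRing, q.1 r = 0 → ∀ w ∈ genModule α v, Φ (w * r) = 0 := by
    intro r hr w hw
    have h1 : r ∈ LinearMap.ker (h.framing hΦ v).1 := hq ▸ hr
    have h2 : r ∈ LinearMap.ker (C.pairing Φ fun i => genSeries v (β i)) := h1
    rw [h.ker_pairing hΦ hv] at h2
    rw [mul_comm]
    exact hΦ.eq_zero _ (h2 w hw)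
  have hmul : ∀ (c : Fin τ → ℂ), (P q.entries).mulVec c = q.1 (∑ j, c j • ρ (β j)) := by
    intro c
    ext i
    rw [map_sum, Finset.sum_apply, Matrix.mulVec, dotProduct]
    refine sum_congr rfl fun j _ => ?_
    rw [map_smul, Pi.smul_apply, smul_eq_mul, mul_comm]
    rfl
  constructor
  -- If `∑ c_j ρ(β_j)` lies in the ideal, pairing it with the element of the module with leading
  -- term `t^{β_i}` and no other exponent in `Δ` returns `c_i`.
  · intro hdet
    obtain ⟨c, hc0, hc⟩ := Matrix.exists_mulVec_eq_zero_iff.2 hdet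
    apply hc0
    rw [hmul] at hc
    funext i
    have hA := hasOrders_genModule h.natCast v
    obtain ⟨w, hw, hw1, -, hw0⟩ := hA.exists_reduced (h.mem_genOrders i)
    have h1 := hker _ hc w hw
    have hwS : ∀ a ∈ C.shiftedOrders s, coeff a w = 0 := fun a ha =>
      hw0 a (fun h' => h.notMem_shiftedOrders i (h' ▸ ha)) (h.shiftedOrders_subset ha)
    rw [AddSubmonoidClass.coe_finsetSum, mul_sum, map_sum, sum_eq_single i] at h1
    · rw [Subalgebra.coe_smul, mul_smul_comm, map_smul, hρ _ (h.notMem_shiftedOrders i) w hwS, hw1,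
        smul_eq_mul, mul_one] at h1
      exact h1
    · intro j _ hj
      rw [Subalgebra.coe_smul, mul_smul_comm, map_smul, hρ _ (h.notMem_shiftedOrders j) w hwS,
        hw0 _ (fun h' => hj (h.injective h')) (h.mem_genOrders j), smul_zero]
    · simp
  · rintro ⟨l, k⟩
    by_cases hlk : 1 ≤ l ∧ IsVar (fun k => (α k : ℤ)) l k
    swap
    · simp only [N]
      rw [if_neg hlk]
      have : v (l, k) = 0 := hv.1 l k hlk
      change v (l, k) * _ = 0
      rw [this, zero_mul]
    simp only [N]
    rw [if_pos hlk]
    set g := α k + l with hg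
    have hgA : g ∉ genOrders α := (notMem_genOrders_iff h.natCast).2 hlk.2
    have hgS : g ∉ C.shiftedOrders s := fun h' => hgA (h.shiftedOrders_subset h')
    set u := genSeries v (α k) - X ^ α k with hu
    have hcu : ∀ a ∈ genOrders α, coeff a u = 0 := by
      intro a ha
      rcases lt_or_ge a (α k) with hak | hak
      · rw [hu, map_sub, coeff_genSeries_of_lt v hak, coeff_X_pow, if_neg hak.ne, sub_zero]
      · obtain ⟨j, rfl⟩ := Nat.exists_eq_add_of_le hak
        rw [hu, map_sub, coeff_genSeries_add, h.natCast, coeff_X_pow]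
        rcases Nat.eq_zero_or_pos j with rfl | hj
        · simp
        · rw [if_neg (by omega), sub_zero, genCoeff_of_pos _ hj.ne']
          exact hv.1 j k fun hjk => (notMem_genOrders_iff h.natCast).2 hjk.2 ha
    have hcg : coeff g u = v (l, k) := by
      rw [hu, map_sub, hg, coeff_genSeries_add, h.natCast, coeff_X_pow, if_neg (by omega), sub_zero,
        genCoeff_of_pos _ (by omega)]
    have hΦu : ∀ a ∉ C.shiftedOrders s,
        Φ (genSeries v (α k) * (ρ a : ℂ⟦X⟧)) = Φ (X ^ α k * (ρ a : ℂ⟦X⟧)) + coeff a u := by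
      intro a ha
      rw [← hρ a ha u fun b hb => hcu b (h.shiftedOrders_subset hb), ← map_add, ← add_mul, hu,
        add_sub_cancel]
    -- This combination lies in the ideal, so it pairs to zero with `f_k`. The elements `ρ (β j)`
    -- only see the term `t^{α_k}`, because `f_k - t^{α_k}` has no exponent in `Δ`; only `ρ g` sees
    -- `v (l, k)`, which can therefore be isolated.
    have hq0 : q.1 ((P q.entries).det • ρ g - ∑ j, cr g q.entries j • ρ (β j)) = 0 := by
      rw [map_sub, ← hmul, map_smul, sub_eq_zero]
      simp only [cr]
      rw [Matrix.mulVec_cramer]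
      rfl
    have h1 := hker _ hq0 _ (genSeries_mem_genModule h.natCast v (gen_mem_genOrders h.natCast k))
    rw [Subalgebra.coe_sub, Subalgebra.coe_smul, AddSubmonoidClass.coe_finsetSum, mul_sub,
      mul_smul_comm, mul_sum, map_sub, map_smul, map_sum, hΦu g hgS, hcg, sub_eq_zero,
      smul_eq_mul] at h1
    have h2 : ∀ j, Φ (genSeries v (α k) * ((cr g q.entries j • ρ (β j) : C.localRing) : ℂ⟦X⟧)) =
        cr g q.entries j * Φ (X ^ α k * (ρ (β j) : ℂ⟦X⟧)) := by
      intro j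
      rw [Subalgebra.coe_smul, mul_smul_comm, map_smul, hΦu _ (h.notMem_shiftedOrders j),
        hcu _ (h.mem_genOrders j), add_zero, smul_eq_mul]
    simp only [h2] at h1
    change v (l, k) * (P q.entries).det = _
    rw [← h1]
    ring

omit hΦ in
theorem CellData.topologicalKrullDim_cell {Δ : Set ℤ} (hΔ : ∀ b ∈ Δ, 0 ≤ b)
    (hΔα : {a : ℕ | (a : ℤ) ∈ Δ} = genOrders α) (hs : (s : ℤ) = τ - C.e Δ) :
    topologicalKrullDim (C.cell Δ τ) = topologicalKrullDim (zariskiSet (C.moduleSet α s)) := by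
  obtain ⟨Φ, hΦ1, hΦ2⟩ := C.exists_duality s
  have hΦ : C.IsDuality s Φ := ⟨hΦ1, hΦ2⟩
  let e : zariskiSet (C.moduleSet α s) ≃ C.cell Δ τ :=
    Equiv.ofBijective (fun v => ⟨h.toHilb hΦ v, h.toHilb_mem_cell hΦ hΔ hΔα hs v⟩)
      ⟨fun v v' hvv' => h.toHilb_injective hΦ (congrArg Subtype.val hvv'), fun I => by
        obtain ⟨v, hv⟩ := h.exists_toHilb_eq hΦ hΔα hs I.2
        exact ⟨v, Subtype.ext hv⟩⟩
  let e' : zariskiSet (C.moduleSet α s) ≃ₜ C.cell Δ τ :=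
    { e with
      continuous_toFun := (h.continuous_toHilb hΦ).subtype_mk _
      continuous_invFun := h.continuous_of_toHilb hΦ continuous_subtype_val fun I =>
        congrArg Subtype.val (e.apply_symm_apply I) }
  exact (IsHomeomorph.topologicalKrullDim_eq e' e'.isHomeomorph).symm

end GenericBranch

end

end

section

open Finset

noncomputable section

/-! ## Class functions on the columns of a Dyck path -/

/-- `κ` divides the columns `0 ≤ x < c n` with ranks `V x` into `c` classes, each of which has one
column in each residue class modulo `n`; the last class consists of the columns
`p, …, p + n - 1`. -/
structure IsClassFunction (n m c p : ℕ) (V : ℕ → ℤ) (κ : ℕ → ℕ) : Prop where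
  lt : ∀ x < c * n, κ x < c
  inj : ∀ x < c * n, ∀ z < c * n, κ x = κ z → x ≡ z [MOD n] → x = z
  next_le : ∀ x < c * n, ∀ z < c * n, κ x = κ z → z ≡ x + 1 [MOD n] → V z ≤ V x + m
  inversion : ∀ x < c * n, ∀ u < c, κ x < u →
    (∀ z < c * n, κ z = u → x < z) ∨
      ∀ z < c * n, κ z = u → z < x ∧ (z ≡ x + 1 [MOD n] → V x + m < V z)
  zero : κ 0 = 0
  link : ∀ u, u + 1 < c → ∃ x < c * n, ∃ z < c * n, κ x = u ∧ κ z = u + 1 ∧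
    z ≡ x + 1 [MOD n] ∧ V z ≤ V x + m
  top_iff : ∀ x < c * n, κ x + 1 = c ↔ p ≤ x ∧ x < p + n
  top_gt : ∀ x < c * n, p + n ≤ x → V x + m < V (x + 1 - n)

/-- In a block of `n` consecutive integers, the successor modulo `n` is the next integer, except
that the last one wraps around to the first. -/
theorem Nat.ModEq.eq_or_wrap {n p x z : ℕ} (hx : p ≤ x) (hx' : x < p + n) (hz : p ≤ z)
    (hz' : z < p + n) (h : z ≡ x + 1 [MOD n]) : z = x + 1 ∨ (x = p + n - 1 ∧ z = p) := by
  rcases lt_or_ge (x + 1) (p + n) with hlt | hge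
  · left
    have h1 : z - p ≡ x + 1 - p [MOD n] := by
      refine Nat.ModEq.add_right_cancel' p ?_
      rwa [Nat.sub_add_cancel hz, Nat.sub_add_cancel (by omega)]
    have := Nat.ModEq.eq_of_lt_of_lt h1 (by omega) (by omega)
    omega
  · right
    have hx1 : x + 1 = p + n := by omega
    have h1 : z - p ≡ 0 [MOD n] := by
      refine Nat.ModEq.add_right_cancel' p ?_
      rw [Nat.sub_add_cancel hz, zero_add]
      rw [hx1] at h
      exact h.trans (by simp [Nat.ModEq])
    have := Nat.ModEq.eq_of_lt_of_lt h1 (by omega) (by omega)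
    omega

theorem exists_modEq_mem_block {n : ℕ} (hn : 0 < n) (p x : ℕ) :
    ∃ z, p ≤ z ∧ z < p + n ∧ z ≡ x [MOD n] := by
  refine ⟨p + (x + (n - 1) * p) % n, by omega, by have := Nat.mod_lt (x + (n - 1) * p) hn; omega, ?_⟩
  have h1 : p + (x + (n - 1) * p) % n ≡ p + (x + (n - 1) * p) [MOD n] :=
    Nat.ModEq.add_left p (Nat.mod_modEq _ _)
  refine h1.trans ?_
  obtain ⟨k, rfl⟩ := Nat.exists_eq_add_of_lt hn
  have h2 : p + (x + (0 + k + 1 - 1) * p) = x + (0 + k + 1) * p := by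
    rw [show 0 + k + 1 - 1 = k by omega]
    ring
  rw [h2]
  simp [Nat.ModEq]

namespace IsClassFunction

variable {n m c p p' : ℕ} {V V' : ℕ → ℤ} {κ κ' : ℕ → ℕ}

/-- A single class. -/
theorem one (hV : ∀ x, x + 1 < n → V (x + 1) ≤ V x + m) (h0 : V 0 ≤ V (n - 1) + m)
    (hκ : ∀ x < n, κ x = 0) (hn : 0 < n) : IsClassFunction n m 1 0 V κ where
  lt x hx := by rw [hκ x (by omega)]; exact one_pos
  inj x hx z hz _ h := Nat.ModEq.eq_of_lt_of_lt h (by omega) (by omega)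
  next_le x hx z hz _ h := by
    rcases Nat.ModEq.eq_or_wrap (p := 0) (by omega) (by omega) (by omega) (by omega) h with
      rfl | ⟨hx', rfl⟩
    · exact hV x (by omega)
    · rwa [hx', zero_add]
  inversion x hx u hu h := by omega
  zero := hκ 0 hn
  link u hu := by omega
  top_iff x hx := by
    rw [hκ x (by omega)]
    omega
  top_gt x hx h := by omega

/-- Insertion of a block of `n` consecutive columns at `p`. -/
theorem insert (h : IsClassFunction n m c p' V' κ') (hn : 1 < n) (hp' : p' < p) (hpc : p ≤ c * n)
    (hV : ∀ x, x + 1 < (c + 1) * n → V (x + 1) ≤ V x + m) (hp : V p ≤ V (p + n - 1) + m)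
    (hmax : ∀ x, p < x → x ≤ c * n → V (x + n - 1) + m < V x)
    (hV'1 : ∀ x < p, V' x = V x) (hV'2 : ∀ x, p ≤ x → x < c * n → V' x = V (x + n))
    (hκ1 : ∀ x < p, κ x = κ' x) (hκ2 : ∀ x, p ≤ x → x < p + n → κ x = c)
    (hκ3 : ∀ x, p + n ≤ x → x < (c + 1) * n → κ x = κ' (x - n)) :
    IsClassFunction n m (c + 1) p V κ := by
  have hc1 : (c + 1) * n = c * n + n := by ring
  have hsub : ∀ {x : ℕ}, n ≤ x → x - n ≡ x [MOD n] := by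
    intro x hx
    have : x - n + n ≡ x - n [MOD n] := by simp [Nat.ModEq]
    rw [Nat.sub_add_cancel hx] at this
    exact this.symm
  -- columns outside of the block
  have hdec : ∀ x < (c + 1) * n, κ x ≠ c → ∃ x' < c * n, κ x = κ' x' ∧ V x = V' x' ∧
      x' ≡ x [MOD n] ∧ ((x < p ∧ x' = x) ∨ (p + n ≤ x ∧ x = x' + n)) := by
    intro x hx hxc
    rcases lt_or_ge x p with h1 | h1
    · exact ⟨x, by omega, hκ1 x h1, (hV'1 x h1).symm, rfl, Or.inl ⟨h1, rfl⟩⟩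
    · rcases lt_or_ge x (p + n) with h2 | h2
      · exact absurd (hκ2 x h1 h2) hxc
      · refine ⟨x - n, by omega, hκ3 x h2 hx, ?_, hsub (by omega), Or.inr ⟨h2, by omega⟩⟩
        rw [hV'2 (x - n) (by omega) (by omega), Nat.sub_add_cancel (by omega)]
  have hasc : ∀ x' < c * n, ∃ x < (c + 1) * n, κ x = κ' x' ∧ V x = V' x' ∧ x ≡ x' [MOD n] := by
    intro x' hx'
    rcases lt_or_ge x' p with h1 | h1
    · exact ⟨x', by omega, hκ1 x' h1, (hV'1 x' h1).symm, rfl⟩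
    · refine ⟨x' + n, by omega, ?_, (hV'2 x' h1 hx').symm, by simp [Nat.ModEq]⟩
      rw [hκ3 _ (by omega) (by omega), Nat.add_sub_cancel]
  have htop : ∀ x < (c + 1) * n, κ x = c ↔ p ≤ x ∧ x < p + n := by
    intro x hx
    constructor
    · intro hxc
      by_contra hout
      rcases lt_or_ge x p with h1 | h1
      · have := h.lt x (by omega)
        rw [← hκ1 x h1] at this
        omega
      · have h2 : p + n ≤ x := by omega
        have := h.lt (x - n) (by omega)
        rw [← hκ3 x h2 hx] at this
        omega
    · rintro ⟨h1, h2⟩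
      exact hκ2 x h1 h2
  have hblock : ∀ x z, p ≤ x → x < p + n → p ≤ z → z < p + n → z ≡ x + 1 [MOD n] →
      V z ≤ V x + m := by
    intro x z hx hx' hz hz' hxz
    rcases Nat.ModEq.eq_or_wrap hx hx' hz hz' hxz with rfl | ⟨rfl, rfl⟩
    · exact hV x (by omega)
    · exact hp
  have hgt : ∀ x < (c + 1) * n, p + n ≤ x → V x + m < V (x + 1 - n) := by
    intro x hx hpx
    have := hmax (x + 1 - n) (by omega) (by omega)
    rwa [show x + 1 - n + n - 1 = x by omega] at this
  -- Beyond the block, the step `x ↦ x + 1 - n` raises `V` by more than `m`. Iterate it until the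
  -- block is reached; the inequality passes to the cyclic successors in the block, where `V` rises
  -- by at most `m` at each step.
  have hgt' : ∀ x < (c + 1) * n, p + n ≤ x → ∀ z, p ≤ z → z < p + n → z ≡ x + 1 [MOD n] →
      V x + m < V z := by
    intro x
    induction x using Nat.strong_induction_on with
    | _ x ih =>
      intro hx hpx z hz hz' hxz
      have h1 := hgt x hx hpx
      have hy : x + 1 - n ≡ x + 1 [MOD n] := hsub (by omega)
      rcases lt_or_ge (x + 1 - n) (p + n) with h2 | h2
      · have h3 : z - p ≡ x + 1 - n - p [MOD n] := by
          refine Nat.ModEq.add_right_cancel' p ?_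
          rw [Nat.sub_add_cancel hz, Nat.sub_add_cancel (by omega)]
          exact hxz.trans hy.symm
        have h4 := Nat.ModEq.eq_of_lt_of_lt h3 (by omega) (by omega)
        have h5 : z = x + 1 - n := by omega
        rwa [h5]
      · obtain ⟨z', hz1, hz2, hz3⟩ := exists_modEq_mem_block (by omega : 0 < n) p (x + 1 - n + 1)
        have h3 := ih (x + 1 - n) (by omega) (by omega) h2 z' hz1 hz2 hz3
        have h4 := hblock z z' hz hz' hz1 hz2 (hz3.trans ((hy.trans hxz.symm).add_right 1))
        omega
  refine ⟨fun x hx => ?_, fun x hx z hz hxz hmod => ?_, fun x hx z hz hxz hmod => ?_,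
    fun x hx u hu hxu => ?_, ?_, fun u hu => ?_, fun x hx => ?_, hgt⟩
  · by_cases hxc : κ x = c
    · omega
    · obtain ⟨x', hx', h1, -⟩ := hdec x hx hxc
      have := h.lt x' hx'
      omega
  · by_cases hxc : κ x = c
    · obtain ⟨h1, h2⟩ := (htop x hx).1 hxc
      obtain ⟨h3, h4⟩ := (htop z hz).1 (hxz ▸ hxc)
      have h5 : x - p ≡ z - p [MOD n] := by
        refine Nat.ModEq.add_right_cancel' p ?_
        rwa [Nat.sub_add_cancel h1, Nat.sub_add_cancel h3]
      have := Nat.ModEq.eq_of_lt_of_lt h5 (by omega) (by omega)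
      omega
    · obtain ⟨x', hx', h1, h2, h3, h4⟩ := hdec x hx hxc
      obtain ⟨z', hz', h5, h6, h7, h8⟩ := hdec z hz (hxz ▸ hxc)
      have := h.inj x' hx' z' hz' (by omega) (h3.trans (hmod.trans h7.symm))
      omega
  · by_cases hxc : κ x = c
    · obtain ⟨h1, h2⟩ := (htop x hx).1 hxc
      obtain ⟨h3, h4⟩ := (htop z hz).1 (hxz ▸ hxc)
      exact hblock x z h1 h2 h3 h4 hmod
    · obtain ⟨x', hx', h1, h2, h3, h4⟩ := hdec x hx hxc
      obtain ⟨z', hz', h5, h6, h7, h8⟩ := hdec z hz (hxz ▸ hxc)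
      rw [h2, h6]
      exact h.next_le x' hx' z' hz' (by omega) (h7.trans (hmod.trans (h3.symm.add_right 1)))
  · obtain ⟨x', hx', h1, h2, h3, h4⟩ := hdec x hx (by omega)
    by_cases huc : u = c
    · subst huc
      rcases h4 with ⟨h5, -⟩ | ⟨h5, -⟩
      · left
        intro z hz hzu
        have := (htop z hz).1 hzu
        omega
      · right
        intro z hz hzu
        obtain ⟨h6, h7⟩ := (htop z hz).1 hzu
        exact ⟨by omega, fun hxz => hgt' x hx h5 z h6 h7 hxz⟩
    · rcases h.inversion x' hx' u (by omega) (by omega) with h5 | h5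
      · left
        intro z hz hzu
        obtain ⟨z', hz', h6, h7, h8, h9⟩ := hdec z hz (by omega)
        have := h5 z' hz' (by omega)
        omega
      · right
        intro z hz hzu
        obtain ⟨z', hz', h6, h7, h8, h9⟩ := hdec z hz (by omega)
        obtain ⟨h10, h11⟩ := h5 z' hz' (by omega)
        refine ⟨by omega, fun hmod => ?_⟩
        rw [h2, h7]
        exact h11 (h8.trans (hmod.trans (h3.symm.add_right 1)))
  · rw [hκ1 0 (by omega), h.zero]
  · by_cases huc : u + 1 = c
    swap
    · obtain ⟨x', hx', z', hz', h1, h2, h3, h4⟩ := h.link u (by omega)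
      obtain ⟨x, hx, h5, h6, h7⟩ := hasc x' hx'
      obtain ⟨z, hz, h8, h9, h10⟩ := hasc z' hz'
      exact ⟨x, hx, z, hz, by omega, by omega, h10.trans (h3.trans (h7.symm.add_right 1)), by omega⟩
    -- The link between the previous top class and the new one. Column `p - 1` is linked to column
    -- `p`, but need not belong to the previous top block. Steps `x ↦ x + 1 - n` move it into that
    -- block; `top_gt` of the previous level keeps the inequality valid, with the target moving
    -- along the new block.
    · have key : ∀ x, p' ≤ x → x < p → ∀ z, p ≤ z → z < p + n → z ≡ x + 1 [MOD n] →
          V z ≤ V x + m → ∃ x, p' ≤ x ∧ x < p' + n ∧ x < p ∧ ∃ z, p ≤ z ∧ z < p + n ∧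
            z ≡ x + 1 [MOD n] ∧ V z ≤ V x + m := by
        intro x
        induction x using Nat.strong_induction_on with
        | _ x ih =>
          intro hx hxp z hz hz' hxz hVz
          rcases lt_or_ge x (p' + n) with h1 | h1
          · exact ⟨x, hx, h1, hxp, z, hz, hz', hxz, hVz⟩
          · have h2 := h.top_gt x (by omega) h1
            rw [hV'1 x hxp, hV'1 (x + 1 - n) (by omega)] at h2
            have hy : x + 1 - n ≡ x + 1 [MOD n] := hsub (by omega)
            obtain ⟨z', hz1, hz2, hz3⟩ := exists_modEq_mem_block (by omega : 0 < n) p (x + 1 - n + 1)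
            have h4 := hblock z z' hz hz' hz1 hz2 (hz3.trans ((hy.trans hxz.symm).add_right 1))
            exact ih (x + 1 - n) (by omega) (by omega) (by omega) z' hz1 hz2 hz3 (by omega)
      obtain ⟨x, hx1, hx2, hxp, z, hz1, hz2, hxz, hVz⟩ := key (p - 1) (by omega) (by omega) p le_rfl
        (by omega) (by rw [Nat.sub_add_cancel (by omega)]) (by
          have := hV (p - 1) (by omega)
          rwa [Nat.sub_add_cancel (by omega)] at this)
      refine ⟨x, by omega, z, by omega, ?_, ?_, hxz, hVz⟩
      · rw [hκ1 x hxp]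
        have := (h.top_iff x (by omega)).2 ⟨hx1, hx2⟩
        omega
      · rw [hκ2 z hz1 hz2, huc]
  · rw [← htop x hx]
    omega

end IsClassFunction

/-! ## The classes of the columns of a Dyck path -/

namespace RationalDyckPath

variable {d n m : ℕ} (D : RationalDyckPath d n m)

theorem cyclePerm_apply_of_lt {j u i : ℕ} (h : i < D.permIndex j u) : D.cyclePerm j u i = i := by
  refine List.formPerm_apply_of_notMem fun hmem => ?_
  rw [List.mem_range'_1] at hmem
  omega

theorem cyclePerm_apply_of_gt {j u i : ℕ} (h : u < i) : D.cyclePerm j u i = i := by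
  refine List.formPerm_apply_of_notMem fun hmem => ?_
  rw [List.mem_range'_1] at hmem
  omega

theorem permIndex_le (j u : ℕ) : D.permIndex j u ≤ u := (Nat.find_spec (D.exists_permIndex j u)).1

theorem lt_permIndex_iff {j u i : ℕ} (hi : i ≤ u) :
    i < D.permIndex j u ↔ i * n + j < D.moveIndex u := by
  rw [permIndex, Nat.lt_find_iff]
  constructor
  · intro h
    have := h i le_rfl
    omega
  · rintro h i' hi' ⟨-, h2⟩
    have : i' * n ≤ i * n := Nat.mul_le_mul_right _ hi'
    omega

theorem cyclePerm_apply_of_mem {j u i : ℕ} (h : D.permIndex j u ≤ i) (h' : i < u) :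
    D.cyclePerm j u i = i + 1 := by
  rw [cyclePerm]
  have h1 := List.formPerm_apply_lt_getElem (List.range' (D.permIndex j u) (u + 1 - D.permIndex j u))
    List.nodup_range' (i - D.permIndex j u) (by rw [List.length_range']; omega)
  rw [List.getElem_range', List.getElem_range'] at h1
  rw [show D.permIndex j u + 1 * (i - D.permIndex j u) = i by omega,
    show D.permIndex j u + 1 * (i - D.permIndex j u + 1) = i + 1 by omega] at h1
  exact h1

theorem cyclePerm_apply_self (j u : ℕ) : D.cyclePerm j u u = D.permIndex j u := by
  rw [cyclePerm]
  have hle := D.permIndex_le j u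
  have h1 := List.formPerm_apply_getElem (List.range' (D.permIndex j u) (u + 1 - D.permIndex j u))
    List.nodup_range' (u - D.permIndex j u) (by rw [List.length_range']; omega)
  rw [List.getElem_range', List.getElem_range'] at h1
  rw [show D.permIndex j u + 1 * (u - D.permIndex j u) = u by omega, List.length_range',
    show u - D.permIndex j u + 1 = u + 1 - D.permIndex j u by omega, Nat.mod_self] at h1
  simpa using h1

theorem permProd_apply_of_gt {j u i : ℕ} (h : u < i) : D.permProd j u i = i := by
  induction u with
  | zero => rfl
  | succ u ih =>
    rw [permProd, Equiv.Perm.mul_apply, ih (by omega), cyclePerm_apply_of_gt _ h]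

/-- The class of the column `x`, at the level of the classes `0, …, u`. -/
def levelClass (u x : ℕ) : ℕ := (D.permProd (x % n) u).symm (x / n)

theorem levelClass_zero (x : ℕ) : D.levelClass 0 x = x / n := rfl

/-- Among the columns congruent to `j` modulo `n`, the cycle `s_{j,u+1}` does the renumbering caused
by inserting `n` consecutive columns at `p_{u+1}`. Columns before the block keep their class, the
block receives class `u + 1`, and later columns inherit the class of `x - n`. This lemma and the
next two are these three cases. -/
theorem levelClass_succ_of_lt {u x : ℕ} (hx : x < (u + 2) * n) (h : x < D.moveIndex (u + 1)) :
    D.levelClass (u + 1) x = D.levelClass u x := by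
  have hn : 0 < n := Nat.pos_of_mul_pos_left (by omega : 0 < (u + 2) * n)
  have h1 : x / n < u + 2 := (Nat.div_lt_iff_lt_mul hn).2 hx
  have h2 := Nat.div_add_mod' x n
  rw [levelClass, levelClass, Equiv.symm_apply_eq, permProd, Equiv.Perm.mul_apply,
    Equiv.apply_symm_apply, cyclePerm_apply_of_lt]
  rw [lt_permIndex_iff _ (by omega), h2]
  exact h

theorem levelClass_succ_of_mem {u x : ℕ} (hx : x < (u + 2) * n) (h : D.moveIndex (u + 1) ≤ x)
    (h' : x < D.moveIndex (u + 1) + n) : D.levelClass (u + 1) x = u + 1 := by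
  have hn : 0 < n := Nat.pos_of_mul_pos_left (by omega : 0 < (u + 2) * n)
  have h1 : x / n < u + 2 := (Nat.div_lt_iff_lt_mul hn).2 hx
  have h2 := Nat.div_add_mod' x n
  rw [levelClass, Equiv.symm_apply_eq, permProd, Equiv.Perm.mul_apply,
    permProd_apply_of_gt _ (Nat.lt_succ_self u), cyclePerm_apply_self]
  have h3 : ¬ x / n < D.permIndex (x % n) (u + 1) := by
    rw [lt_permIndex_iff _ (by omega), h2]
    omega
  by_contra hne
  obtain ⟨i, hi⟩ : ∃ i, x / n = i + 1 := ⟨x / n - 1, by omega⟩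
  have h4 : ¬ i < D.permIndex (x % n) (u + 1) := by omega
  rw [lt_permIndex_iff _ (by omega)] at h4
  rw [hi, add_mul, one_mul] at h2
  omega

theorem levelClass_succ_of_ge {u x : ℕ} (hx : x < (u + 2) * n) (h : D.moveIndex (u + 1) + n ≤ x) :
    D.levelClass (u + 1) x = D.levelClass u (x - n) := by
  have hn : 0 < n := Nat.pos_of_mul_pos_left (by omega : 0 < (u + 2) * n)
  have h1 : x / n < u + 2 := (Nat.div_lt_iff_lt_mul hn).2 hx
  have h2 := Nat.div_add_mod' x n
  have h3 : (x - n) % n = x % n := (Nat.mod_eq_sub_mod (by omega)).symm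
  have h4 : (x - n) / n + 1 = x / n := by
    have := Nat.sub_mul_div x n 1
    rw [mul_one] at this
    have h5 : 0 < x / n := Nat.div_pos (by omega) hn
    omega
  rw [levelClass, levelClass, Equiv.symm_apply_eq, permProd, Equiv.Perm.mul_apply, h3,
    Equiv.apply_symm_apply, cyclePerm_apply_of_mem _ _ (by omega), h4]
  rw [← not_lt, lt_permIndex_iff _ (by omega)]
  rw [← h4, add_mul, one_mul] at h2
  omega

theorem mul_y_le (x : ℕ) : n * D.y x ≤ m * x := by
  rw [y]
  split_ifs with h
  · have h1 := D.height_le ⟨x, h⟩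
    calc n * D.height ⟨x, h⟩ ≤ n * (m * x / n) := Nat.mul_le_mul_left _ h1
      _ ≤ m * x := Nat.mul_div_le _ _
  · simp

theorem rank_nonneg (x : ℕ) : 0 ≤ D.rank x := by
  have := D.mul_y_le x
  rw [rank, boxRank]
  zify at this
  omega

theorem y_zero : D.y 0 = 0 := by
  rw [y]
  split_ifs with h
  · have := D.height_le ⟨0, h⟩
    simpa using this
  · rfl

theorem rank_zero : D.rank 0 = 0 := by
  rw [rank, boxRank, y_zero]
  simp

theorem y_le_y {x z : ℕ} (hxz : x ≤ z) (hz : z < d * n) : D.y x ≤ D.y z := by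
  rw [y, y, dif_pos hz, dif_pos (by omega)]
  exact D.mono hxz

theorem rank_succ_le {x : ℕ} (hx : x + 1 < d * n) : D.rank (x + 1) ≤ D.rank x + m := by
  have h1 := D.y_le_y (Nat.le_succ x) hx
  have h2 : n * D.y x ≤ n * D.y (x + 1) := Nat.mul_le_mul_left _ h1
  rw [rank, rank, boxRank, boxRank]
  push_cast
  zify at h2
  nlinarith

theorem rankVec_of_lt {u x : ℕ} (hu : u + 1 < d) (hx : x < D.moveIndex (u + 1)) :
    D.rankVec (d - 1 - u) x = D.rankVec (d - 1 - (u + 1)) x := by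
  rw [show d - 1 - u = (d - 1 - (u + 1)) + 1 by omega, rankVec]
  refine if_pos ?_
  rw [moveIndex] at hx
  rwa [show d - (d - 1 - (u + 1) + 1) = u + 1 by omega,
    show d - 1 - (u + 1) = d - (u + 1) - 1 by omega]

theorem rankVec_of_ge {u x : ℕ} (hu : u + 1 < d) (hx : D.moveIndex (u + 1) ≤ x) :
    D.rankVec (d - 1 - u) x = D.rankVec (d - 1 - (u + 1)) (x + n) := by
  rw [show d - 1 - u = (d - 1 - (u + 1)) + 1 by omega, rankVec]
  refine if_neg ?_
  rw [moveIndex] at hx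
  rw [show d - (d - 1 - (u + 1) + 1) = u + 1 by omega,
    show d - 1 - (u + 1) = d - (u + 1) - 1 by omega]
  omega

/-- The rank vectors are again rank vectors of paths. -/
structure IsRankVec (n m c : ℕ) (V : ℕ → ℤ) : Prop where
  zero : V 0 = 0
  nonneg : ∀ x, 0 ≤ V x
  succ_le : ∀ x, x + 1 < c * n → V (x + 1) ≤ V x + m

theorem IsRankVec.moveIndexOf_spec {c : ℕ} {V : ℕ → ℤ} (h : IsRankVec n m (c + 1) V) :
    V (moveIndexOf n m V c) ≤ V (moveIndexOf n m V c + n - 1) + m := by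
  have h0 : V 0 ≤ V (0 + n - 1) + m := by
    have := h.nonneg (0 + n - 1)
    rw [h.zero]
    omega
  exact Nat.findGreatest_spec (P := fun x => V x ≤ V (x + n - 1) + m) (Nat.zero_le (c * n)) h0

theorem moveIndexOf_max {c x : ℕ} {V : ℕ → ℤ} (hx : moveIndexOf n m V c < x) (hxc : x ≤ c * n) :
    V (x + n - 1) + m < V x :=
  not_le.1 (Nat.findGreatest_is_greatest hx hxc)

/-- The index `1` satisfies the defining inequality, as `V 1 ≤ m` and `V` is nonnegative. -/
theorem IsRankVec.moveIndexOf_pos {c : ℕ} {V : ℕ → ℤ} (h : IsRankVec n m (c + 1) V) (hn : 1 < n)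
    (hc : 0 < c) : 0 < moveIndexOf n m V c := by
  by_contra h0
  have hcn : n ≤ c * n := Nat.le_mul_of_pos_left _ hc
  have h1 := moveIndexOf_max (n := n) (m := m) (V := V) (c := c) (x := 1) (by omega) (by omega)
  have h2 := h.succ_le 0 (by rw [add_mul]; omega)
  rw [h.zero] at h2
  have h3 := h.nonneg (1 + n - 1)
  simp only [zero_add] at h2
  omega

theorem moveIndex_eq {u : ℕ} (hu : u < d) :
    D.moveIndex u = moveIndexOf n m (D.rankVec (d - 1 - u)) u := by
  rw [moveIndex, show d - u - 1 = d - 1 - u by omega]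

/-- Deleting the block at the move index keeps the rise of at most `m` per column. Only the seam at
the deleted block needs an argument, and maximality of the move index supplies it. -/
theorem isRankVec (hn : 1 < n) {u t : ℕ} (hu : u + t + 1 = d) :
    IsRankVec n m (u + 1) (D.rankVec (d - 1 - u)) := by
  induction t generalizing u with
  | zero =>
    rw [show d - 1 - u = 0 by omega, show u + 1 = d by omega]
    exact ⟨D.rank_zero, D.rank_nonneg, fun x hx => D.rank_succ_le hx⟩
  | succ t ih =>
    have h := ih (u := u + 1) (by omega)
    have hpos : 0 < D.moveIndex (u + 1) := by
      rw [D.moveIndex_eq (by omega)]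
      exact h.moveIndexOf_pos hn (by omega)
    refine ⟨?_, fun x => ?_, fun x hx => ?_⟩
    · rw [D.rankVec_of_lt (by omega) hpos, h.zero]
    · rcases lt_or_ge x (D.moveIndex (u + 1)) with hx | hx
      · rw [D.rankVec_of_lt (by omega) hx]
        exact h.nonneg _
      · rw [D.rankVec_of_ge (by omega) hx]
        exact h.nonneg _
    · have hc : (u + 1 + 1) * n = (u + 1) * n + n := by ring
      rcases lt_trichotomy (x + 1) (D.moveIndex (u + 1)) with h1 | h1 | h1
      · rw [D.rankVec_of_lt (u := u) (by omega) h1,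
          D.rankVec_of_lt (u := u) (x := x) (by omega) (by omega)]
        exact h.succ_le x (by omega)
      · rw [D.rankVec_of_ge (u := u) (x := x + 1) (by omega) (by omega),
          D.rankVec_of_lt (u := u) (x := x) (by omega) (by omega)]
        have h2 := h.succ_le x (by omega)
        have h3 := h.succ_le (x + 1) (by omega)
        -- With `x + 1` the move index, maximality at `x + 2` gives `V (x + 1 + n) + m < V (x + 2) ≤
        -- V x + 2m`, the rise across the seam.
        have h4 := moveIndexOf_max (n := n) (m := m) (V := D.rankVec (d - 1 - (u + 1)))
          (c := u + 1) (x := x + 2) (by rw [← D.moveIndex_eq (by omega)]; omega) (by omega)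
        rw [show x + 2 + n - 1 = x + 1 + n by omega] at h4
        rw [show x + 2 = x + 1 + 1 by omega] at h4
        omega
      · rw [D.rankVec_of_ge (u := u) (x := x + 1) (by omega) (by omega),
          D.rankVec_of_ge (u := u) (x := x) (by omega) (by omega)]
        have := h.succ_le (x + n) (by omega)
        rwa [show x + n + 1 = x + 1 + n by omega] at this

/-- Otherwise `p_{u+1} ≥ p_{u+2}`, and before the deletion at `p_{u+2}` the inequality defining
`p_{u+1}` held at the larger index `p_{u+1} + n`, against the maximality of `p_{u+2}`. -/
theorem moveIndex_lt_succ (hn : 1 < n) {u : ℕ} (hu : u + 2 < d) :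
    D.moveIndex (u + 1) < D.moveIndex (u + 2) := by
  by_contra! hle
  have h1 := (D.isRankVec hn (u := u + 1) (t := d - u - 2) (by omega)).moveIndexOf_spec
  rw [← D.moveIndex_eq (by omega)] at h1
  rw [D.rankVec_of_ge (u := u + 1) (x := D.moveIndex (u + 1)) (by omega) hle,
    D.rankVec_of_ge (u := u + 1) (x := D.moveIndex (u + 1) + n - 1) (by omega)
      (by rw [show u + 1 + 1 = u + 2 by omega]; omega)] at h1
  have h3 : D.moveIndex (u + 1) ≤ (u + 1) * n := Nat.findGreatest_le _
  have h2 := moveIndexOf_max (n := n) (m := m) (V := D.rankVec (d - 1 - (u + 2)))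
    (c := u + 2) (x := D.moveIndex (u + 1) + n) (by rw [← D.moveIndex_eq (by omega)]; omega)
    (by rw [show (u + 2) * n = (u + 1) * n + n by ring]; omega)
  rw [show D.moveIndex (u + 1) + n - 1 + n = D.moveIndex (u + 1) + n + n - 1 by omega] at h1
  simp only [add_assoc, Nat.reduceAdd] at h1 h2
  omega

/-- Reverses the deletions: starting from the last `n` remaining columns, which form class `0`,
block after block is inserted. The strict growth of the move indices is what
`IsClassFunction.insert` requires. -/
theorem exists_isClassFunction_level (hn : 1 < n) {u : ℕ} (hu : u < d) :
    IsClassFunction n m (u + 1) (if u = 0 then 0 else D.moveIndex u) (D.rankVec (d - 1 - u))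
      (D.levelClass u) := by
  induction u with
  | zero =>
    have h := D.isRankVec hn (u := 0) (t := d - 1) (by omega)
    rw [if_pos rfl]
    refine IsClassFunction.one (fun x hx => h.succ_le x (by omega)) ?_ (fun x hx => ?_) (by omega)
    · rw [h.zero]
      have := h.nonneg (n - 1)
      omega
    · rw [levelClass_zero, Nat.div_eq_of_lt hx]
  | succ u ih =>
    have h := D.isRankVec hn (u := u + 1) (t := d - 1 - (u + 1)) (by omega)
    rw [if_neg (by omega)]
    have hp := D.moveIndex_eq (u := u + 1) hu
    have hle : D.moveIndex (u + 1) ≤ (u + 1) * n := Nat.findGreatest_le _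
    have hc : (u + 2) * n = (u + 1) * n + n := by ring
    refine (ih (by omega)).insert hn ?_ hle h.succ_le ?_ (fun x hx hxc => ?_)
      (fun x hx => D.rankVec_of_lt hu hx) (fun x hx _ => D.rankVec_of_ge hu hx)
      (fun x hx => D.levelClass_succ_of_lt (by omega) hx)
      (fun x hx hx' => D.levelClass_succ_of_mem (by omega) hx hx')
      (fun x hx hx' => D.levelClass_succ_of_ge hx' hx)
    · split_ifs with hu0
      · rw [hp]
        exact h.moveIndexOf_pos hn (by omega)
      · obtain ⟨u, rfl⟩ := Nat.exists_eq_succ_of_ne_zero hu0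
        exact D.moveIndex_lt_succ hn hu
    · rw [hp]
      exact h.moveIndexOf_spec
    · exact moveIndexOf_max (by rw [← hp]; exact hx) hxc

/-- The class of the column `x = i n + j` is `s_j⁻¹(i)`. -/
def colClass (x : ℕ) : ℕ := (D.perm (x % n)).symm (x / n)

theorem exists_isClassFunction (hn : 1 < n) (hd : 0 < d) :
    ∃ p, IsClassFunction n m d p D.rank D.colClass := by
  have h := D.exists_isClassFunction_level hn (u := d - 1) (by omega)
  rw [Nat.sub_add_cancel hd, Nat.sub_self] at h
  exact ⟨_, h⟩

theorem enhancedRank_eq (z : ℕ × ℕ) :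
    D.enhancedRank z = d * boxRank n m z.1 z.2 + D.colClass z.1 := rfl

end RationalDyckPath

end

end

section

open Finset

noncomputable section

/-! ## Special boxes -/

/-- The number of positive multiples of `n` that are at most `δ`. -/
def multiplesUpTo (n : ℕ) (δ : ℤ) : ℕ := (δ / n).toNat

/-- The number of positive multiples of `n` in `(δ - m, δ]`. -/
def multiplesIn (n m : ℕ) (δ : ℤ) : ℤ := (multiplesUpTo n δ : ℤ) - multiplesUpTo n (δ - m)

theorem le_multiplesUpTo {n s : ℕ} (hn : 0 < n) (hs : 0 < s) {δ : ℤ} :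
    s ≤ multiplesUpTo n δ ↔ (n * s : ℤ) ≤ δ := by
  have h : s ≤ (δ / n).toNat ↔ (s : ℤ) ≤ δ / n := by omega
  rw [multiplesUpTo, h, Int.le_ediv_iff_mul_le (by omega), mul_comm]

theorem multiplesUpTo_mono {n : ℕ} (hn : 0 < n) {δ δ' : ℤ} (h : δ ≤ δ') :
    multiplesUpTo n δ ≤ multiplesUpTo n δ' :=
  Int.toNat_le_toNat (Int.ediv_le_ediv (by omega) h)

/-- The last two conditions say that `z` is the integer part of `(m x - N) / m`. This turns an
inequality for the arm `a` of a box into a count of columns `z`, so that boxes can be counted by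
pairs of columns. -/
theorem card_filter_range_eq_ite {m : ℕ} (hm : 0 < m) {x a N : ℕ} (hN : N ≤ m * x) :
    ((range x).filter fun z => z + a < x ∧ m * x < N + m * z + m ∧ N + m * z ≤ m * x).card =
      if m * a < N then 1 else 0 := by
  split_ifs with h
  · rw [card_eq_one]
    refine ⟨(m * x - N) / m, ?_⟩
    have h1 := Nat.div_mul_le_self (m * x - N) m
    have h2 := Nat.lt_div_mul_add (a := m * x - N) hm
    set z₀ := (m * x - N) / m
    ext z
    rw [mem_singleton, mem_filter, mem_range]
    constructor
    · rintro ⟨-, -, h3, h4⟩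
      have h5 : m * z < m * (z₀ + 1) := by
        rw [mul_add, mul_comm m z₀]
        omega
      have h6 : m * z₀ < m * (z + 1) := by
        rw [mul_add, mul_comm m z₀]
        omega
      have := Nat.lt_of_mul_lt_mul_left h5
      have := Nat.lt_of_mul_lt_mul_left h6
      omega
    · rintro rfl
      have h5 : m * (z₀ + a) < m * x := by
        rw [mul_add, mul_comm m z₀]
        omega
      have := Nat.lt_of_mul_lt_mul_left h5
      rw [mul_comm m z₀]
      omega
  · rw [card_eq_zero, filter_eq_empty_iff]
    rintro z - ⟨h1, h2, -⟩
    have : m * (z + a + 1) ≤ m * x := Nat.mul_le_mul_left m h1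
    have : m * (z + a + 1) = m * z + m * a + m := by ring
    omega

/-- The number of nonnegative multiples of `n` in `[-δ, m - δ)`. -/
theorem multiplesIn_add (n m : ℕ) (δ : ℤ) :
    multiplesIn n m δ + (((-((δ - m) / n)).toNat : ℤ) - (-(δ / n)).toNat) =
      δ / n - (δ - m) / n := by
  unfold multiplesIn multiplesUpTo
  omega

namespace RationalDyckPath

variable {d n m : ℕ} (D : RationalDyckPath d n m)

theorem y_le_mul (hn : 0 < n) {x : ℕ} (hx : x < d * n) : D.y x ≤ d * m := by
  have h1 := D.mul_y_le x
  have h2 : m * x ≤ m * (d * n) := Nat.mul_le_mul_left m hx.le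
  refine Nat.le_of_mul_le_mul_left (c := n) ?_ hn
  calc n * D.y x ≤ m * (d * n) := h1.trans h2
    _ = n * (d * m) := by ring

theorem mem_boxes (hn : 0 < n) {z : ℕ × ℕ} :
    z ∈ D.boxes ↔ z.1 < d * n ∧ 1 ≤ z.2 ∧ z.2 ≤ D.y z.1 := by
  rw [boxes, mem_filter, triangleBoxes, mem_filter, mem_product, mem_range, mem_Icc]
  constructor
  · rintro ⟨⟨⟨h1, h2, -⟩, -⟩, h3⟩
    exact ⟨h1, h2, h3⟩
  · rintro ⟨h1, h2, h3⟩
    exact ⟨⟨⟨h1, h2, h3.trans (D.y_le_mul hn h1)⟩,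
      (Nat.mul_le_mul_left n h3).trans (D.mul_y_le _)⟩, h3⟩

theorem boxes_eq_biUnion (hn : 0 < n) :
    D.boxes = (range (d * n)).biUnion fun x => (Icc 1 (D.y x)).image fun y => (x, y) := by
  ext ⟨x, y⟩
  rw [D.mem_boxes hn]
  simp only [mem_biUnion, mem_range, mem_image, mem_Icc, Prod.mk.injEq]
  constructor
  · rintro ⟨h1, h2, h3⟩
    exact ⟨x, h1, y, ⟨h2, h3⟩, rfl, rfl⟩
  · rintro ⟨x', h1, y', ⟨h2, h3⟩, rfl, rfl⟩
    exact ⟨h1, h2, h3⟩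

theorem sum_boxes (hn : 0 < n) {M : Type*} [AddCommMonoid M] (φ : ℕ × ℕ → M) :
    ∑ z ∈ D.boxes, φ z = ∑ x ∈ range (d * n), ∑ y ∈ Icc 1 (D.y x), φ (x, y) := by
  rw [D.boxes_eq_biUnion hn, sum_biUnion]
  · refine sum_congr rfl fun x _ => ?_
    rw [sum_image]
    rintro _ _ _ _ h
    exact (Prod.mk.injEq _ _ _ _ ▸ h).2
  · intro x _ x' _ hx
    rw [Function.onFun, disjoint_left]
    intro z hz hz'
    rw [mem_image] at hz hz'
    obtain ⟨y, -, rfl⟩ := hz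
    obtain ⟨y', -, h⟩ := hz'
    exact hx (Prod.mk.injEq _ _ _ _ ▸ h).1.symm

theorem size_eq : D.size = ∑ x ∈ range (d * n), D.y x := by
  rw [size, sum_range]
  refine sum_congr rfl fun x _ => ?_
  rw [y, dif_pos x.2]

theorem card_boxes (hn : 0 < n) : D.boxes.card = D.size := by
  rw [card_eq_sum_ones, D.sum_boxes hn, D.size_eq]
  simp

theorem leg_eq (hn : 0 < n) {x y : ℕ} (hx : x < d * n) (hy : 1 ≤ y) :
    D.leg (x, y) = D.y x - y := by
  have : D.boxes.filter (fun w => w.1 = x ∧ y < w.2) =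
      (Ioc y (D.y x)).image fun y' => (x, y') := by
    ext ⟨x', y'⟩
    rw [mem_filter, D.mem_boxes hn]
    simp only [mem_image, mem_Ioc, Prod.mk.injEq]
    constructor
    · rintro ⟨⟨h1, h2, h3⟩, rfl, h4⟩
      exact ⟨y', ⟨h4, h3⟩, rfl, rfl⟩
    · rintro ⟨y'', ⟨h1, h2⟩, rfl, rfl⟩
      exact ⟨⟨hx, by omega, h2⟩, rfl, h1⟩
  unfold leg
  rw [this, card_image_of_injective, Nat.card_Ioc]
  exact fun _ _ h => (Prod.mk.injEq _ _ _ _ ▸ h).2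

theorem arm_lt_iff (hn : 0 < n) {x y z : ℕ} (hx : x < d * n) (hy : 1 ≤ y) (hz : z < x) :
    z + D.arm (x, y) < x ↔ D.y z < y := by
  have : D.boxes.filter (fun w => w.2 = y ∧ w.1 < x) =
      ((range x).filter fun x' => y ≤ D.y x').image fun x' => (x', y) := by
    ext ⟨x', y'⟩
    rw [mem_filter, D.mem_boxes hn]
    simp only [mem_image, mem_filter, mem_range, Prod.mk.injEq]
    constructor
    · rintro ⟨⟨h1, h2, h3⟩, rfl, h4⟩
      exact ⟨x', ⟨h4, h3⟩, rfl, rfl⟩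
    · rintro ⟨x'', ⟨h1, h2⟩, rfl, rfl⟩
      exact ⟨⟨by omega, hy, h2⟩, rfl, h1⟩
  unfold arm
  rw [this, card_image_of_injective _ fun _ _ h => (Prod.mk.injEq _ _ _ _ ▸ h).1]
  constructor
  · intro h
    by_contra! hyz
    have h1 : Ico z x ⊆ (range x).filter fun x' => y ≤ D.y x' := by
      intro x' hx'
      rw [mem_Ico] at hx'
      rw [mem_filter, mem_range]
      exact ⟨hx'.2, hyz.trans (D.y_le_y hx'.1 (by omega))⟩
    have := card_le_card h1
    rw [Nat.card_Ico] at this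
    omega
  · intro h
    have h1 : ((range x).filter fun x' => y ≤ D.y x') ⊆ Ioo z x := by
      intro x' hx'
      rw [mem_filter, mem_range] at hx'
      rw [mem_Ioo]
      refine ⟨?_, hx'.1⟩
      by_contra! hle
      have := D.y_le_y hle (by omega)
      omega
    have := card_le_card h1
    rw [Nat.card_Ioo] at this
    omega

theorem rank_eq (x : ℕ) : D.rank x = (m * x : ℤ) - n * D.y x := rfl

/-- Each such box in column `x` has a unique witness column `z < x`. For fixed `x` and `z`, the
heights `y = y_z + s` that occur are those for which `n s` lies in the window of length `m` counted
by `multiplesIn`. -/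
theorem card_filter_leg (hn : 0 < n) (hm : 0 < m) :
    ((D.boxes.filter fun z => m * (D.arm z + 1) < n * D.leg z).card : ℤ) =
      ∑ x ∈ range (d * n), ∑ z ∈ range x, multiplesIn n m (D.rank z - D.rank x - 1) := by
  rw [card_filter, Nat.cast_sum, D.sum_boxes hn]
  refine sum_congr rfl fun x hx => ?_
  rw [mem_range] at hx
  have h1 : ∀ y ∈ Icc 1 (D.y x), (((if m * (D.arm (x, y) + 1) < n * D.leg (x, y) then 1 else 0 : ℕ)) : ℤ) =
      ∑ z ∈ range x, if D.y z < y ∧ m * x < n * (D.y x - y) + m * z ∧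
        n * (D.y x - y) + m * z ≤ m * x + m then 1 else 0 := by
    intro y hy
    rw [mem_Icc] at hy
    have hle : n * (D.y x - y) ≤ m * (x + 1) := by
      have := D.mul_y_le x
      have := Nat.mul_le_mul_left n (Nat.sub_le (D.y x) y)
      have : m * (x + 1) = m * x + m := by ring
      omega
    -- The witness count is used with `x + 1` and `arm + 1`; the column `z = x` never qualifies, and
    -- for `z < x` the first condition says that `z` does not reach the row of the box.
    rw [D.leg_eq hn hx hy.1, ← card_filter_range_eq_ite hm hle, card_filter, Nat.cast_sum,
      sum_range_succ, if_neg (by omega), Nat.cast_zero, add_zero]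
    refine sum_congr rfl fun z hz => ?_
    rw [mem_range] at hz
    have hiff := D.arm_lt_iff hn hx hy.1 hz
    have e1 : m * (x + 1) = m * x + m := by ring
    rw [Nat.cast_ite, Nat.cast_one, Nat.cast_zero]
    refine if_congr ?_ rfl rfl
    rw [← hiff, e1]
    omega
  rw [sum_congr rfl h1, sum_comm]
  refine sum_congr rfl fun z hz => ?_
  rw [mem_range] at hz
  set δ := D.rank z - D.rank x - 1 with hδ
  rw [rank_eq, rank_eq] at hδ
  have hmono : multiplesUpTo n (δ - m) ≤ multiplesUpTo n δ := multiplesUpTo_mono hn (by omega)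
  have h2 : (Icc 1 (D.y x)).filter (fun y => D.y z < y ∧ m * x < n * (D.y x - y) + m * z ∧
        n * (D.y x - y) + m * z ≤ m * x + m) =
      Ioc (D.y z + multiplesUpTo n (δ - m)) (D.y z + multiplesUpTo n δ) := by
    ext y
    rw [mem_filter, mem_Icc, mem_Ioc]
    rcases le_or_gt y (D.y z) with hy | hy
    · constructor
      · rintro ⟨-, h, -⟩
        omega
      · rintro ⟨h, -⟩
        omega
    · obtain ⟨s, rfl⟩ := Nat.exists_eq_add_of_lt hy
      have hA := le_multiplesUpTo (s := s + 1) hn (by omega) (δ := δ)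
      have hB := le_multiplesUpTo (s := s + 1) hn (by omega) (δ := δ - m)
      push_cast at hA hB
      have hmz : (m * z : ℤ) ≤ m * x := by
        have : (z : ℤ) ≤ x := by omega
        gcongr
      constructor
      · rintro ⟨⟨h1, h2⟩, h3, h4, h5⟩
        zify [h2] at h4 h5
        constructor
        · by_contra! hcon
          have := hB.1 (by omega)
          linarith
        · have := hA.2 (by linarith)
          omega
      · rintro ⟨h1, h2⟩
        have h3 := hA.1 (by omega)
        have h4 : ¬ _ := fun h => absurd (hB.2 h) (by omega)
        have h5 : D.y z + s + 1 ≤ D.y x := by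
          by_contra! hcon
          have : (n : ℤ) * D.y x ≤ n * (D.y z + s) := by
            have : (D.y x : ℤ) ≤ D.y z + s := by omega
            gcongr
          nlinarith
        refine ⟨⟨by omega, h5⟩, by omega, ?_, ?_⟩
        · zify [h5]
          linarith
        · zify [h5]
          linarith
  rw [sum_boole, h2, Nat.card_Ioc, multiplesIn]
  omega

/-- Same witness argument for the complementary inequality. Now `y = y_z + 1 + s`, and the
admissible `n s` are the nonnegative multiples of `n` in `[-δ, m - δ)`, where `δ` is the rank of `x`
minus the rank of `z`. -/
theorem card_filter_arm (hn : 0 < n) (hm : 0 < m) :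
    ((D.boxes.filter fun z => ¬ n * (D.leg z + 1) ≤ m * D.arm z).card : ℤ) =
      ∑ x ∈ range (d * n), ∑ z ∈ range x,
        (((-((D.rank x - D.rank z - m) / n)).toNat : ℤ) - (-((D.rank x - D.rank z) / n)).toNat) := by
  rw [card_filter, Nat.cast_sum, D.sum_boxes hn]
  refine sum_congr rfl fun x hx => ?_
  rw [mem_range] at hx
  have h1 : ∀ y ∈ Icc 1 (D.y x),
      (((if ¬ n * (D.leg (x, y) + 1) ≤ m * D.arm (x, y) then 1 else 0 : ℕ)) : ℤ) =
      ∑ z ∈ range x, if D.y z < y ∧ m * x < n * (D.y x - y + 1) + m * z + m ∧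
        n * (D.y x - y + 1) + m * z ≤ m * x then 1 else 0 := by
    intro y hy
    rw [mem_Icc] at hy
    have hle : n * (D.y x - y + 1) ≤ m * x := by
      have := D.mul_y_le x
      have := Nat.mul_le_mul_left n (show D.y x - y + 1 ≤ D.y x by omega)
      omega
    rw [D.leg_eq hn hx hy.1]
    simp_rw [not_le]
    rw [← card_filter_range_eq_ite hm hle, card_filter, Nat.cast_sum]
    refine sum_congr rfl fun z hz => ?_
    rw [mem_range] at hz
    have hiff := D.arm_lt_iff hn hx hy.1 hz
    rw [Nat.cast_ite, Nat.cast_one, Nat.cast_zero]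
    refine if_congr ?_ rfl rfl
    rw [← hiff]
  rw [sum_congr rfl h1, sum_comm]
  refine sum_congr rfl fun z hz => ?_
  rw [mem_range] at hz
  set δ := D.rank x - D.rank z with hδ
  rw [rank_eq, rank_eq] at hδ
  have hle : ∀ (s : ℕ) (A : ℤ), (-(A / n)).toNat ≤ s ↔ -A ≤ n * s := by
    intro s A
    rw [Int.toNat_le, neg_le, Int.le_ediv_iff_mul_le (by omega), neg_mul, neg_le, mul_comm]
  have hmono : (-(δ / n)).toNat ≤ (-((δ - m) / n)).toNat :=
    Int.toNat_le_toNat (neg_le_neg (Int.ediv_le_ediv (by omega) (by omega)))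
  have h2 : (Icc 1 (D.y x)).filter (fun y => D.y z < y ∧
        m * x < n * (D.y x - y + 1) + m * z + m ∧ n * (D.y x - y + 1) + m * z ≤ m * x) =
      Ico (D.y z + 1 + (-(δ / n)).toNat) (D.y z + 1 + (-((δ - m) / n)).toNat) := by
    ext y
    rw [mem_filter, mem_Icc, mem_Ico]
    rcases le_or_gt y (D.y z) with hy | hy
    · constructor
      · rintro ⟨-, h, -⟩
        omega
      · rintro ⟨h, -⟩
        omega
    · obtain ⟨s, rfl⟩ := Nat.exists_eq_add_of_lt hy
      have hA := hle s δ
      have hB := hle s (δ - m)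
      have hmz : (m * z : ℤ) + m ≤ m * x := by
        have : (z : ℤ) + 1 ≤ x := by omega
        nlinarith
      constructor
      · rintro ⟨⟨h1, h2⟩, h3, h4, h5⟩
        zify [h2] at h4 h5
        constructor
        · have := hA.2 (by linarith)
          omega
        · by_contra! hcon
          have := hB.1 (by omega)
          linarith
      · rintro ⟨h1, h2⟩
        have h3 := hA.1 (by omega)
        have h4 : ¬ _ := fun h => absurd (hB.2 h) (by omega)
        have h5 : D.y z + s + 1 ≤ D.y x := by
          by_contra! hcon
          have : (n : ℤ) * D.y x ≤ n * (D.y z + s) := by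
            have : (D.y x : ℤ) ≤ D.y z + s := by omega
            gcongr
          linarith
        refine ⟨⟨by omega, h5⟩, by omega, ?_, ?_⟩
        · zify [h5]
          linarith
        · zify [h5]
          linarith
  rw [sum_boole, h2, Nat.card_Ico]
  omega

theorem card_triangleBoxes (hn : 0 < n) :
    (triangleBoxes d n m).card = ∑ x ∈ range (d * n), m * x / n := by
  let D₀ : RationalDyckPath d n m :=
    ⟨fun x => m * x / n, fun _ => le_rfl, fun x z h => Nat.div_le_div_right (Nat.mul_le_mul_left m h)⟩
  have hy : ∀ x < d * n, D₀.y x = m * x / n := fun x hx => by rw [y, dif_pos hx]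
  have h : triangleBoxes d n m = D₀.boxes := by
    rw [boxes, eq_comm, filter_eq_self]
    intro z hz
    rw [triangleBoxes, mem_filter, mem_product, mem_range] at hz
    rw [hy _ hz.1.1, Nat.le_div_iff_mul_le hn, mul_comm]
    exact hz.2
  rw [h, D₀.card_boxes hn, D₀.size_eq]
  exact sum_congr rfl fun x hx => hy x (mem_range.1 hx)

/-- Modulo `n` the heights drop out of the ranks, so for each column `x` the differences telescope
to `⌊m x / n⌋`, the number of boxes of `ℛ⁺` in that column. -/
theorem sum_floor_rank (hn : 0 < n) :
    ∑ x ∈ range (d * n), ∑ z ∈ range x,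
      ((D.rank x - D.rank z) / n - (D.rank x - D.rank z - m) / n) =
        ((triangleBoxes d n m).card : ℤ) := by
  rw [card_triangleBoxes hn, Nat.cast_sum]
  refine sum_congr rfl fun x _ => ?_
  have hn' : (n : ℤ) ≠ 0 := by omega
  have h1 : ∀ z ∈ range x, ((D.rank x - D.rank z) / n - (D.rank x - D.rank z - m) / n) =
      -((m * x - m * (z + 1 : ℕ) : ℤ) / n) - -((m * x - m * z : ℤ) / n) := by
    intro z _
    rw [rank_eq, rank_eq,
      show (m * x - n * D.y x - (m * z - n * D.y z) : ℤ) = m * x - m * z + n * (D.y z - D.y x) by ring,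
      show (m * x - m * z + n * (D.y z - D.y x) - m : ℤ) =
        m * x - m * (z + 1 : ℕ) + n * (D.y z - D.y x) by push_cast; ring,
      Int.add_mul_ediv_left _ _ hn', Int.add_mul_ediv_left _ _ hn']
    ring
  rw [sum_congr rfl h1, sum_range_sub fun z : ℕ => -((m * x - m * z : ℤ) / n)]
  simp

/-- The two conditions on a box exclude each other. The first is counted directly; the second
through its complement in `D`. By `multiplesIn_add` and `sum_floor_rank`, the windows of that
complement and those of the right-hand side together account for `|ℛ⁺|`. -/
theorem card_specialBoxes (hn : 0 < n) (hm : 0 < m) :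
    (D.specialBoxes.card : ℤ) + ((triangleBoxes d n m \ D.boxes).card : ℤ) =
      ∑ x ∈ range (d * n), ∑ z ∈ range x,
        (multiplesIn n m (D.rank z - D.rank x - 1) + multiplesIn n m (D.rank x - D.rank z)) := by
  have h1 : D.specialBoxes.card = (D.boxes.filter fun z => m * (D.arm z + 1) < n * D.leg z).card +
      (D.boxes.filter fun z => n * (D.leg z + 1) ≤ m * D.arm z).card := by
    rw [specialBoxes, filter_or, card_union_of_disjoint]
    rw [disjoint_filter]
    intro z _ h2 h3
    rw [mul_add] at h2 h3
    omega
  have h2 := card_filter_add_card_filter_not (s := D.boxes) fun z => n * (D.leg z + 1) ≤ m * D.arm z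
  have h3 := card_sdiff_add_card_eq_card (show D.boxes ⊆ triangleBoxes d n m from filter_subset _ _)
  have h4 := D.card_filter_leg hn hm
  have h5 := D.card_filter_arm hn hm
  have h6 := D.sum_floor_rank hn
  simp_rw [← multiplesIn_add] at h6
  simp_rw [sum_add_distrib] at h6 ⊢
  rw [← h4]
  rw [← h5] at h6
  omega

end RationalDyckPath

end

end

section

open Finset

noncomputable section

/-! ## Sums over pairs of columns -/

theorem sum_range_range_eq {M : Type*} [AddCommMonoid M] (N : ℕ) (F : ℕ → ℕ → M)
    (hF : ∀ x, F x x = 0) :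
    ∑ x ∈ range N, ∑ z ∈ range N, F x z = ∑ x ∈ range N, ∑ z ∈ range x, (F x z + F z x) := by
  induction N with
  | zero => simp
  | succ N ih =>
    rw [sum_range_succ, sum_range_succ (fun x => ∑ z ∈ range x, (F x z + F z x)), ← ih]
    simp_rw [sum_range_succ _ N, sum_add_distrib, hF]
    rw [add_zero, add_assoc]
    congr 1
    exact add_comm _ _

theorem multiplesUpTo_sub {n : ℕ} (hn : 0 < n) (δ : ℤ) :
    (multiplesUpTo n δ : ℤ) - multiplesUpTo n (δ - 1) = if (n : ℤ) ∣ δ ∧ 0 < δ then 1 else 0 := by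
  have hn' : (n : ℤ) ≠ 0 := by omega
  have hn0 : (0 : ℤ) < n := by omega
  unfold multiplesUpTo
  by_cases h : (n : ℤ) ∣ δ
  · obtain ⟨c, rfl⟩ := h
    have h1 : (n * c : ℤ) / n = c := Int.mul_ediv_cancel_left c hn'
    have h2 : (n * c - 1 : ℤ) / n = c - 1 := by
      rw [Int.ediv_eq_iff_of_pos hn0]
      constructor <;> nlinarith
    rw [h1, h2]
    have h3 : (0 < (n * c : ℤ)) ↔ 0 < c := by
      rw [mul_pos_iff_of_pos_left hn0]
    simp only [dvd_mul_right, true_and, h3]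
    split_ifs <;> omega
  · rw [if_neg fun h' => h h'.1]
    have h1 := Int.emod_nonneg δ hn'
    have h2 := Int.emod_lt_of_pos δ hn0
    have h3 : δ % n ≠ 0 := fun h' => h (Int.dvd_of_emod_eq_zero h')
    have h4 := Int.emod_add_mul_ediv δ n
    have h5 : (δ - 1) / n = δ / n := by
      rw [Int.ediv_eq_iff_of_pos hn0]
      rw [mul_comm (n : ℤ)] at h4
      omega
    rw [h5, sub_self]

theorem multiplesIn_sub {n m : ℕ} (hn : 0 < n) (δ : ℤ) :
    multiplesIn n m δ - multiplesIn n m (δ - 1) =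
      (if (n : ℤ) ∣ δ ∧ 0 < δ then 1 else 0) -
        if (n : ℤ) ∣ δ - m ∧ 0 < δ - m then 1 else 0 := by
  rw [← multiplesUpTo_sub hn, ← multiplesUpTo_sub hn, multiplesIn, multiplesIn, sub_right_comm δ 1]
  ring

namespace IsClassFunction

variable {n m c p : ℕ} {V : ℕ → ℤ} {κ : ℕ → ℕ}

/-- The pair (class, residue modulo `n`) is injective on `c n` columns and takes at most `c n`
values. -/
theorem exists_mem (h : IsClassFunction n m c p V κ) (hn : 0 < n) {u : ℕ} (hu : u < c) (x : ℕ) :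
    ∃ z < c * n, κ z = u ∧ z ≡ x [MOD n] := by
  have h1 : Set.MapsTo (fun z => (κ z, z % n)) (range (c * n) : Set ℕ)
      (range c ×ˢ range n : Finset (ℕ × ℕ)) := by
    intro z hz
    rw [mem_coe, mem_range] at hz
    rw [mem_coe, mem_product, mem_range, mem_range]
    exact ⟨h.lt z hz, Nat.mod_lt _ hn⟩
  have h2 : Set.InjOn (fun z => (κ z, z % n)) (range (c * n) : Set ℕ) := by
    intro z hz z' hz' hzz
    rw [mem_coe, mem_range] at hz hz'
    rw [Prod.mk.injEq] at hzz
    exact h.inj z hz z' hz' hzz.1 hzz.2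
  have h3 := surjOn_of_injOn_of_card_le _ h1 h2 (by simp)
  obtain ⟨z, hz, hzz⟩ := h3 (show (u, x % n) ∈ _ by
    rw [mem_coe, mem_product, mem_range, mem_range]
    exact ⟨hu, Nat.mod_lt _ hn⟩)
  rw [mem_coe, mem_range] at hz
  rw [Prod.mk.injEq] at hzz
  exact ⟨z, hz, hzz.1, hzz.2⟩

theorem dvd_sub_iff (hnm : Nat.Coprime n m) (hV : ∀ x, (n : ℤ) ∣ V x - m * x) (x z a : ℕ) :
    (n : ℤ) ∣ V z - V x - m * a ↔ z ≡ x + a [MOD n] := by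
  have h1 : V z - V x - m * a = (V z - m * z) - (V x - m * x) + m * (z - (x + a : ℕ)) := by
    push_cast
    ring
  have h2 : (n : ℤ) ∣ m * (z - (x + a : ℕ)) ↔ (n : ℤ) ∣ z - (x + a : ℕ) :=
    ⟨(Nat.isCoprime_iff_coprime.2 hnm).dvd_of_dvd_mul_left, fun h => h.mul_left _⟩
  rw [h1, dvd_add_right (dvd_sub (hV z) (hV x)), h2, ← Int.natCast_modEq_iff, Int.modEq_comm, Int.modEq_iff_dvd]

variable (hnm : Nat.Coprime n m) (hV : ∀ x, (n : ℤ) ∣ V x - m * x)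

include hnm hV

/-- By `inversion`, the columns of a higher class `u` lie all to the right of `x`, and the sum is
empty, or all to its left. In the second case two columns contribute: the one congruent to `x`
contributes `1`, and the one congruent to `x + 1` contributes `-1`. -/
theorem sum_class (h : IsClassFunction n m c p V κ) (hn : 1 < n) {x u : ℕ} (hx : x < c * n)
    (hu : u < c) (hxu : κ x < u) :
    ∑ z ∈ range x with κ z = u,
      ((multiplesIn n m (V z - V x) - multiplesIn n m (V z - V x - 1)) -
        (multiplesIn n m (V x - V z) - multiplesIn n m (V x - V z - 1))) = 0 := by
  have hd0 : ∀ x z, (n : ℤ) ∣ V z - V x ↔ z ≡ x [MOD n] := by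
    intro x z
    have := dvd_sub_iff hnm hV x z 0
    simpa using this
  have hd1 : ∀ x z, (n : ℤ) ∣ V z - V x - m ↔ z ≡ x + 1 [MOD n] := by
    intro x z
    have := dvd_sub_iff hnm hV x z 1
    simpa using this
  rcases h.inversion x hx u hu hxu with hgt | hlt
  · refine sum_eq_zero fun z hz => ?_
    rw [mem_filter, mem_range] at hz
    have := hgt z (by omega) hz.2
    omega
  · have hset : (range x).filter (fun z => κ z = u) = (range (c * n)).filter fun z => κ z = u := by
      ext z
      rw [mem_filter, mem_filter, mem_range, mem_range]
      exact ⟨fun hz => ⟨by omega, hz.2⟩, fun hz => ⟨(hlt z hz.1 hz.2).1, hz.2⟩⟩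
    obtain ⟨z₁, hz₁, hκ₁, hm₁⟩ := h.exists_mem (by omega) hu x
    obtain ⟨z₂, hz₂, hκ₂, hm₂⟩ := h.exists_mem (by omega) hu (x + 1)
    have hV₂ := (hlt z₂ hz₂ hκ₂).2 hm₂
    have h12 := h.next_le z₁ hz₁ z₂ hz₂ (hκ₁.trans hκ₂.symm) (hm₂.trans (hm₁.symm.add_right 1))
    have hterm : ∀ z ∈ (range (c * n)).filter (fun z => κ z = u),
        ((multiplesIn n m (V z - V x) - multiplesIn n m (V z - V x - 1)) -
        (multiplesIn n m (V x - V z) - multiplesIn n m (V x - V z - 1))) =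
        (if z = z₁ then 1 else 0) - if z = z₂ then 1 else 0 := by
      intro z hz
      rw [mem_filter, mem_range] at hz
      rw [multiplesIn_sub (by omega), multiplesIn_sub (by omega)]
      have e1 : ((n : ℤ) ∣ V z - V x ∧ 0 < V z - V x) ↔ z = z₁ := by
        constructor
        · rintro ⟨hdv, -⟩
          exact h.inj z hz.1 z₁ hz₁ (hz.2.trans hκ₁.symm) (((hd0 x z).1 hdv).trans hm₁.symm)
        · rintro rfl
          exact ⟨(hd0 x z).2 hm₁, by omega⟩
      have e2 : ((n : ℤ) ∣ V z - V x - m ∧ 0 < V z - V x - m) ↔ z = z₂ := by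
        constructor
        · rintro ⟨hdv, -⟩
          exact h.inj z hz.1 z₂ hz₂ (hz.2.trans hκ₂.symm) (((hd1 x z).1 hdv).trans hm₂.symm)
        · rintro rfl
          exact ⟨(hd1 x z).2 hm₂, by omega⟩
      have e3 : ¬ ((n : ℤ) ∣ V x - V z ∧ 0 < V x - V z) := by
        rintro ⟨hdv, hpos⟩
        have hzz := h.inj z hz.1 z₁ hz₁ (hz.2.trans hκ₁.symm) (((hd0 z x).1 hdv).symm.trans hm₁.symm)
        subst hzz
        omega
      have e4 : ¬ ((n : ℤ) ∣ V x - V z - m ∧ 0 < V x - V z - m) := by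
        rintro ⟨hdv, hpos⟩
        have := h.next_le z hz.1 z₁ hz₁ (hz.2.trans hκ₁.symm) (hm₁.trans ((hd1 z x).1 hdv))
        omega
      rw [if_congr e1 rfl rfl, if_congr e2 rfl rfl, if_neg e3, if_neg e4, sub_self, sub_zero]
    rw [hset, sum_congr rfl hterm, sum_sub_distrib, sum_ite_eq', sum_ite_eq', if_pos, if_pos,
      sub_self]
    · rw [mem_filter, mem_range]
      exact ⟨hz₂, hκ₂⟩
    · rw [mem_filter, mem_range]
      exact ⟨hz₁, hκ₁⟩

/-- Ties between two columns of equal residue may be broken by class or by position. For pairs in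
one class both conventions give the same value by `next_le`; for pairs in different classes the
discrepancies cancel class by class by `sum_class`. -/
theorem sum_multiplesIn (h : IsClassFunction n m c p V κ) (hn : 1 < n) :
    ∑ x ∈ range (c * n), ∑ z ∈ range (c * n),
      multiplesIn n m (V z - V x - if κ z ≤ κ x then 1 else 0) =
    ∑ x ∈ range (c * n), ∑ z ∈ range x,
      (multiplesIn n m (V z - V x - 1) + multiplesIn n m (V x - V z)) := by
  have hd0 : ∀ x z, (n : ℤ) ∣ V z - V x ↔ z ≡ x [MOD n] := by
    intro x z
    have := dvd_sub_iff hnm hV x z 0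
    simpa using this
  have hd1 : ∀ x z, (n : ℤ) ∣ V z - V x - m ↔ z ≡ x + 1 [MOD n] := by
    intro x z
    have := dvd_sub_iff hnm hV x z 1
    simpa using this
  have hn0 : (0 : ℤ) < n := by omega
  rw [sum_range_range_eq]
  swap
  · intro x
    have h1 : ((0 : ℤ) - 1) / n < 0 := Int.ediv_neg_of_neg_of_pos (by omega) hn0
    have h2 : ((0 : ℤ) - 1 - m) / n < 0 := Int.ediv_neg_of_neg_of_pos (by omega) hn0
    rw [if_pos le_rfl, sub_self, multiplesIn, multiplesUpTo, multiplesUpTo]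
    omega
  refine sum_congr rfl fun x hx => ?_
  rw [mem_range] at hx
  have hterm : ∀ z ∈ range x,
      multiplesIn n m (V z - V x - if κ z ≤ κ x then 1 else 0) +
        multiplesIn n m (V x - V z - if κ x ≤ κ z then 1 else 0) =
      (multiplesIn n m (V z - V x - 1) + multiplesIn n m (V x - V z)) +
        if κ x < κ z then ((multiplesIn n m (V z - V x) - multiplesIn n m (V z - V x - 1)) -
        (multiplesIn n m (V x - V z) - multiplesIn n m (V x - V z - 1))) else 0 := by
    intro z hz
    rw [mem_range] at hz
    rcases lt_trichotomy (κ x) (κ z) with hlt | heq | hgt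
    · rw [if_neg (by omega), if_pos hlt.le, if_pos hlt, sub_zero]
      ring
    · rw [if_pos heq.ge, if_pos heq.le, if_neg (by omega), add_zero]
      have hsub := multiplesIn_sub (m := m) (show 0 < n by omega) (V x - V z)
      rw [if_neg, if_neg] at hsub
      · linarith
      · rintro ⟨hdv, hpos⟩
        have := h.next_le z (by omega) x hx heq.symm ((hd1 z x).1 hdv)
        omega
      · rintro ⟨hdv, -⟩
        have := h.inj x hx z (by omega) heq ((hd0 z x).1 hdv)
        omega
    · rw [if_pos hgt.le, if_neg (by omega), if_neg (by omega), sub_zero, add_zero]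
  rw [sum_congr rfl hterm, sum_add_distrib, add_eq_left,
    ← sum_fiberwise_of_maps_to (s := range x) (t := range c) (g := κ)]
  swap
  · intro z hz
    rw [mem_range] at hz ⊢
    exact h.lt z (by omega)
  refine sum_eq_zero fun u hu => ?_
  rw [mem_range] at hu
  by_cases hxu : κ x < u
  · rw [← h.sum_class hnm hV hn hx hu hxu]
    refine sum_congr rfl fun z hz => ?_
    rw [mem_filter] at hz
    rw [hz.2, if_pos hxu]
  · refine sum_eq_zero fun z hz => ?_
    rw [mem_filter] at hz
    rw [hz.2, if_neg hxu]

end IsClassFunction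

end

end

section

open Finset

noncomputable section

/-! ## The semimodule of a Dyck path -/

namespace RationalDyckPath

variable {d n m : ℕ} (D : RationalDyckPath d n m)

/-- The generator of `Ψ_d(D)` attached to the column `x`. -/
def order (x : ℕ) : ℕ := d * (D.rank x).toNat + D.colClass x

theorem natCast_order (x : ℕ) : (D.order x : ℤ) = d * D.rank x + D.colClass x := by
  rw [order, Nat.cast_add, Nat.cast_mul, Int.toNat_of_nonneg (D.rank_nonneg x)]

open Classical in
/-- The least element of `Ψ_d(D)` in a given residue class modulo `d n`. -/
def minOrder (k : ZMod (d * n)) : ℕ :=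
  if h : ∃ x < d * n, (D.order x : ZMod (d * n)) = k then D.order h.choose else 0

theorem dvd_rank_sub (x : ℕ) : (n : ℤ) ∣ D.rank x - m * x :=
  ⟨-D.y x, by rw [rank_eq]; ring⟩

theorem perm_lt {i : ℕ} (j : ℕ) (hi : i < d) : D.perm j i < d := by
  by_contra! h
  have h1 : D.perm j (D.perm j i) = D.perm j i := D.permProd_apply_of_gt (by omega)
  have := (D.perm j).injective h1
  omega

theorem perm_mul_add_lt {i j : ℕ} (hi : i < d) (hj : j < n) : D.perm j i * n + j < d * n := by
  have h1 := D.perm_lt j hi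
  calc D.perm j i * n + j < D.perm j i * n + n := by omega
    _ = (D.perm j i + 1) * n := by ring
    _ ≤ d * n := Nat.mul_le_mul_right n h1

theorem colClass_perm {i j : ℕ} (hj : j < n) : D.colClass (D.perm j i * n + j) = i := by
  rw [colClass, mul_comm, Nat.mul_add_mod, Nat.mod_eq_of_lt hj, Nat.mul_add_div (by omega),
    Nat.div_eq_of_lt hj, add_zero, Equiv.symm_apply_apply]

theorem perm_colClass (x : ℕ) : D.perm (x % n) (D.colClass x) * n + x % n = x := by
  rw [colClass, Equiv.apply_symm_apply]
  exact Nat.div_add_mod' x n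

theorem mem_Psi_iff_exists (hn : 0 < n) (hκ : ∀ x < d * n, D.colClass x < d) {b : ℤ} :
    b ∈ D.Psi ↔ ∃ x < d * n, ∃ s : ℕ, b = D.order x + d * n * s := by
  have key : ∀ i j : ℕ, j < n → ((j : ℤ) * d * m + (d * m * n + 1) * i - d * n * D.c i j) =
      D.order (D.perm j i * n + j) := by
    intro i j hj
    rw [natCast_order, D.colClass_perm hj, c, rank_eq]
    push_cast
    ring
  constructor
  · rintro ⟨i, hi, j, hj, s, rfl⟩
    exact ⟨D.perm j i * n + j, D.perm_mul_add_lt hi hj, s, by rw [key i j hj]⟩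
  · rintro ⟨x, hx, s, rfl⟩
    refine ⟨D.colClass x, hκ x hx, x % n, Nat.mod_lt _ hn, s, ?_⟩
    rw [key _ _ (Nat.mod_lt _ hn), D.perm_colClass]

section

variable (hnm : Nat.Coprime n m) (hn : 1 < n) (hd : 0 < d)
include hnm hn hd

omit hnm in
theorem colClass_lt {x : ℕ} (hx : x < d * n) : D.colClass x < d := by
  obtain ⟨p, h⟩ := D.exists_isClassFunction hn hd
  exact h.lt x hx

theorem order_injOn {x z : ℕ} (hx : x < d * n) (hz : z < d * n)
    (h : (D.order x : ZMod (d * n)) = D.order z) : x = z := by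
  obtain ⟨p, hp⟩ := D.exists_isClassFunction hn hd
  rw [ZMod.natCast_eq_natCast_iff] at h
  have h1 : D.colClass x = D.colClass z := by
    have h2 : ∀ x, D.order x ≡ D.colClass x [MOD d] := fun x => by simp [order, Nat.ModEq]
    exact Nat.ModEq.eq_of_lt_of_lt ((h2 x).symm.trans ((h.of_mul_right n).trans (h2 z)))
      (hp.lt x hx) (hp.lt z hz)
  refine hp.inj x hx z hz h1 ?_
  rw [order, order, h1] at h
  have h3 := Nat.ModEq.mul_left_cancel' hd.ne' (Nat.ModEq.add_right_cancel' _ h)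
  have h4 := (Nat.modEq_iff_dvd.1 h3)
  rw [Int.toNat_of_nonneg (D.rank_nonneg x), Int.toNat_of_nonneg (D.rank_nonneg z)] at h4
  have := IsClassFunction.dvd_sub_iff hnm D.dvd_rank_sub x z 0
  rw [Nat.cast_zero, mul_zero, sub_zero, add_zero] at this
  exact (this.1 h4).symm

theorem exists_order (k : ZMod (d * n)) : ∃ x < d * n, (D.order x : ZMod (d * n)) = k := by
  have : NeZero (d * n) := ⟨by positivity⟩
  have h : Function.Bijective fun x : Fin (d * n) => (D.order x : ZMod (d * n)) := by
    rw [Fintype.bijective_iff_injective_and_card]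
    refine ⟨fun x z h => Fin.ext (D.order_injOn hnm hn hd x.2 z.2 h), ?_⟩
    rw [ZMod.card, Fintype.card_fin]
  obtain ⟨x, hx⟩ := h.2 k
  exact ⟨x, x.2, hx⟩

theorem minOrder_eq {x : ℕ} (hx : x < d * n) {k : ZMod (d * n)}
    (h : (D.order x : ZMod (d * n)) = k) : D.minOrder k = D.order x := by
  have h' : ∃ x < d * n, (D.order x : ZMod (d * n)) = k := ⟨x, hx, h⟩
  rw [minOrder, dif_pos h']
  congr 1
  exact D.order_injOn hnm hn hd h'.choose_spec.1 hx (h'.choose_spec.2.trans h.symm)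

theorem natCast_minOrder (k : ZMod (d * n)) : ((D.minOrder k : ℕ) : ZMod (d * n)) = k := by
  obtain ⟨x, hx, h⟩ := D.exists_order hnm hn hd k
  rw [D.minOrder_eq hnm hn hd hx h, h]

theorem sum_minOrder [NeZero (d * n)] {M : Type*} [AddCommMonoid M] (F : ℕ → M) :
    ∑ k, F (D.minOrder k) = ∑ x ∈ range (d * n), F (D.order x) := by
  symm
  refine sum_bij (fun x _ => (D.order x : ZMod (d * n))) (fun _ _ => mem_univ _) ?_ ?_ ?_
  · intro x hx z hz h
    exact D.order_injOn hnm hn hd (mem_range.1 hx) (mem_range.1 hz) h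
  · intro k _
    obtain ⟨x, hx, h⟩ := D.exists_order hnm hn hd k
    exact ⟨x, mem_range.2 hx, h⟩
  · intro x hx
    rw [D.minOrder_eq hnm hn hd (mem_range.1 hx) rfl]

theorem mem_Psi {b : ℤ} : b ∈ D.Psi ↔ (D.minOrder b : ℤ) ≤ b := by
  rw [D.mem_Psi_iff_exists (by omega) fun x hx => D.colClass_lt hn hd hx]
  constructor
  · rintro ⟨x, hx, s, rfl⟩
    rw [D.minOrder_eq hnm hn hd hx]
    · have : (0 : ℤ) ≤ d * n * s := by positivity
      omega
    · have h0 : ((d : ZMod (d * n)) * n) = 0 := by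
        rw [← Nat.cast_mul, ZMod.natCast_self]
      push_cast
      rw [h0]
      ring
  · intro h
    obtain ⟨x, hx, hxb⟩ := D.exists_order hnm hn hd b
    rw [D.minOrder_eq hnm hn hd hx hxb] at h
    have h1 : ((D.order x : ℤ) : ZMod (d * n)) = b := by rw [Int.cast_natCast, hxb]
    rw [ZMod.intCast_eq_intCast_iff_dvd_sub] at h1
    obtain ⟨s, hs⟩ := h1
    have hpos : (0 : ℤ) < (d * n : ℕ) := by positivity
    have hs0 : 0 ≤ s := by
      by_contra! hlt
      nlinarith
    refine ⟨x, hx, s.toNat, ?_⟩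
    rw [Int.toNat_of_nonneg hs0]
    push_cast at hs
    linarith

theorem mem_Psi_of_le {b : ℤ} {x : ℕ} (hx : x < d * n) (h : (D.order x : ZMod (d * n)) = b)
    (hle : (D.order x : ℤ) ≤ b) : b ∈ D.Psi := by
  rwa [D.mem_Psi hnm hn hd, D.minOrder_eq hnm hn hd hx h]

theorem exists_order_le {b : ℤ} (hb : b ∈ D.Psi) : ∃ x < d * n,
    (D.order x : ZMod (d * n)) = b ∧ (D.order x : ℤ) ≤ b := by
  obtain ⟨x, hx, h⟩ := D.exists_order hnm hn hd b
  refine ⟨x, hx, h, ?_⟩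
  rwa [D.mem_Psi hnm hn hd, D.minOrder_eq hnm hn hd hx h] at hb

omit hn hd in
theorem order_cast_eq {x z a : ℕ} {e e' : ℤ} (hκ : (D.colClass z : ℤ) = D.colClass x + e - d * e')
    (hzx : z ≡ x + a [MOD n]) (hee : (n : ℤ) ∣ e') :
    (D.order z : ZMod (d * n)) = ((D.order x + d * m * a + e : ℤ) : ZMod (d * n)) := by
  rw [← Int.cast_natCast (D.order z), ZMod.intCast_eq_intCast_iff_dvd_sub]
  have h1 := (IsClassFunction.dvd_sub_iff hnm D.dvd_rank_sub x z a).2 hzx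
  rw [natCast_order, natCast_order, hκ, Nat.cast_mul,
    show (d * D.rank x + D.colClass x + d * m * a + e - (d * D.rank z + (D.colClass x + e - d * e')) : ℤ) =
      d * (e' - (D.rank z - D.rank x - m * a)) by ring]
  exact mul_dvd_mul_left _ (dvd_sub hee h1)

theorem add_mem_Psi {b : ℤ} (hb : b ∈ D.Psi) : b + d * m ∈ D.Psi := by
  obtain ⟨x, hx, hxb, hle⟩ := D.exists_order_le hnm hn hd hb
  obtain ⟨p, h⟩ := D.exists_isClassFunction hn hd
  obtain ⟨z, hz, hκ, hzx⟩ := h.exists_mem (by omega) (h.lt x hx) (x + 1)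
  refine D.mem_Psi_of_le hnm hn hd hz ?_ ?_
  · rw [D.order_cast_eq hnm (e := 0) (e' := 0) (by omega) hzx (dvd_zero _)]
    push_cast
    rw [hxb]
    ring
  · have h1 := h.next_le x hx z hz hκ.symm hzx
    rw [natCast_order] at hle ⊢
    rw [hκ]
    have : (d * D.rank z : ℤ) ≤ d * (D.rank x + m) := by gcongr
    rw [mul_add] at this
    linarith

theorem add_mul_mem_Psi {b : ℤ} (hb : b ∈ D.Psi) (a : ℕ) : b + d * m * a ∈ D.Psi := by
  induction a with
  | zero => simpa using hb
  | succ a ih =>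
    have := D.add_mem_Psi hnm hn hd ih
    rwa [show b + d * m * a + d * m = b + d * m * (a + 1 : ℕ) by push_cast; ring] at this

theorem add_period_mem_Psi {b : ℤ} (hb : b ∈ D.Psi) (s : ℕ) : b + d * n * s ∈ D.Psi := by
  obtain ⟨x, hx, hxb, hle⟩ := D.exists_order_le hnm hn hd hb
  refine D.mem_Psi_of_le hnm hn hd hx ?_ ?_
  · have h0 : ((d : ZMod (d * n)) * n) = 0 := by
      rw [← Nat.cast_mul, ZMod.natCast_self]
    push_cast
    rw [h0, hxb]
    ring
  · have : (0 : ℤ) ≤ d * n * s := by positivity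
    omega

omit hnm in
theorem order_zero : D.order 0 = 0 := by
  obtain ⟨p, h⟩ := D.exists_isClassFunction hn hd
  rw [order, D.rank_zero, h.zero]
  simp

/-- This is admissibility. For `u + 1 < d` the link between the classes `u` and `u + 1` provides the
column. For the last class take a column with rank `≡ -m - 1` modulo `n`: its order plus `dm + 1` is
a nonnegative multiple of `dn`, and `0 ∈ Δ`. -/
theorem exists_add_succ_mem_Psi {u : ℕ} (hu : u < d) :
    ∃ x < d * n, D.colClass x = u ∧ (D.order x : ℤ) + d * m + 1 ∈ D.Psi := by
  obtain ⟨p, h⟩ := D.exists_isClassFunction hn hd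
  rcases Nat.lt_or_ge (u + 1) d with hu1 | hu1
  · obtain ⟨x, hx, z, hz, hκx, hκz, hzx, hle⟩ := h.link u hu1
    refine ⟨x, hx, hκx, D.mem_Psi_of_le hnm hn hd hz ?_ ?_⟩
    · rw [D.order_cast_eq hnm (e := 1) (e' := 0) (by omega) hzx (dvd_zero _)]
      push_cast
      ring
    · rw [natCast_order, natCast_order, hκx, hκz]
      have : (d * D.rank z : ℤ) ≤ d * (D.rank x + m) := by gcongr
      push_cast
      linarith
  -- With `a` the inverse of `m` modulo `n`, the choice `x₀ + 1 = a (n - 1) + n` gives `m (x₀ + 1) ≡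
  -- -1`.
  · obtain ⟨x₀, hx₀⟩ : ∃ x₀, m * (x₀ + 1) + 1 ≡ 0 [MOD n] := by
      obtain ⟨a, -, ha⟩ := Nat.exists_mul_mod_eq_one_of_coprime hnm.symm hn
      refine ⟨a * (n - 1) + (n - 1), ?_⟩
      have h1 : m * (a * (n - 1) + n - 1 + 1) + 1 ≡ 0 [MOD n] := by
        have h2 : m * (a * (n - 1) + n - 1 + 1) + 1 = (m * a) * (n - 1) + m * n + 1 := by
          rw [show a * (n - 1) + n - 1 + 1 = a * (n - 1) + n by omega]
          ring
        have h3 : m * a ≡ 1 [MOD n] := by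
          rw [Nat.ModEq, ha, Nat.mod_eq_of_lt hn]
        rw [h2]
        calc (m * a) * (n - 1) + m * n + 1 ≡ 1 * (n - 1) + 0 + 1 [MOD n] :=
              ((h3.mul_right _).add (by simp [Nat.ModEq])).add_right 1
          _ = n := by omega
          _ ≡ 0 [MOD n] := by simp [Nat.ModEq]
      rwa [show a * (n - 1) + (n - 1) = a * (n - 1) + n - 1 by omega]
    obtain ⟨x, hx, hκx, hxx⟩ := h.exists_mem (by omega) hu x₀
    have hx0 : (n : ℤ) ∣ D.rank x + m + 1 := by
      have h1 : m * (x + 1) + 1 ≡ 0 [MOD n] :=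
        (((hxx.add_right 1).mul_left m).add_right 1).trans hx₀
      rw [Nat.modEq_zero_iff_dvd, ← Int.natCast_dvd_natCast] at h1
      have h2 := dvd_add (D.dvd_rank_sub x) h1
      push_cast at h2
      rwa [show (D.rank x - m * x + (m * (x + 1) + 1) : ℤ) = D.rank x + m + 1 by ring] at h2
    have he : (D.order x : ℤ) + d * m + 1 = d * (D.rank x + m + 1) := by
      rw [natCast_order, hκx]
      have : (u : ℤ) + 1 = d := by omega
      linear_combination this
    refine ⟨x, hx, hκx, D.mem_Psi_of_le hnm hn hd (x := 0) (by omega) ?_ ?_⟩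
    · rw [D.order_zero hn hd, he, Nat.cast_zero, eq_comm, ZMod.intCast_zmod_eq_zero_iff_dvd,
        Nat.cast_mul]
      exact mul_dvd_mul_left _ hx0
    · rw [D.order_zero hn hd]
      positivity

/-- Decompose `dmn + 1 = a · dm + (dm + 1) + (n - 1 - a) · dm`. The first steps lead, within the
class of `b`, to the residue of the column with the admissible step; that step adds `dm + 1`, and
the remaining steps add multiples of `dm`. -/
theorem add_curveOrder_mem_Psi {b : ℤ} (hb : b ∈ D.Psi) : b + (d * m * n + 1) ∈ D.Psi := by
  obtain ⟨x, hx, hxb, hle⟩ := D.exists_order_le hnm hn hd hb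
  obtain ⟨p, h⟩ := D.exists_isClassFunction hn hd
  obtain ⟨x', hx', hκ, hadm⟩ := D.exists_add_succ_mem_Psi hnm hn hd (h.lt x hx)
  obtain ⟨a, ha, ha'⟩ : ∃ a < n, x' ≡ x + a [MOD n] := by
    obtain ⟨z, hz, hz', hzz⟩ := exists_modEq_mem_block (show 0 < n by omega) x x'
    refine ⟨z - x, by omega, ?_⟩
    rw [Nat.add_sub_cancel' hz]
    exact hzz.symm
  have h1 := D.order_cast_eq hnm (e := 0) (e' := 0) (by omega) ha' (dvd_zero _)
  have h2 : (D.order x' : ℤ) ≤ b + d * m * a := by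
    have h3 := D.add_mul_mem_Psi hnm hn hd hb a
    rw [D.mem_Psi hnm hn hd, D.minOrder_eq hnm hn hd hx'] at h3
    · exact h3
    · rw [h1]
      push_cast
      rw [hxb]
      ring
  obtain ⟨z, hz, hzb, hzle⟩ := D.exists_order_le hnm hn hd hadm
  have h4 : b + d * m * a + d * m + 1 ∈ D.Psi := by
    refine D.mem_Psi_of_le hnm hn hd hz ?_ (by omega)
    rw [hzb]
    push_cast
    rw [h1]
    push_cast
    rw [hxb]
    ring
  have h5 := D.add_mul_mem_Psi hnm hn hd h4 (n - 1 - a)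
  have h6 : (d * m * n : ℤ) = d * m * a + d * m + d * m * (n - 1 - a : ℕ) := by
    have : (n : ℤ) = a + 1 + (n - 1 - a : ℕ) := by omega
    rw [this]
    ring
  rwa [show b + d * m * a + d * m + 1 + d * m * (n - 1 - a : ℕ) = b + (d * m * n + 1) by
    rw [h6]; ring] at h5

theorem zero_mem_Psi : (0 : ℤ) ∈ D.Psi := by
  refine D.mem_Psi_of_le hnm hn hd (x := 0) (by positivity) ?_ ?_
  · rw [D.order_zero hn hd]
    simp
  · rw [D.order_zero hn hd]
    simp

theorem nonneg_of_mem_Psi {b : ℤ} (hb : b ∈ D.Psi) : 0 ≤ b :=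
  le_trans (by positivity) ((D.mem_Psi hnm hn hd).1 hb)

theorem genData_minOrder [NeZero d] : GenData d n m fun k => (D.minOrder k : ℤ) where
  add_le k := by
    have h : (D.minOrder k : ℤ) ∈ D.Psi := by
      rw [D.mem_Psi hnm hn hd, Int.cast_natCast, D.natCast_minOrder hnm hn hd]
    have h1 := (D.mem_Psi hnm hn hd).1 (D.add_mem_Psi hnm hn hd h)
    push_cast at h1 ⊢
    rwa [D.natCast_minOrder hnm hn hd] at h1
  adm i := by
    obtain ⟨x, hx, hκ, h⟩ := D.exists_add_succ_mem_Psi hnm hn hd (ZMod.val_lt i)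
    refine ⟨(D.order x : ℕ), ?_, ?_⟩
    · rw [map_natCast, order, hκ]
      simp
    · rw [D.mem_Psi hnm hn hd] at h
      rw [D.minOrder_eq hnm hn hd hx rfl]
      push_cast at h ⊢
      exact h

theorem sub_period_notMem_Psi {x : ℕ} (hx : x < d * n) : (D.order x : ℤ) - d * n ∉ D.Psi := by
  rw [D.mem_Psi hnm hn hd, D.minOrder_eq hnm hn hd hx, not_le]
  · have : (0 : ℤ) < d * n := by positivity
    omega
  · have h0 : ((d : ZMod (d * n)) * n) = 0 := by
      rw [← Nat.cast_mul, ZMod.natCast_self]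
    push_cast
    rw [h0, sub_zero]

end

/-- `Γ` is generated by `dn`, `dm` and `dmn + 1`, under each of which stability is already known. -/
theorem add_mem_Psi_of_mem_Γ (C : GenericBranch d n m) {a b : ℤ} (ha : a ∈ C.Γ) (hb : b ∈ D.Psi) :
    a + b ∈ D.Psi := by
  have : NeZero d := ⟨C.d_pos.ne'⟩
  have : NeZero n := ⟨(zero_lt_one.trans C.one_lt_n).ne'⟩
  have hnm := C.coprime
  have hn := C.one_lt_n
  have hd := C.d_pos
  rw [C.mem_Γ_iff] at ha
  obtain ⟨⟨i, j⟩, hij⟩ := (genEquiv d n m C.coprime).surjective (a : ZMod (d * n))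
  have hgen : C.gen (a : ZMod (d * n)) = genOrder d n m i j := by
    rw [← hij]
    exact semigroupGen_genEquiv _ _
  have h1 := C.natCast_gen (a : ZMod (d * n))
  rw [← Int.cast_natCast, ZMod.intCast_eq_intCast_iff_dvd_sub] at h1
  obtain ⟨s, hs⟩ := h1
  have hpos : (0 : ℤ) < (d * n : ℕ) := by positivity
  have hs0 : 0 ≤ s := by
    by_contra! hlt
    nlinarith
  obtain ⟨s, rfl⟩ := Int.eq_ofNat_of_zero_le hs0
  have h2 : ∀ i : ℕ, b + (d * m * n + 1) * i ∈ D.Psi := by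
    intro i
    induction i with
    | zero => simpa using hb
    | succ i ih =>
      have := D.add_curveOrder_mem_Psi hnm hn hd ih
      rwa [show b + (d * m * n + 1) * i + (d * m * n + 1) = b + (d * m * n + 1) * (i + 1 : ℕ) by
        push_cast; ring] at this
  have h3 := D.add_period_mem_Psi hnm hn hd (D.add_mul_mem_Psi hnm hn hd (h2 i) j) s
  have h4 : a = (d * m * n + 1) * i + d * m * j + d * n * s := by
    have h5 : a = C.gen (a : ZMod (d * n)) + (d * n : ℕ) * s := by linarith
    rw [hgen, genOrder] at h5
    rw [h5]
    push_cast
    ring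
  rw [h4]
  rwa [show (d * m * n + 1) * i + d * m * j + d * n * s + b =
    b + (d * m * n + 1) * i + d * m * j + d * n * (s : ℤ) by ring]

theorem Psi_mem_Adm (C : GenericBranch d n m) : D.Psi ∈ C.Adm := by
  have hnm := C.coprime
  have hn := C.one_lt_n
  have hd := C.d_pos
  refine ⟨fun b hb => D.nonneg_of_mem_Psi hnm hn hd hb, D.zero_mem_Psi hnm hn hd,
    fun a ha b hb => D.add_mem_Psi_of_mem_Γ C ha hb, fun i hi => ?_⟩
  obtain ⟨x, hx, hκ, h⟩ := D.exists_add_succ_mem_Psi hnm hn hd hi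
  refine ⟨D.order x, D.mem_Psi_of_le hnm hn hd hx (by simp) le_rfl,
    D.sub_period_notMem_Psi hnm hn hd hx, ?_, h⟩
  rw [natCast_order, hκ, Int.modEq_iff_dvd]
  exact ⟨-D.rank x, by ring⟩

end RationalDyckPath

end

end

section

open Finset

noncomputable section

/-! ## Counting gaps -/

section Gaps

variable {q : ℕ} [NeZero q] {α : ZMod q → ℕ}

/-- In the residue class `k` the gaps are `α k - q s` with `s ≥ 1`; those above `B` correspond to
the positive multiples of `q` up to `α k - B - 1`. -/
theorem card_filter_gaps (hα : ∀ k, ((α k : ℕ) : ZMod q) = k) {B : ℤ} (hB : -1 ≤ B) {L : ℕ}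
    (hL : ∀ k, α k ≤ L) :
    ((range L).filter fun a : ℕ => B < a ∧ a < α a).card =
      ∑ k, multiplesUpTo q (α k - B - 1) := by
  have hq : 0 < q := Nat.pos_of_neZero q
  rw [card_eq_sum_card_fiberwise (f := fun a : ℕ => (a : ZMod q)) (t := univ) fun _ _ => by simp]
  refine sum_congr rfl fun k _ => ?_
  set M := multiplesUpTo q (α k - B - 1)
  have hM : ∀ s : ℕ, 0 < s → s ≤ M → q * s ≤ α k := by
    intro s hs hsM
    have := (le_multiplesUpTo hq hs).1 hsM
    zify
    omega
  have h : (((range L).filter fun a : ℕ => B < a ∧ a < α a).filter fun a : ℕ => (a : ZMod q) = k) =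
      (Icc 1 M).image fun s => α k - q * s := by
    ext a
    rw [mem_filter, mem_filter, mem_range, mem_image]
    constructor
    · rintro ⟨⟨haL, hBa, haα⟩, rfl⟩
      have h1 := hα a
      rw [eq_comm, ZMod.natCast_eq_natCast_iff, Nat.modEq_iff_dvd' haα.le] at h1
      obtain ⟨s, hs⟩ := h1
      have hs0 : 0 < s := by
        rcases Nat.eq_zero_or_pos s with rfl | h
        · omega
        · exact h
      refine ⟨s, mem_Icc.2 ⟨hs0, (le_multiplesUpTo hq hs0).2 ?_⟩, by omega⟩
      zify [haα.le] at hs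
      rw [← hs]
      omega
    · rintro ⟨s, hs, rfl⟩
      rw [mem_Icc] at hs
      have h1 := hM s hs.1 hs.2
      have h2 := (le_multiplesUpTo hq hs.1).1 hs.2
      have h3 : 0 < q * s := Nat.mul_pos hq hs.1
      have h4 : ((α k - q * s : ℕ) : ZMod q) = k := by
        rw [Nat.cast_sub h1, hα]
        simp
      have := hL k
      refine ⟨⟨by omega, ?_, ?_⟩, h4⟩
      · push_cast [h1]
        omega
      · rw [h4]
        omega
  rw [h, card_image_of_injOn, Nat.card_Icc, Nat.add_sub_cancel]
  intro s hs s' hs' hss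
  rw [mem_coe, mem_Icc] at hs hs'
  have h1 := hM s hs.1 hs.2
  have h2 := hM s' hs'.1 hs'.2
  have hss' : α k - q * s = α k - q * s' := hss
  exact Nat.eq_of_mul_eq_mul_left hq (show q * s = q * s' by omega)

theorem card_filter_add (hα : ∀ k, ((α k : ℕ) : ZMod q) = k) (B : ℕ) {L : ℕ}
    (hL : ∀ k, α k ≤ L) :
    ((Icc 1 L).filter fun l : ℕ => B + l < α (B + l : ℕ)).card =
      ∑ k, multiplesUpTo q (α k - B - 1) := by
  rw [← card_filter_gaps hα (by omega) hL, ← card_image_of_injective _ (add_right_injective B)]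
  congr 1
  ext a
  rw [mem_image, mem_filter, mem_range]
  constructor
  · rintro ⟨l, hl, rfl⟩
    rw [mem_filter, mem_Icc] at hl
    have := hL (B + l : ℕ)
    refine ⟨by omega, by push_cast; omega, hl.2⟩
  · rintro ⟨h1, h2, h3⟩
    have h4 : B + (a - B) = a := by omega
    refine ⟨a - B, ?_, h4⟩
    rw [mem_filter, mem_Icc, h4]
    exact ⟨by omega, h3⟩

theorem ncard_compl_genOrders (hα : ∀ k, ((α k : ℕ) : ZMod q) = k) :
    {a : ℕ | α a ≤ a}ᶜ.ncard = ∑ k, multiplesUpTo q (α k) := by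
  have h := card_filter_gaps hα (B := -1) le_rfl (L := univ.sup α) fun k => le_sup (mem_univ k)
  simp only [sub_neg_eq_add, add_sub_cancel_right] at h
  rw [← h, ← Set.ncard_coe_finset]
  congr 1
  ext a
  rw [Set.mem_compl_iff, Set.mem_ofPred_eq, mem_coe, mem_filter, mem_range, not_le]
  exact ⟨fun h => ⟨h.trans_le (le_sup (mem_univ _)), by omega, h⟩, fun h => h.2.2⟩

end Gaps

theorem multiplesUpTo_mul {d n : ℕ} (δ : ℤ) : multiplesUpTo (d * n) δ = multiplesUpTo n (δ / d) := by
  rw [multiplesUpTo, multiplesUpTo, Nat.cast_mul, Int.ediv_ediv_of_nonneg (by positivity)]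

namespace GenericBranch

variable {d n m : ℕ} (C : GenericBranch d n m)

/-- The generator of `Γ` for `(i, j)` is `d m (i n + j) + i` with `i < d`, so the number of gaps in
its residue class is `⌊m (i n + j) / n⌋`, the height of column `i n + j` of `ℛ⁺`. -/
theorem delta_eq_card : C.delta = (triangleBoxes d n m).card := by
  have : NeZero d := ⟨C.d_pos.ne'⟩
  have : NeZero n := ⟨(zero_lt_one.trans C.one_lt_n).ne'⟩
  have hn : 0 < n := Nat.pos_of_neZero n
  rw [C.delta_eq, ncard_compl_genOrders C.natCast_gen, RationalDyckPath.card_triangleBoxes hn,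
    ← (genEquiv d n m C.coprime).sum_comp, sum_range, ← finProdFinEquiv.sum_comp]
  refine sum_congr rfl fun x _ => ?_
  have h1 : C.gen (genEquiv d n m C.coprime x) = genOrder d n m x.1 x.2 := semigroupGen_genEquiv _ _
  have h2 : ((genOrder d n m x.1 x.2 : ℕ) : ℤ) / d = m * (x.2 + n * x.1) := by
    have hd : (0 : ℤ) < d := by exact_mod_cast C.d_pos
    have := x.1.2
    rw [Int.ediv_eq_iff_of_pos hd, genOrder]
    push_cast
    constructor <;> nlinarith
  rw [h1, multiplesUpTo_mul, h2, multiplesUpTo, finProdFinEquiv_apply_val]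
  norm_cast

end GenericBranch

namespace RationalDyckPath

variable {d n m : ℕ} (D : RationalDyckPath d n m)

theorem mem_outside (hn : 0 < n) {z : ℕ × ℕ} :
    z ∈ triangleBoxes d n m \ D.boxes ↔ z.1 < d * n ∧ D.y z.1 < z.2 ∧ n * z.2 ≤ m * z.1 := by
  rw [mem_sdiff, D.mem_boxes hn, triangleBoxes, mem_filter, mem_product, mem_range, mem_Icc]
  constructor
  · rintro ⟨⟨⟨h1, h2, h3⟩, h4⟩, h5⟩
    exact ⟨h1, by omega, h4⟩
  · rintro ⟨h1, h2, h3⟩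
    refine ⟨⟨⟨h1, by omega, ?_⟩, h3⟩, by omega⟩
    have h4 : m * z.1 ≤ m * (d * n) := Nat.mul_le_mul_left m h1.le
    refine Nat.le_of_mul_le_mul_left (c := n) ?_ hn
    calc n * z.2 ≤ m * (d * n) := h3.trans h4
      _ = n * (d * m) := by ring

theorem enhancedRank_add (x s : ℕ) :
    D.enhancedRank (x, D.y x + s) = D.order x - (d * n : ℕ) * s := by
  rw [enhancedRank_eq, natCast_order, boxRank, rank_eq]
  push_cast
  ring

/-- Going up by `s` boxes from the top of column `x` lowers the enhanced rank from `order x` to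
`order x - dn s`. So the enhanced ranks of the boxes outside `D` run through the gaps of `Δ`, each
once. -/
theorem card_filter_enhancedRank (hn : 1 < n) (hd : 0 < d) (hκ : ∀ x < d * n, D.colClass x < d)
    {B : ℤ} (hB : -1 ≤ B) :
    ((triangleBoxes d n m \ D.boxes).filter fun z => B < D.enhancedRank z).card =
      ∑ x ∈ range (d * n), multiplesUpTo (d * n) (D.order x - B - 1) := by
  have hq : 0 < d * n := by positivity
  rw [card_eq_sum_card_fiberwise (f := Prod.fst) (t := range (d * n))]
  swap
  · intro z hz
    rw [mem_coe, mem_filter, D.mem_outside (by omega)] at hz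
    exact mem_coe.2 (mem_range.2 hz.1.1)
  refine sum_congr rfl fun x hx => ?_
  rw [mem_range] at hx
  set M := multiplesUpTo (d * n) (D.order x - B - 1)
  have h : (((triangleBoxes d n m \ D.boxes).filter fun z => B < D.enhancedRank z).filter
      fun z => z.1 = x) = (Icc 1 M).image fun s => (x, D.y x + s) := by
    ext ⟨x', y'⟩
    rw [mem_filter, mem_filter, D.mem_outside (by omega), mem_image]
    constructor
    · rintro ⟨⟨⟨h1, h2, h3⟩, h4⟩, rfl⟩
      dsimp only at h1 h2 h3 ⊢
      obtain ⟨s, rfl⟩ := Nat.exists_eq_add_of_lt h2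
      rw [add_assoc, enhancedRank_add] at h4
      refine ⟨s + 1, mem_Icc.2 ⟨by omega, (le_multiplesUpTo hq (by omega)).2 ?_⟩, rfl⟩
      change ((d * n : ℕ) : ℤ) * (s + 1 : ℕ) ≤ D.order x' - B - 1
      omega
    · rintro ⟨s, hs, hxy⟩
      rw [Prod.mk.injEq] at hxy
      obtain ⟨rfl, rfl⟩ := hxy
      rw [mem_Icc] at hs
      have h1 := (le_multiplesUpTo hq hs.1).1 hs.2
      have h2 : B < D.enhancedRank (x, D.y x + s) := by
        rw [enhancedRank_add]
        omega
      refine ⟨⟨⟨hx, by show D.y x < D.y x + s; omega, ?_⟩, h2⟩, rfl⟩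
      rw [enhancedRank_eq, boxRank] at h2
      have h3 := hκ x hx
      by_contra! hcon
      have h4 : (m * x : ℤ) - n * (D.y x + s : ℕ) ≤ -1 := by
        zify at hcon
        push_cast at hcon ⊢
        linarith
      have h5 : (d : ℤ) * ((m * x : ℤ) - n * (D.y x + s : ℕ)) ≤ d * (-1) := by gcongr
      have h6 : (D.colClass x : ℤ) < d := by exact_mod_cast h3
      linarith
  rw [h, card_image_of_injective, Nat.card_Icc, Nat.add_sub_cancel]
  intro s s' hss
  have := (Prod.mk.injEq _ _ _ _ ▸ hss).2
  omega

section

variable (hnm : Nat.Coprime n m) (hn : 1 < n) (hd : 0 < d)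
include hnm hn hd

theorem enhancedRank_notMem_Psi {z : ℕ × ℕ} (hz : z ∈ triangleBoxes d n m \ D.boxes) :
    D.enhancedRank z ∉ D.Psi := by
  rw [D.mem_outside (by omega)] at hz
  obtain ⟨x, y⟩ := z
  obtain ⟨h1, h2, h3⟩ := hz
  dsimp only at h1 h2 h3
  obtain ⟨s, rfl⟩ := Nat.exists_eq_add_of_lt h2
  rw [add_assoc, enhancedRank_add, D.mem_Psi hnm hn hd, D.minOrder_eq hnm hn hd h1, not_le]
  · have : (0 : ℤ) < (d * n : ℕ) * (s + 1 : ℕ) := by positivity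
    omega
  · rw [Int.cast_sub, Int.cast_mul, Int.cast_natCast (d * n), ZMod.natCast_self, zero_mul, sub_zero,
      Int.cast_natCast]

theorem setOf_mem_Psi : {a : ℕ | (a : ℤ) ∈ D.Psi} = {a : ℕ | D.minOrder a ≤ a} := by
  ext a
  rw [Set.mem_ofPred_eq, Set.mem_ofPred_eq, D.mem_Psi hnm hn hd, Int.cast_natCast, Nat.cast_le]

theorem ncard_compl_minOrder :
    {a : ℕ | D.minOrder a ≤ a}ᶜ.ncard = (triangleBoxes d n m \ D.boxes).card := by
  have : NeZero (d * n) := ⟨by positivity⟩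
  have hκ : ∀ x < d * n, D.colClass x < d := fun x hx => D.colClass_lt hn hd hx
  have h := D.card_filter_enhancedRank hn hd hκ (B := -1) le_rfl
  rw [ncard_compl_genOrders (D.natCast_minOrder hnm hn hd),
    D.sum_minOrder hnm hn hd fun a => multiplesUpTo (d * n) a]
  simp only [sub_neg_eq_add, add_sub_cancel_right] at h
  rw [← h]
  congr 1
  rw [filter_eq_self]
  intro z hz
  rw [D.mem_outside (by omega)] at hz
  have h1 : 0 ≤ boxRank n m z.1 z.2 := by
    rw [boxRank]
    have := hz.2.2
    zify at this
    linarith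
  rw [enhancedRank_eq]
  have : 0 ≤ (d : ℤ) * boxRank n m z.1 z.2 := by positivity
  omega

/-- The gaps of `Δ` lie below or above `τ₀`, which is itself not a gap. -/
theorem epsilonHat_add_card {τ₀ : ℕ} (hτ : (τ₀ : ℤ) ∈ D.Psi) :
    D.epsilonHat τ₀ + ∑ x ∈ range (d * n), multiplesUpTo (d * n) (D.order x - τ₀ - 1) =
      (triangleBoxes d n m \ D.boxes).card := by
  have hκ : ∀ x < d * n, D.colClass x < d := fun x hx => D.colClass_lt hn hd hx
  rw [← D.card_filter_enhancedRank hn hd hκ (by omega), epsilonHat,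
    ← card_filter_add_card_filter_not (s := triangleBoxes d n m \ D.boxes)
      fun z => D.enhancedRank z < τ₀]
  congr 2
  refine filter_congr fun z hz => ?_
  have h1 := D.enhancedRank_notMem_Psi hnm hn hd hz
  have h2 : D.enhancedRank z ≠ τ₀ := fun h => h1 (h ▸ hτ)
  omega

omit hnm in
-- Integer division by `d` of a difference of orders, lowered by one, leaves the difference of
-- ranks, lowered by one exactly when the class of `z` does not exceed that of `x`. This is the
-- source of tie-breaking by classes.
theorem multiplesUpTo_order_sub {x z : ℕ} (hx : x < d * n) (hz : z < d * n) :
    (multiplesUpTo (d * n) (D.order z - D.order x - 1) : ℤ) -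
        multiplesUpTo (d * n) (D.order z - (D.order x + d * m : ℕ) - 1) =
      multiplesIn n m (D.rank z - D.rank x - if D.colClass z ≤ D.colClass x then 1 else 0) := by
  have hκx : (D.colClass x : ℤ) < d := by exact_mod_cast D.colClass_lt hn hd hx
  have hκz : (D.colClass z : ℤ) < d := by exact_mod_cast D.colClass_lt hn hd hz
  have hd' : (0 : ℤ) < d := by exact_mod_cast hd
  have h1 : ((D.order z : ℤ) - D.order x - 1) / d =
      D.rank z - D.rank x - if D.colClass z ≤ D.colClass x then 1 else 0 := by
    rw [Int.ediv_eq_iff_of_pos hd', natCast_order, natCast_order]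
    split_ifs with h
    · constructor <;> nlinarith
    · constructor <;> nlinarith
  have h2 : ((D.order z : ℤ) - (D.order x + d * m : ℕ) - 1) / d =
      D.rank z - D.rank x - (if D.colClass z ≤ D.colClass x then 1 else 0) - m := by
    rw [← h1, show ((D.order z : ℤ) - (D.order x + d * m : ℕ) - 1) =
      (D.order z - D.order x - 1) + d * (-m) by push_cast; ring, Int.add_mul_ediv_left _ _ hd'.ne']
    ring
  rw [multiplesUpTo_mul, multiplesUpTo_mul, h1, h2, multiplesIn]

/-- The left-hand side is the number of unknowns minus the number of equations for `y f_k`, before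
the condition on `t^{τ₀}`. -/
theorem sum_multiplesUpTo (hm : 0 < m) :
    ∑ x ∈ range (d * n), ∑ z ∈ range (d * n),
        ((multiplesUpTo (d * n) (D.order z - D.order x - 1) : ℤ) -
        multiplesUpTo (d * n) (D.order z - (D.order x + d * m : ℕ) - 1)) =
      D.specialBoxes.card + (triangleBoxes d n m \ D.boxes).card := by
  obtain ⟨p, h⟩ := D.exists_isClassFunction hn hd
  rw [D.card_specialBoxes (by omega) hm, ← h.sum_multiplesIn hnm D.dvd_rank_sub hn]
  refine sum_congr rfl fun x hx => sum_congr rfl fun z hz => ?_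
  exact D.multiplesUpTo_order_sub hn hd (mem_range.1 hx) (mem_range.1 hz)

end

end RationalDyckPath

end

end

section

open Finset
open scoped PowerSeries LaurentSeries

noncomputable section

/-! ## The dimension of the cells -/

namespace RationalDyckPath

variable {d n m : ℕ} (D : RationalDyckPath d n m)

theorem ncard_compl_shiftedOrders (C : GenericBranch d n m) [NeZero d] [NeZero n] (s : ℕ) :
    (C.shiftedOrders s)ᶜ.ncard = s + C.delta := by
  have hfin : {a : ℕ | C.gen a ≤ a}ᶜ.Finite := C.hasOrders_localRing.finite_compl
  have h : (C.shiftedOrders s)ᶜ = Set.Iio s ∪ (fun b => s + b) '' {a : ℕ | C.gen a ≤ a}ᶜ := by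
    ext a
    rw [Set.mem_compl_iff, Set.mem_union, Set.mem_Iio, Set.mem_image]
    constructor
    · intro ha
      rcases Nat.lt_or_ge a s with hlt | hge
      · exact Or.inl hlt
      · refine Or.inr ⟨a - s, fun h => ha ⟨a - s, h, by omega⟩, by omega⟩
    · rintro (hlt | ⟨b, hb, rfl⟩)
      · rintro ⟨b, -, rfl⟩
        omega
      · rintro ⟨b', hb', hbb⟩
        obtain rfl : b = b' := by omega
        exact hb hb'
  rw [h, Set.ncard_union_eq ?_ (Set.finite_Iio s) (hfin.image _), Set.ncard_image_of_injective _ (add_right_injective s), C.delta_eq]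
  · congr 1
    rw [← Finset.coe_Iio, Set.ncard_coe_finset, Nat.card_Iio]
  · rw [Set.disjoint_left]
    rintro a ha ⟨b, -, hb⟩
    rw [Set.mem_Iio] at ha
    dsimp only at hb
    omega

theorem delta_eq_add (C : GenericBranch d n m) :
    C.delta = (triangleBoxes d n m \ D.boxes).card + D.size := by
  rw [C.delta_eq_card, ← D.card_boxes (zero_lt_one.trans C.one_lt_n)]
  exact (card_sdiff_add_card_eq_card (filter_subset _ _)).symm

/-- The set `β` enumerates has the right size: `τ₀ + Γ` has `τ₀ + δ` gaps, `Δ` has `δ - |D|`, and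
the first set of gaps contains the second. -/
theorem exists_cellData (C : GenericBranch d n m) [NeZero d] [NeZero n] {τ₀ : ℕ}
    (hτ : (τ₀ : ℤ) ∈ D.Psi) :
    ∃ β, C.CellData D.minOrder τ₀ (τ₀ + D.size) β := by
  have hnm := C.coprime
  have hn := C.one_lt_n
  have hd := C.d_pos
  have hα := D.natCast_minOrder hnm hn hd
  have hsub : C.shiftedOrders τ₀ ⊆ genOrders D.minOrder := by
    rintro a ⟨b, hb, rfl⟩
    have h1 : (b : ℤ) ∈ C.Γ := C.mem_Γ_iff.2 (by exact_mod_cast hb)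
    have h2 := D.add_mem_Psi_of_mem_Γ C h1 hτ
    rw [D.mem_Psi hnm hn hd] at h2
    change D.minOrder _ ≤ _
    rw [add_comm]
    exact_mod_cast h2
  have hfin : (genOrders D.minOrder \ C.shiftedOrders τ₀).Finite :=
    (C.hasOrders_shiftedRing τ₀).finite_compl.subset fun a ha => ha.2
  have hcard : hfin.toFinset.card = τ₀ + D.size := by
    rw [← Set.ncard_eq_toFinset_card _ hfin]
    have h1 : genOrders D.minOrder \ C.shiftedOrders τ₀ =
        (C.shiftedOrders τ₀)ᶜ \ (genOrders D.minOrder)ᶜ := by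
      ext a
      simp only [Set.mem_sdiff, Set.mem_compl_iff, not_not]
      exact and_comm
    have h2 := Set.ncard_sdiff_add_ncard_of_subset (Set.compl_subset_compl.2 hsub)
      (C.hasOrders_shiftedRing τ₀).finite_compl
    have h3 := D.ncard_compl_minOrder hnm hn hd
    rw [h1]
    have h4 := ncard_compl_shiftedOrders C τ₀
    have h5 := D.delta_eq_add C
    change (genOrders D.minOrder)ᶜ.ncard = _ at h3
    omega
  refine ⟨hfin.toFinset.orderEmbOfFin hcard, hα, D.genData_minOrder hnm hn hd, ?_, hsub,
    (hfin.toFinset.orderEmbOfFin hcard).injective, ?_⟩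
  · rw [D.mem_Psi hnm hn hd] at hτ
    exact_mod_cast hτ
  · rw [range_orderEmbOfFin, Set.Finite.coe_toFinset]

theorem e_Psi (C : GenericBranch d n m) : C.e D.Psi = D.size := by
  have hnm := C.coprime
  have hn := C.one_lt_n
  have hd := C.d_pos
  rw [GenericBranch.e, gapCount_eq_ncard, D.setOf_mem_Psi hnm hn hd,
    D.ncard_compl_minOrder hnm hn hd, D.delta_eq_add C]
  push_cast
  ring

open Classical in
-- For fixed `k` the orders of the unknowns are the distances to the gaps beyond `α k`. The next two
-- lemmas are the same count with starting points `α k + p` and `s`.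
theorem sum_card_isVar [NeZero d] [NeZero n] {α : ZMod (d * n) → ℕ}
    (hα : ∀ k, ((α k : ℕ) : ZMod (d * n)) = k) :
    ∑ l ∈ Icc 1 (univ.sup α), (univ.filter (IsVar (fun k => (α k : ℤ)) l)).card =
      ∑ k, ∑ k', multiplesUpTo (d * n) (α k' - α k - 1) := by
  simp_rw [card_filter]
  rw [sum_comm]
  refine sum_congr rfl fun k _ => ?_
  rw [← card_filter_add hα (α k) fun k => le_sup (mem_univ k), card_filter]
  refine sum_congr rfl fun l _ => if_congr ?_ rfl rfl
  rw [IsVar]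
  push_cast
  rw [hα]
  norm_cast

open Classical in
theorem sum_card_isEqn [NeZero d] [NeZero n] {α : ZMod (d * n) → ℕ}
    (hα : ∀ k, ((α k : ℕ) : ZMod (d * n)) = k) (p : ℕ) :
    ∑ l ∈ Icc 1 (univ.sup α), (univ.filter (IsEqn (fun k => (α k : ℤ)) p l)).card =
      ∑ k, ∑ k', multiplesUpTo (d * n) (α k' - (α k + p : ℕ) - 1) := by
  simp_rw [card_filter]
  rw [sum_comm]
  refine sum_congr rfl fun k _ => ?_
  rw [← card_filter_add hα (α k + p) fun k => le_sup (mem_univ k), card_filter]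
  refine sum_congr rfl fun l _ => if_congr ?_ rfl rfl
  rw [IsEqn]
  push_cast
  rw [hα]
  norm_cast

open Classical in
theorem sum_isPin [NeZero d] [NeZero n] {α : ZMod (d * n) → ℕ}
    (hα : ∀ k, ((α k : ℕ) : ZMod (d * n)) = k) (s : ℕ) :
    (∑ l ∈ Icc 1 (univ.sup α), if IsPin (fun k => (α k : ℤ)) (s : ℤ) l then 1 else 0) =
      ∑ k', multiplesUpTo (d * n) (α k' - s - 1) := by
  rw [← card_filter_add hα s fun k => le_sup (mem_univ k), card_filter]
  refine sum_congr rfl fun l _ => if_congr ?_ rfl rfl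
  rw [IsPin]
  push_cast
  norm_cast

theorem topologicalKrullDim_cell (C : GenericBranch d n m) {τ₀ : ℕ} (hτ : (τ₀ : ℤ) ∈ D.Psi) :
    topologicalKrullDim (C.cell D.Psi (τ₀ + D.size)) =
      ((D.specialBoxes.card + D.epsilonHat τ₀ : ℕ) : WithBot ℕ∞) := by
  classical
  have : NeZero d := ⟨C.d_pos.ne'⟩
  have : NeZero n := ⟨(zero_lt_one.trans C.one_lt_n).ne'⟩
  have hnm := C.coprime
  have hn := C.one_lt_n
  have hd := C.d_pos
  have hα := D.natCast_minOrder hnm hn hd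
  obtain ⟨β, h⟩ := D.exists_cellData C hτ
  rw [h.topologicalKrullDim_cell (fun b hb => D.nonneg_of_mem_Psi hnm hn hd hb)
    (D.setOf_mem_Psi hnm hn hd) (by rw [D.e_Psi C]; push_cast; ring)]
  have hY : C.yCoeff 0 = 1 := C.coeff_dm
  have hY1 : C.yCoeff 1 ≠ 0 := C.coeff_succ_ne_zero
  obtain ⟨N, hN, hS⟩ := isAffineOfDim_solutionSet h.genData hnm hY hY1 (s := (τ₀ : ℤ))
    (by rw [Int.cast_natCast]; exact_mod_cast h.le) (L := univ.sup D.minOrder)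
    fun l k hl => GenericBranch.isVar_le_sup hl
  rw [hS.topologicalKrullDim_eq]
  congr 1
  rw [sum_add_distrib, sum_card_isVar hα, sum_card_isEqn hα, sum_isPin hα] at hN
  have h1 := D.sum_multiplesUpTo hnm hn hd (zero_lt_one.trans (hn.trans C.n_lt_m))
  have h2 := D.epsilonHat_add_card hnm hn hd hτ
  have h3 : ∀ B : ℤ, ∑ k, multiplesUpTo (d * n) (D.minOrder k - B - 1) =
      ∑ x ∈ range (d * n), multiplesUpTo (d * n) (D.order x - B - 1) := fun B =>
    D.sum_minOrder hnm hn hd fun a => multiplesUpTo (d * n) (a - B - 1)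
  simp_rw [h3] at hN
  rw [D.sum_minOrder hnm hn hd fun a => ∑ z ∈ range (d * n),
      multiplesUpTo (d * n) (D.order z - (a + d * m : ℕ) - 1),
    D.sum_minOrder hnm hn hd fun a => ∑ z ∈ range (d * n),
      multiplesUpTo (d * n) (D.order z - a - 1)] at hN
  simp_rw [sum_sub_distrib] at h1
  zify at hN h2 ⊢
  push_cast at h1
  linarith

end RationalDyckPath

end

end

section

open Finset

noncomputable section

/-! ## Ranks and the numbers `ε` -/

section Decomposition

/-- Division by `d` gives `k` and `r`; then `ℓ` is the solution of `m ℓ ≡ r` modulo `n`. The bound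
on `h` expresses `r ≥ 0` and is automatic. -/
theorem existsUnique_decomposition {d n m : ℕ} (hnm : Nat.Coprime n m) (hn : 0 < n) (hd : 0 < d)
    (τ₀ : ℕ) :
    ∃! q : ℕ × ℕ × ℤ, q.1 < d ∧ q.2.1 < n ∧ q.2.2 ≤ ((m * q.2.1 / n : ℕ) : ℤ) ∧
      (τ₀ : ℤ) = d * (m * q.2.1 - n * q.2.2) + q.1 := by
  have hn' : (0 : ℤ) < n := by exact_mod_cast hn
  have hd' : (0 : ℤ) < d := by exact_mod_cast hd
  obtain ⟨ℓ, hℓ, hdvd⟩ : ∃ ℓ < n, (n : ℤ) ∣ m * ℓ - (τ₀ / d : ℕ) := by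
    obtain ⟨u, v, huv⟩ := Nat.isCoprime_iff_coprime.2 hnm
    refine ⟨((v * (τ₀ / d : ℕ)) % n).toNat, ?_, ?_⟩
    · have := Int.emod_lt_of_pos (v * (τ₀ / d : ℕ)) hn'
      omega
    · rw [Int.toNat_of_nonneg (Int.emod_nonneg _ hn'.ne'), Int.emod_def]
      refine ⟨-(m * ((v * (τ₀ / d : ℕ)) / n)) - u * (τ₀ / d : ℕ), ?_⟩
      linear_combination (τ₀ / d : ℕ) * huv
  obtain ⟨h, hh⟩ := hdvd
  have hτ : (τ₀ : ℤ) = d * (τ₀ / d : ℕ) + (τ₀ % d : ℕ) := by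
    exact_mod_cast (Nat.div_add_mod τ₀ d).symm
  refine ⟨(τ₀ % d, ℓ, h), ⟨Nat.mod_lt _ hd, hℓ, ?_, ?_⟩, ?_⟩
  · rw [Int.natCast_div, Int.le_ediv_iff_mul_le hn', Nat.cast_mul]
    have : (0 : ℤ) ≤ (τ₀ / d : ℕ) := by positivity
    linarith
  · linear_combination hτ - d * hh
  · rintro ⟨k', ℓ', h'⟩ ⟨hk', hℓ', -, hτ'⟩
    dsimp only at hk' hℓ' hτ'
    have h1 : ((τ₀ / d : ℕ) : ℤ) = m * ℓ' - n * h' := by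
      rw [Int.natCast_div, hτ', Int.ediv_eq_iff_of_pos hd']
      constructor <;> linarith
    have h2 : (k' : ℤ) = (τ₀ % d : ℕ) := by
      rw [← h1] at hτ'
      linarith
    have h3 : (n : ℤ) ∣ m * (ℓ - ℓ') := ⟨h - h', by linear_combination hh + h1⟩
    have h4 := (Nat.isCoprime_iff_coprime.2 hnm).dvd_of_dvd_mul_left h3
    have h5 : ℓ' = ℓ := Nat.ModEq.eq_of_lt_of_lt (Nat.modEq_iff_dvd.2 h4) hℓ' hℓ
    subst h5
    have h6 : (n : ℤ) * h' = n * h := by linarith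
    rw [Prod.mk.injEq, Prod.mk.injEq]
    exact ⟨by exact_mod_cast h2, rfl, mul_left_cancel₀ hn'.ne' h6⟩

end Decomposition

namespace RationalDyckPath

variable {d n m : ℕ} (D : RationalDyckPath d n m)

section

variable (hnm : Nat.Coprime n m) (hn : 1 < n) (hd : 0 < d)
include hnm hn hd

theorem mem_Psi_iff_rank_le {b r : ℤ} {k ℓ : ℕ} (hk : k < d) (hℓ : ℓ < n)
    (hr : (n : ℤ) ∣ m * ℓ - r) (hb : b = d * r + k) :
    b ∈ D.Psi ↔ D.rank (D.perm ℓ k * n + ℓ) ≤ r := by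
  set x := D.perm ℓ k * n + ℓ with hx
  have hκ : D.colClass x = k := D.colClass_perm hℓ
  have hd' : (0 : ℤ) < d := by exact_mod_cast hd
  rw [D.mem_Psi hnm hn hd, D.minOrder_eq hnm hn hd (D.perm_mul_add_lt hk hℓ), natCast_order, hκ, hb,
    add_le_add_iff_right, mul_le_mul_iff_right₀ hd']
  rw [← Int.cast_natCast (D.order _), natCast_order, hκ, ZMod.intCast_eq_intCast_iff_dvd_sub, hb,
    Nat.cast_mul, show (d * r + k - (d * D.rank x + k) : ℤ) = d * (r - D.rank x) by ring]
  refine mul_dvd_mul_left _ ?_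
  have h1 := D.dvd_rank_sub x
  have h2 : r - D.rank x = -(D.rank x - m * x) - (m * ℓ - r) - n * (m * D.perm ℓ k) := by
    rw [hx]
    push_cast
    ring
  rw [h2]
  exact dvd_sub (dvd_sub (dvd_neg.2 h1) hr) (dvd_mul_right _ _)

/-- The columns that can contain a box of rank `r` are those congruent to `ℓ` modulo `n`, one in
each class `i`. The box lies outside `D` when the rank of that column exceeds `r`, and the condition
on its enhanced rank `d r + i` is `i < k`. -/
theorem card_filter_rank_eq {r : ℤ} (hr0 : 0 ≤ r) {k ℓ : ℕ} (hk : k < d) (hℓ : ℓ < n)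
    (hr : (n : ℤ) ∣ m * ℓ - r) :
    ((triangleBoxes d n m \ D.boxes).filter fun z =>
      boxRank n m z.1 z.2 = r ∧ D.enhancedRank z < d * r + k).card =
      ((range k).filter fun i => r < D.rank (D.perm ℓ i * n + ℓ)).card := by
  have hn' : (0 : ℤ) < n := by omega
  have hd' : (0 : ℤ) < d := by omega
  have hcol : ∀ z : ℕ × ℕ, boxRank n m z.1 z.2 = r →
      D.perm ℓ (D.colClass z.1) * n + ℓ = z.1 := by
    intro z hz
    have h1 : z.1 ≡ ℓ [MOD n] := by
      have h2 : (n : ℤ) ∣ m * (z.1 - ℓ) := by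
        rw [show (m * (z.1 - ℓ) : ℤ) = n * z.2 - (m * ℓ - r) by rw [← hz, boxRank]; ring]
        exact dvd_sub (dvd_mul_right _ _) hr
      have h3 := (Nat.isCoprime_iff_coprime.2 hnm).dvd_of_dvd_mul_left h2
      exact ((Nat.modEq_iff_dvd).2 h3).symm
    have h4 : z.1 % n = ℓ := by rw [h1, Nat.mod_eq_of_lt hℓ]
    have h5 := D.perm_colClass z.1
    rwa [h4] at h5
  refine card_bij (fun z _ => D.colClass z.1) ?_ ?_ ?_
  · intro z hz
    rw [mem_filter, D.mem_outside (by omega)] at hz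
    obtain ⟨⟨h1, h2, h3⟩, h4, h5⟩ := hz
    rw [enhancedRank_eq, h4] at h5
    rw [mem_filter, mem_range, hcol z h4]
    refine ⟨by omega, ?_⟩
    rw [← h4, rank_eq, boxRank]
    have : (n : ℤ) * D.y z.1 < n * z.2 := by
      have : (D.y z.1 : ℤ) < z.2 := by exact_mod_cast h2
      gcongr
    linarith
  · intro z hz z' hz' hzz
    rw [mem_filter] at hz hz'
    have h1 := hcol z hz.2.1
    have h2 := hcol z' hz'.2.1
    have h3 : z.1 = z'.1 := by rw [← h1, ← h2, hzz]
    refine Prod.ext h3 ?_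
    have h4 := hz.2.1.trans hz'.2.1.symm
    rw [boxRank, boxRank, h3] at h4
    have h5 : (n : ℤ) * z.2 = n * z'.2 := by linarith
    exact_mod_cast mul_left_cancel₀ hn'.ne' h5
  · intro i hi
    rw [mem_filter, mem_range] at hi
    set x := D.perm ℓ i * n + ℓ with hx
    obtain ⟨c, hc⟩ : (n : ℤ) ∣ m * x - r := by
      rw [show (m * x - r : ℤ) = m * ℓ - r + n * (m * D.perm ℓ i) by rw [hx]; push_cast; ring]
      exact dvd_add hr (dvd_mul_right _ _)
    have hlt : (D.y x : ℤ) < c := by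
      have h1 := hi.2
      rw [rank_eq] at h1
      by_contra! hle
      have : (n : ℤ) * c ≤ n * D.y x := by gcongr
      linarith
    obtain ⟨c, rfl⟩ := Int.eq_ofNat_of_zero_le (show 0 ≤ c by omega)
    have hbox : boxRank n m x c = r := by
      rw [boxRank]
      linarith
    have hκ : D.colClass x = i := D.colClass_perm hℓ
    refine ⟨(x, c), ?_, hκ⟩
    rw [mem_filter, D.mem_outside (by omega), enhancedRank_eq]
    dsimp only
    rw [hbox, hκ]
    refine ⟨⟨D.perm_mul_add_lt (by omega) hℓ, by omega, ?_⟩, rfl, by omega⟩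
    zify
    linarith

omit hnm in
-- Enhanced ranks of boxes of rank `ρ` lie in `[d ρ, d ρ + d)`, so only the boxes with `ρ = r`
-- require a comparison.
theorem epsilonHat_eq {τ₀ k : ℕ} {r : ℤ} (hk : k < d) (hτ : (τ₀ : ℤ) = d * r + k) :
    D.epsilonHat τ₀ =
      ((triangleBoxes d n m \ D.boxes).filter fun z => boxRank n m z.1 z.2 < r).card +
        ((triangleBoxes d n m \ D.boxes).filter fun z =>
          boxRank n m z.1 z.2 = r ∧ D.enhancedRank z < τ₀).card := by
  rw [epsilonHat, ← card_union_of_disjoint, ← filter_or]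
  · congr 1
    refine filter_congr fun z hz => ?_
    rw [D.mem_outside (by omega)] at hz
    have h1 := D.colClass_lt hn hd hz.1
    rw [enhancedRank_eq]
    constructor
    · intro h
      rcases lt_trichotomy (boxRank n m z.1 z.2) r with hlt | heq | hgt
      · exact Or.inl hlt
      · exact Or.inr ⟨heq, h⟩
      · exfalso
        have : (d : ℤ) * (r + 1) ≤ d * boxRank n m z.1 z.2 := by gcongr; omega
        rw [mul_add] at this
        omega
    · rintro (hlt | ⟨-, h⟩)
      · have : (d : ℤ) * (boxRank n m z.1 z.2 + 1) ≤ d * r := by gcongr; omega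
        rw [mul_add] at this
        omega
      · exact h
  · rw [disjoint_filter]
    intro z _ h1 h2
    omega

end

/-- If `τ₀ ∈ Γ`, then `r ≥ m ℓ + k m n`. For `i < k` the element `ℓ dm + i (dmn + 1)` of `Γ ⊆ Δ`
bounds the rank of the column of class `i` by `m ℓ + i m n`. -/
theorem rank_le_of_mem_Γ (C : GenericBranch d n m) {τ₀ : ℕ} {r : ℤ} {k ℓ : ℕ} (hk : k < d)
    (hℓ : ℓ < n) (hr : (n : ℤ) ∣ m * ℓ - r) (hτ : (τ₀ : ℤ) = d * r + k) (hΓ : (τ₀ : ℤ) ∈ C.Γ)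
    {i : ℕ} (hi : i < k) : D.rank (D.perm ℓ i * n + ℓ) ≤ r := by
  have : NeZero d := ⟨C.d_pos.ne'⟩
  have : NeZero n := ⟨(zero_lt_one.trans C.one_lt_n).ne'⟩
  have hnm := C.coprime
  have hn := C.one_lt_n
  have hd := C.d_pos
  have hd' : (0 : ℤ) < d := by exact_mod_cast hd
  have hgen : ∀ {i : ℕ}, i < d → ((genOrder d n m i ℓ : ℕ) : ℤ) ∈ C.Γ := by
    intro i hi
    rw [C.mem_Γ_iff, Int.cast_natCast, GenericBranch.gen, semigroupGen_genOrder C.coprime hi hℓ]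
  have hle : (m * ℓ + i * (m * n) : ℤ) ≤ r := by
    have h1 : ((genOrder d n m k ℓ : ℕ) : ZMod (d * n)) = ((τ₀ : ℤ) : ZMod (d * n)) := by
      rw [← Int.cast_natCast, ZMod.intCast_eq_intCast_iff_dvd_sub, hτ, genOrder]
      push_cast
      rw [show (d * r + k - (ℓ * (d * m) + k * (d * m * n + 1)) : ℤ) =
        d * (-(m * ℓ - r) - n * (k * m)) by ring]
      exact mul_dvd_mul_left _ (dvd_sub (dvd_neg.2 hr) (dvd_mul_right _ _))
    rw [C.mem_Γ_iff, ← h1, GenericBranch.gen, semigroupGen_genOrder C.coprime hk hℓ, hτ,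
      genOrder] at hΓ
    push_cast at hΓ
    have h2 : (d * (m * ℓ + k * (m * n)) : ℤ) ≤ d * r := by linarith
    have h3 := le_of_mul_le_mul_left h2 hd'
    have h4 : (i * (m * n) : ℤ) ≤ k * (m * n) := by
      have : (i : ℤ) ≤ k := by omega
      gcongr
    linarith
  refine le_trans ?_ hle
  rw [← D.mem_Psi_iff_rank_le hnm hn hd (hi.trans hk) hℓ (b := (genOrder d n m i ℓ : ℕ))]
  · have := D.add_mem_Psi_of_mem_Γ C (hgen (hi.trans hk)) (D.zero_mem_Psi hnm hn hd)
    rwa [add_zero] at this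
  · exact ⟨-(i * m), by ring⟩
  · rw [genOrder]
    push_cast
    ring

end RationalDyckPath

end

end

/-! ### Assembly of the proposition -/

theorem mainTheorem4 {d n m : ℕ} (C : GenericBranch d n m) (D : RationalDyckPath d n m)
    (τ₀ : ℕ) :
    -- the decomposition of `τ₀` exists and is unique
    (∃! q : ℕ × ℕ × ℤ, q.1 < d ∧ q.2.1 < n ∧ q.2.2 ≤ ((m * q.2.1 / n : ℕ) : ℤ) ∧
      (τ₀ : ℤ) = d * (m * q.2.1 - n * q.2.2) + q.1) ∧
    -- `Δ = Ψ_d(D)` is an admissible semimodule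
    D.Psi ∈ C.Adm ∧
    -- the dimension of the cell
    ((τ₀ : ℤ) ∈ D.Psi →
      topologicalKrullDim (C.cell D.Psi (τ₀ + D.size)) =
        ((D.specialBoxes.card + D.epsilonHat τ₀ : ℕ) : WithBot ℕ∞)) ∧
    ((τ₀ : ℤ) ∈ C.Γ → D.epsilon τ₀ = 0) ∧
    ∀ (r : ℤ) (k ℓ : ℕ) (h : ℤ), k < d → ℓ < n → h ≤ ((m * ℓ / n : ℕ) : ℤ) →
      r = m * ℓ - n * h → (τ₀ : ℤ) = d * r + k →
      -- membership
      ((τ₀ : ℤ) ∈ D.Psi ↔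
        h ≤ (D.y (D.perm ℓ k * n + ℓ) : ℤ) - (D.perm ℓ k : ℤ) * m) ∧
      ((τ₀ : ℤ) ∈ D.Psi ↔ D.rank (D.perm ℓ k * n + ℓ) ≤ r) ∧
      -- the two expressions for `ε_D` and for `ε̂_D`
      D.epsilon τ₀ =
        ((triangleBoxes d n m \ D.boxes).filter fun z =>
          boxRank n m z.1 z.2 = r ∧ D.enhancedRank z < τ₀).card ∧
      D.epsilon τ₀ =
        ((Finset.range k).filter fun i => r < D.rank (D.perm ℓ i * n + ℓ)).card ∧
      D.epsilonHat τ₀ =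
        ((triangleBoxes d n m \ D.boxes).filter fun z => boxRank n m z.1 z.2 < r).card +
          D.epsilon τ₀ := by
  have hnm := C.coprime
  have hn := C.one_lt_n
  have hd := C.d_pos
  have hn' : (0 : ℤ) < n := by omega
  have hd' : (0 : ℤ) < d := by omega
  have hdiv : ∀ {r : ℤ} {k : ℕ}, k < d → (τ₀ : ℤ) = d * r + k → ((τ₀ / d : ℕ) : ℤ) = r := by
    intro r k hk hτ
    rw [Int.natCast_div, hτ, Int.ediv_eq_iff_of_pos hd']
    constructor <;> linarith
  have heps : ∀ {r : ℤ} {k ℓ : ℕ}, k < d → ℓ < n → (n : ℤ) ∣ m * ℓ - r → (τ₀ : ℤ) = d * r + k →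
      D.epsilon τ₀ =
        ((Finset.range k).filter fun i => r < D.rank (D.perm ℓ i * n + ℓ)).card := by
    intro r k ℓ hk hℓ hr hτ
    rw [← D.card_filter_rank_eq hnm hn hd (hdiv hk hτ ▸ by positivity) hk hℓ hr, ← hτ,
      RationalDyckPath.epsilon, hdiv hk hτ]
  have hq := existsUnique_decomposition hnm (zero_lt_one.trans hn) hd τ₀
  refine ⟨hq, D.Psi_mem_Adm C, D.topologicalKrullDim_cell C, fun hΓ => ?_, ?_⟩
  · obtain ⟨⟨k, ℓ, h⟩, ⟨hk, hℓ, -, hτ⟩, -⟩ := hq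
    dsimp only at hk hℓ hτ
    have hr : (n : ℤ) ∣ m * ℓ - (m * ℓ - n * h) := ⟨h, by ring⟩
    rw [heps hk hℓ hr hτ, Finset.card_eq_zero, Finset.filter_eq_empty_iff]
    intro i hi
    rw [not_lt]
    exact D.rank_le_of_mem_Γ C hk hℓ hr hτ hΓ (Finset.mem_range.1 hi)
  · intro r k ℓ h hk hℓ _ hr hτ
    have hr' : (n : ℤ) ∣ m * ℓ - r := ⟨h, by rw [hr]; ring⟩
    have hmem := D.mem_Psi_iff_rank_le hnm hn hd hk hℓ hr' hτ
    have heps' : D.epsilon τ₀ =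
        ((triangleBoxes d n m \ D.boxes).filter fun z =>
          boxRank n m z.1 z.2 = r ∧ D.enhancedRank z < τ₀).card := by
      rw [RationalDyckPath.epsilon, hdiv hk hτ]
    refine ⟨?_, hmem, heps', heps hk hℓ hr' hτ, ?_⟩
    · rw [hmem, D.rank_eq, hr]
      push_cast
      constructor
      · intro h'
        refine le_of_mul_le_mul_left ?_ hn'
        linarith
      · intro h'
        have := mul_le_mul_of_nonneg_left h' hn'.le
        linarith
    · rw [heps', D.epsilonHat_eq hn hd hk hτ]
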